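/- **Setting.** Work over $\mathbb R$; let $n\ge 0$ and $d=n+1$. *Graph complex.* $\mathrm{Gra}_d(N)$ is the vector space spanned by directed multigraphs (tadpoles allowed) with vertices $1,\dots,N$ and totally ordered edges, modulo the relations: reversing an edge costs $(-1)^d$, permuting the edges by $\sigma$ costs $\mathrm{sgn}(\sigma)^{d+1}$. The partial composition $x\circ_1y$ inserts $y$ in the first vertex of $x$, summing over all ways of reconnecting the edge ends at that vertex to the vertices of $y$. The full graph complex is $\mathsf{fGC}_d=\prod_{N\ge1}\big(\mathrm{Gra}_d(N)\otimes\mathrm{sgn}_N^{\otimes d}\big)^{\mathbb S_N}$, a graph with $N$ vertices and $k$ edges having degree $d(N-1)+k(1-d)$, with differential $\delta=[\,\bullet\!\!-\!\!\bullet\,,\cdot\,]$, the graded commutator with the one-edge graph for the pre-Lie product obtained by summing $x\circ_1y$ over unshuffles of the vertex labels (with signature if $d$ is odd). *Geometry.* Let $\mathcal V$ be an NP-manifold of degree $n$ in Darboux coordinates: finitely many coordinates $z_a$ of degrees $|a|\ge0$, those of degree $0$ ranging over an open set (the base), and a constant nondegenerate Poisson tensor $\omega^{ab}$ of degree $-n$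 (i.e. $\omega^{ab}=0$ unless $|a|+|b|=n$) with $\omega^{ab}=(-1)^{d+|a||b|}\omega^{ba}$. The graded commutative algebra $C^\infty(\mathcal V)$ consists of the functions that are smooth in the coordinates of degree $0$, polynomial in those of positive even degree and exterior in those of odd degree, with the bracket $\{f,g\}=\sum_{a,b}(-1)^{|b||f|}\,\partial_af\;\omega^{ab}\,\partial_bg$. For a graph $\gamma\in\mathrm{Gra}_d(N)$ put $$\mathrm{Rep}^{(d)}_N(\gamma)(f_1\otimes\dots\otimes f_N)=\mu_N\Big(\prod_{(i,j)}\Delta_{ij}\,(f_1\otimes\dots\otimes f_N)\Big),\qquad \Delta_{ij}=\sum_{a,b}\omega^{ab}\,\partial^{(i)}_a\partial^{(j)}_b ,$$ where the product runs over the edges in their order, $\partial_a^{(i)}$ differentiates the $i$-th factor (with Koszul signs) and $\mu_N$ is multiplication. *Flows.* A Hamiltonian function is an $\mathscr H\in C^\infty(\mathcal V)$ of degree $d$ with $\{\mathscr H,\mathscr H\}=0$; $H^\bullet(C^\infty(\mathcal V)|\mathsf Q)$ is the cohomology of $\mathsf Q=\{\mathscr H,\cdot\}$. A (universal) Hamiltonian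 flow is a map assigning to every Hamiltonian function $\mathscr H$ a class $[\dot{\mathscr H}]\in H^d(C^\infty(\mathcal V)|\mathsf Q)$ for which there are finitely many $c_N\in\mathrm{Gra}_d(N)$, independent of $\mathscr H$, such that $\sum_N\mathrm{Rep}^{(d)}_N(c_N)(\mathscr H^{\otimes N})$ represents $[\dot{\mathscr H}]$ for all $\mathscr H$ and is a $\mathsf Q$-cocycle of degree $d$ for all Hamiltonian functions on all NP-manifolds of degree $n$ in Darboux coordinates; these flows form the vector space $\mathsf{Hflow}$. The flow is conformal if for every $\mathscr H$ there is a function $\Omega(\mathscr H)$ of degree $0$ (a function on the base) with $\{\mathscr H,\Omega(\mathscr H)\}=0$ and $[\dot{\mathscr H}]=[\Omega(\mathscr H)\cdot\mathscr H]$; these flows form $\mathsf{cHflow}\subset\mathsf{Hflow}$. Below, $H^\bullet_{\rm fin}(\mathsf{fGC}_d)\subset H^\bullet(\mathsf{fGC}_d)$ is the subspace of the classes represented by cocycles with finitely many nonzero components (for instance cocycles with a fixed number $N$ of vertices). **Proposition.** Let $n\ge0$, $d=n+1$, and let $\mathcal V$ be an NP-manifold of degree $n$ in Darboux coordinates. 1.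 For every cocycle $\gamma=(\gamma_N)_N\in\mathsf{fGC}_d$ of degree $-d$, every $N$ and every Hamiltonian function $\mathscr H$, the function $\mathrm{Rep}^{(d)}_N(\gamma_N)(\mathscr H^{\otimes N})$ is of degree $0$ and $\{\mathscr H,\mathrm{Rep}^{(d)}_N(\gamma_N)(\mathscr H^{\otimes N})\}=0$ (also for the summand of $\gamma_N$ with any given number of edges). Hence, if $\gamma$ has finitely many components, the same holds for $\Omega_\gamma(\mathscr H)=\sum_N\mathrm{Rep}^{(d)}_N(\gamma_N)(\mathscr H^{\otimes N})$. 2. There is a unique linear map $\Phi:H^{-d}_{\rm fin}(\mathsf{fGC}_d)\to\mathsf{cHflow}$ sending the class of every cocycle $\gamma$ with finitely many components to the flow $\dot{\mathscr H}=\Omega_\gamma(\mathscr H)\cdot\mathscr H$; in particular this flow is universal and its class depends only on the cohomology class of $\gamma$. 3. Likewise there is a unique linear map $\Phi_0:H^{0}_{\rm fin}(\mathsf{fGC}_d)\to\mathsf{Hflow}$ sending the class of every cocycle $\gamma$ of degree $0$ with finitely many components to the flow $\dot{\mathscr H}=\sum_N\mathrm{Rep}^{(d)}_N(\gamma_N)(\mathscr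 H^{\otimes N})$. 4. The map $\Phi_0$ is not surjective in general: for some $n$ and some $\mathcal V$ there is a conformal flow in the image of $\Phi$ that is not in the image of $\Phi_0$. -/

import Mathlib

open scoped TensorProduct ContDiff

noncomputable section

namespace GraphFlow

/-! ## Graphs and the graph operad -/

/-- Multidigraphs with vertex set `{0, …, N-1}` and `k` edges, the edges being ordered and directed:
edge number `e` goes from `(g e).1` to `(g e).2`.  Multiple edges and tadpoles are allowed. -/
abbrev LGraph (N k : ℕ) : Type := Fin k → Fin N × Fin N

namespace LGraph

/-- Reverse the direction of the edge `e`. -/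
def flip {N k : ℕ} (g : LGraph N k) (e : Fin k) : LGraph N k :=
  Function.update g e (g e).swap

/-- Permute the order of the edges. -/
def permEdges {N k : ℕ} (g : LGraph N k) (σ : Equiv.Perm (Fin k)) : LGraph N k :=
  fun e => g (σ e)

/-- Push the endpoints of all the edges forward along a map of vertex sets. -/
def mapVertices {N N' k : ℕ} (φ : Fin N → Fin N') (g : LGraph N k) : LGraph N' k :=
  fun e => (φ (g e).1, φ (g e).2)

end LGraph

/-- The relations of the graph operad: reversing an edge costs `(-1)^d`, permuting the edges by `σ`
costs `sgn(σ)^(d+1)`. -/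
def graRel (d N k : ℕ) : Submodule ℝ (LGraph N k →₀ ℝ) :=
  Submodule.span ℝ
    ({x | ∃ (g : LGraph N k) (e : Fin k),
        x = Finsupp.single (g.flip e) (1 : ℝ) - (-1 : ℝ) ^ d • Finsupp.single g (1 : ℝ)} ∪
     {x | ∃ (g : LGraph N k) (σ : Equiv.Perm (Fin k)),
        x = Finsupp.single (g.permEdges σ) (1 : ℝ)
          - ((Equiv.Perm.sign σ : ℤ) : ℝ) ^ (d + 1) • Finsupp.single g (1 : ℝ)})

/-- The summand with `k` edges of the arity `N` component of the graph operad `Gra_d`: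
linear combinations of graphs modulo the relations `graRel`. -/
abbrev Gra (d N k : ℕ) : Type := (LGraph N k →₀ ℝ) ⧸ graRel d N k

namespace Gra

/-- The class of a graph. -/
def mk (d : ℕ) {N k : ℕ} (g : LGraph N k) : Gra d N k :=
  (graRel d N k).mkQ (Finsupp.single g 1)

theorem mk_flip (d : ℕ) {N k : ℕ} (g : LGraph N k) (e : Fin k) :
    mk d (g.flip e) = (-1 : ℝ) ^ d • mk d g := by
  unfold mk
  rw [← map_smul, ← sub_eq_zero, ← map_sub, Submodule.mkQ_apply, Submodule.Quotient.mk_eq_zero]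
  exact Submodule.subset_span (Or.inl ⟨g, e, rfl⟩)

theorem mk_permEdges (d : ℕ) {N k : ℕ} (g : LGraph N k) (σ : Equiv.Perm (Fin k)) :
    mk d (g.permEdges σ) = ((Equiv.Perm.sign σ : ℤ) : ℝ) ^ (d + 1) • mk d g := by
  unfold mk
  rw [← map_smul, ← sub_eq_zero, ← map_sub, Submodule.mkQ_apply, Submodule.Quotient.mk_eq_zero]
  exact Submodule.subset_span (Or.inr ⟨g, σ, rfl⟩)

/-- A function on graphs with the symmetries of `Gra d` extends to a linear map on `Gra d`. -/
def lift {d N k : ℕ} {W : Type*} [AddCommGroup W] [Module ℝ W] (F : LGraph N k → W)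
    (hflip : ∀ g e, F (g.flip e) = (-1 : ℝ) ^ d • F g)
    (hperm : ∀ g σ, F (g.permEdges σ) = ((Equiv.Perm.sign σ : ℤ) : ℝ) ^ (d + 1) • F g) :
    Gra d N k →ₗ[ℝ] W :=
  (graRel d N k).liftQ (Finsupp.linearCombination ℝ F) (by
    rw [graRel, Submodule.span_le]
    rintro x (⟨g, e, rfl⟩ | ⟨g, σ, rfl⟩)
    · simp [hflip]
    · simp [hperm])

theorem lift_mk {d N k : ℕ} {W : Type*} [AddCommGroup W] [Module ℝ W] (F : LGraph N k → W)
    (hflip : ∀ g e, F (g.flip e) = (-1 : ℝ) ^ d • F g)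
    (hperm : ∀ g σ, F (g.permEdges σ) = ((Equiv.Perm.sign σ : ℤ) : ℝ) ^ (d + 1) • F g)
    (g : LGraph N k) : lift F hflip hperm (mk d g) = F g := by
  simp [lift, mk]

/-- Identification of the components along equalities of the numbers of vertices and edges. -/
def cast (d : ℕ) {N N' k k' : ℕ} (hN : N = N') (hk : k = k') : Gra d N k →ₗ[ℝ] Gra d N' k' := by
  subst hN hk
  exact LinearMap.id

theorem ext_mk {d N k : ℕ} {W : Type*} [AddCommGroup W] [Module ℝ W] {A B : Gra d N k →ₗ[ℝ] W}
    (h : ∀ g, A (mk d g) = B (mk d g)) : A = B := by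
  refine Submodule.linearMap_qext _ (Finsupp.lhom_ext' fun g => LinearMap.ext_ring ?_)
  exact h g

theorem mapVertices_flip {N N' k : ℕ} (φ : Fin N → Fin N') (g : LGraph N k) (e : Fin k) :
    (g.flip e).mapVertices φ = (g.mapVertices φ).flip e := by
  funext e'
  by_cases h : e' = e
  · subst h; simp [LGraph.flip, LGraph.mapVertices]
  · simp [LGraph.flip, LGraph.mapVertices, h]

/-- The right action of the symmetric group: the vertex label `i` becomes `σ⁻¹ i`. -/
def permVertices (d : ℕ) {N k : ℕ} (σ : Equiv.Perm (Fin N)) : Gra d N k →ₗ[ℝ] Gra d N k :=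
  lift (fun g => mk d (g.mapVertices ⇑(σ⁻¹)))
    (fun g e => by rw [mapVertices_flip, mk_flip])
    (fun g τ => by rw [← mk_permEdges]; rfl)

/-- The map of vertex sets collapsing the first `N` vertices to the first vertex. -/
def collapse (M N : ℕ) : Fin (N + M) → Fin (M + 1) :=
  Fin.addCases (fun _ => 0) (fun v => v.succ)

open Classical in
/-- Insertion of the graph `h` in place of the first vertex of the graph `g`: sum over all the ways of
reconnecting the edge ends at the first vertex of `g` to the vertices of `h`, that is, over all
graphs `g'` that become `g` when the vertices of `h` are collapsed to the first vertex.  The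
vertices of `h` come first, then the remaining vertices of `g`; the edges of `g` come first, then
those of `h`. -/
def insertGraph (d : ℕ) {M N j k : ℕ} (g : LGraph (M + 1) j) (h : LGraph N k) :
    Gra d (N + M) (j + k) :=
  ∑ g' : LGraph (N + M) j with g'.mapVertices (collapse M N) = g,
    mk d (Fin.append g' (h.mapVertices (Fin.castAdd M)))

theorem flip_flip {N k : ℕ} (g : LGraph N k) (e : Fin k) : (g.flip e).flip e = g := by
  simp [LGraph.flip]

theorem append_flip_left {N j k : ℕ} (g : LGraph N j) (h : LGraph N k) (e : Fin j) :
    (Fin.append (g.flip e) h : LGraph N (j + k)) =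
      LGraph.flip (Fin.append g h) (Fin.castAdd k e) := by
  funext e'
  refine Fin.addCases (fun i => ?_) (fun i => ?_) e'
  · by_cases hi : i = e
    · subst hi; simp [LGraph.flip]
    · simp [LGraph.flip, Function.update_of_ne, hi]
  · have : Fin.natAdd j i ≠ Fin.castAdd k e := by
      intro h; have := congrArg Fin.val h; simp at this; omega
    simp [LGraph.flip, Function.update_of_ne, this]

theorem append_flip_right {N j k : ℕ} (g : LGraph N j) (h : LGraph N k) (e : Fin k) :
    (Fin.append g (h.flip e) : LGraph N (j + k)) =
      LGraph.flip (Fin.append g h) (Fin.natAdd j e) := by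
  funext e'
  refine Fin.addCases (fun i => ?_) (fun i => ?_) e'
  · have : Fin.castAdd k i ≠ Fin.natAdd j e := by
      intro h; have := congrArg Fin.val h; simp at this; omega
    simp [LGraph.flip, Function.update_of_ne, this]
  · by_cases hi : i = e
    · subst hi; simp [LGraph.flip]
    · simp [LGraph.flip, Function.update_of_ne, hi]

theorem append_permEdges {N j k : ℕ} (g : LGraph N j) (h : LGraph N k)
    (σ : Equiv.Perm (Fin j)) (τ : Equiv.Perm (Fin k)) :
    (Fin.append (g.permEdges σ) (h.permEdges τ) : LGraph N (j + k)) =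
      LGraph.permEdges (Fin.append g h)
        (finSumFinEquiv.permCongr (Equiv.Perm.sumCongr σ τ)) := by
  funext e'
  refine Fin.addCases (fun i => ?_) (fun i => ?_) e' <;>
    simp [LGraph.permEdges, Equiv.permCongr_apply]

theorem insertGraph_flip_left (d : ℕ) {M N j k : ℕ} (g : LGraph (M + 1) j) (h : LGraph N k)
    (e : Fin j) : insertGraph d (g.flip e) h = (-1 : ℝ) ^ d • insertGraph d g h := by
  classical
  unfold insertGraph
  rw [Finset.smul_sum]
  refine Finset.sum_bij' (fun g' _ => g'.flip e) (fun g' _ => g'.flip e) ?_ ?_ ?_ ?_ ?_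
  · intro a ha
    simp only [Finset.mem_filter, Finset.mem_univ, true_and] at ha ⊢
    rw [mapVertices_flip, ha, flip_flip]
  · intro a ha
    simp only [Finset.mem_filter, Finset.mem_univ, true_and] at ha ⊢
    rw [mapVertices_flip, ha]
  · intro a _; exact flip_flip a e
  · intro a _; exact flip_flip a e
  · intro a _
    rw [append_flip_left, mk_flip, smul_smul, ← mul_pow]
    simp

theorem insertGraph_flip_right (d : ℕ) {M N j k : ℕ} (g : LGraph (M + 1) j) (h : LGraph N k)
    (e : Fin k) : insertGraph d g (h.flip e) = (-1 : ℝ) ^ d • insertGraph d g h := by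
  classical
  unfold insertGraph
  rw [Finset.smul_sum]
  refine Finset.sum_congr rfl fun a _ => ?_
  rw [mapVertices_flip, append_flip_right, mk_flip]

theorem insertGraph_permEdges_left (d : ℕ) {M N j k : ℕ} (g : LGraph (M + 1) j) (h : LGraph N k)
    (σ : Equiv.Perm (Fin j)) : insertGraph d (g.permEdges σ) h =
      ((Equiv.Perm.sign σ : ℤ) : ℝ) ^ (d + 1) • insertGraph d g h := by
  classical
  unfold insertGraph
  rw [Finset.smul_sum]
  symm
  refine Finset.sum_bij' (fun g' _ => LGraph.permEdges g' σ)
    (fun g' _ => LGraph.permEdges g' σ⁻¹) ?_ ?_ ?_ ?_ ?_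
  · intro a ha
    simp only [Finset.mem_filter, Finset.mem_univ, true_and] at ha ⊢
    rw [← ha]; rfl
  · intro a ha
    simp only [Finset.mem_filter, Finset.mem_univ, true_and] at ha ⊢
    have : (LGraph.permEdges a σ⁻¹).mapVertices (collapse M N) =
        (a.mapVertices (collapse M N)).permEdges σ⁻¹ := rfl
    rw [this, ha]; funext i; simp [LGraph.permEdges]
  · intro a _; funext i; simp [LGraph.permEdges]
  · intro a _; funext i; simp [LGraph.permEdges]
  · intro a _
    have := append_permEdges a (h.mapVertices (Fin.castAdd M)) σ 1
    have h1 : LGraph.permEdges (h.mapVertices (Fin.castAdd M)) (1 : Equiv.Perm (Fin k)) =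
      h.mapVertices (Fin.castAdd M) := rfl
    rw [h1] at this
    rw [this, mk_permEdges]
    simp

theorem insertGraph_permEdges_right (d : ℕ) {M N j k : ℕ} (g : LGraph (M + 1) j)
    (h : LGraph N k) (σ : Equiv.Perm (Fin k)) : insertGraph d g (h.permEdges σ) =
      ((Equiv.Perm.sign σ : ℤ) : ℝ) ^ (d + 1) • insertGraph d g h := by
  classical
  unfold insertGraph
  rw [Finset.smul_sum]
  refine Finset.sum_congr rfl fun a _ => ?_
  have := append_permEdges a (h.mapVertices (Fin.castAdd M)) 1 σ
  have h1 : LGraph.permEdges a (1 : Equiv.Perm (Fin j)) = a := rfl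
  rw [h1] at this
  have h2 : (h.permEdges σ).mapVertices (Fin.castAdd M) =
    (h.mapVertices (Fin.castAdd M)).permEdges σ := rfl
  rw [h2, this, mk_permEdges]
  simp

/-- The partial composition `x ∘₁ y` (insertion in the first vertex) of the graph operad. -/
def comp₁ (d : ℕ) {M N j k : ℕ} :
    Gra d (M + 1) j →ₗ[ℝ] Gra d N k →ₗ[ℝ] Gra d (N + M) (j + k) :=
  lift (fun g => lift (fun h => insertGraph d g h) (insertGraph_flip_right d g)
      (insertGraph_permEdges_right d g))
    (fun g e => ext_mk fun h => by
      rw [lift_mk, LinearMap.smul_apply, lift_mk, insertGraph_flip_left])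
    (fun g σ => ext_mk fun h => by
      rw [lift_mk, LinearMap.smul_apply, lift_mk, insertGraph_permEdges_left])

/-- `σ` is an unshuffle of type `(p, q)`: its inverse is increasing on the first `p` and on the last `q`
labels. -/
def IsUnshuffle {p q : ℕ} (σ : Equiv.Perm (Fin (p + q))) : Prop :=
  (StrictMono fun i : Fin p => σ⁻¹ (Fin.castAdd q i)) ∧
    StrictMono fun i : Fin q => σ⁻¹ (Fin.natAdd p i)

open Classical in
/-- The pre-Lie product of the full graph complex (`x` has `M + 1` vertices, `y` has `N`). -/
def preLie (d : ℕ) {M N j k : ℕ} :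
    Gra d (M + 1) j →ₗ[ℝ] Gra d N k →ₗ[ℝ] Gra d (N + M) (j + k) :=
  ∑ σ : Equiv.Perm (Fin (N + M)) with IsUnshuffle σ,
    ((Equiv.Perm.sign σ : ℤ) : ℝ) ^ d • (comp₁ d).compr₂ (permVertices d σ)

end Gra

/-! ## The full graph complex -/

/-- The degree in `fGC_d` of a graph with `N + 1` vertices and `k` edges. -/
def fgcDegree (d N k : ℕ) : ℤ := (d : ℤ) * N + k * (1 - (d : ℤ))

/-- The graded commutator of the pre-Lie product. -/
def Gra.bracket (d : ℕ) {M N j k : ℕ} (x : Gra d (M + 1) j) :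
    Gra d (N + 1) k →ₗ[ℝ] Gra d (M + N + 1) (j + k) :=
  Gra.cast d (by omega) rfl ∘ₗ Gra.preLie d x
    - ((-1 : ℝ) ^ (fgcDegree d M j * fgcDegree d N k)) •
      (Gra.cast d (by omega) (by omega) ∘ₗ (Gra.preLie d).flip x)

/-- The graph with two vertices and one edge, the Maurer-Cartan element of `fGC_d`. -/
def Gra.edge (d : ℕ) : Gra d (1 + 1) 1 := Gra.mk d fun _ => (0, 1)

/-- Families `(c N k)` of elements of `Gra_d`, the member `c N k` having `N + 1 ≥ 1` vertices and `k`
edges. -/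
def GraFamily (d : ℕ) : Type := (N k : ℕ) → Gra d (N + 1) k

instance (d : ℕ) : AddCommGroup (GraFamily d) :=
  inferInstanceAs (AddCommGroup ((N k : ℕ) → Gra d (N + 1) k))

instance (d : ℕ) : Module ℝ (GraFamily d) :=
  inferInstanceAs (Module ℝ ((N k : ℕ) → Gra d (N + 1) k))

/-- The differential `δ = [edge, ·]`, which adds one vertex and one edge. -/
def diff (d : ℕ) : GraFamily d →ₗ[ℝ] GraFamily d where
  toFun c
    | 0, _ => 0
    | _ + 1, 0 => 0
    | N + 1, k + 1 => Gra.cast d (by omega) (by omega) (Gra.bracket d (Gra.edge d) (c N k))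
  map_add' c c' := by
    funext N k
    rcases N with _ | N
    · exact (add_zero (0 : Gra d (0 + 1) k)).symm
    rcases k with _ | k
    · exact (add_zero (0 : Gra d (N + 1 + 1) 0)).symm
    change Gra.cast d _ _ (Gra.bracket d (Gra.edge d) (c N k + c' N k)) = _
    rw [map_add, map_add]
    rfl
  map_smul' r c := by
    funext N k
    rcases N with _ | N
    · exact (smul_zero r : r • (0 : Gra d (0 + 1) k) = 0).symm
    rcases k with _ | k
    · exact (smul_zero r : r • (0 : Gra d (N + 1 + 1) 0) = 0).symm
    change Gra.cast d _ _ (Gra.bracket d (Gra.edge d) (r • c N k)) = _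
    rw [map_smul, map_smul]
    rfl

/-- The full graph complex `fGC_d`: families of elements that are invariant under permutations of the
vertices, twisted by the signature if `d` is odd. -/
def fGC (d : ℕ) : Submodule ℝ (GraFamily d) where
  carrier := {c | ∀ N k (σ : Equiv.Perm (Fin (N + 1))),
    Gra.permVertices d σ (c N k) = ((Equiv.Perm.sign σ : ℤ) : ℝ) ^ d • c N k}
  add_mem' {a b} ha hb N k σ := by
    change Gra.permVertices d σ (a N k + b N k) = _ • (a N k + b N k)
    rw [map_add, ha N k σ, hb N k σ, smul_add]
  zero_mem' N k σ := by
    change Gra.permVertices d σ 0 = _ • (0 : Gra d (N + 1) k)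
    rw [map_zero, smul_zero]
  smul_mem' r c hc N k σ := by
    change Gra.permVertices d σ (r • c N k) = _ • r • c N k
    rw [map_smul, hc N k σ, smul_comm]

/-- The cochains of degree `j` of the full graph complex. -/
def fgcCochains (d : ℕ) (j : ℤ) : Submodule ℝ (GraFamily d) where
  carrier := {c | c ∈ fGC d ∧ ∀ N k, fgcDegree d N k ≠ j → c N k = 0}
  add_mem' {a b} ha hb := ⟨add_mem ha.1 hb.1, fun N k h => by
    change a N k + b N k = 0
    rw [ha.2 N k h, hb.2 N k h, add_zero]⟩
  zero_mem' := ⟨zero_mem _, fun _ _ _ => rfl⟩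
  smul_mem' r c hc := ⟨Submodule.smul_mem _ r hc.1, fun N k h => by
    change r • c N k = 0
    rw [hc.2 N k h, smul_zero]⟩

/-- The cocycles of degree `j` of the full graph complex. -/
def fgcCocycles (d : ℕ) (j : ℤ) : Submodule ℝ (GraFamily d) :=
  fgcCochains d j ⊓ LinearMap.ker (diff d)

/-- The coboundaries of degree `j` of the full graph complex. -/
def fgcCoboundaries (d : ℕ) (j : ℤ) : Submodule ℝ (GraFamily d) :=
  (fgcCochains d (j - 1)).map (diff d)

/-- The cohomology `H^j(fGC_d)`. -/
abbrev fgcCohomology (d : ℕ) (j : ℤ) : Type :=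
  fgcCocycles d j ⧸ (fgcCoboundaries d j).comap (fgcCocycles d j).subtype

/-- The families with only finitely many nonzero members. -/
def finiteFamilies (d : ℕ) : Submodule ℝ (GraFamily d) where
  carrier := {c | {p : ℕ × ℕ | c p.1 p.2 ≠ 0}.Finite}
  add_mem' {a b} ha hb := (ha.union hb).subset fun p hp => by
    by_contra h
    rw [Set.mem_union, not_or] at h
    have h1 : a p.1 p.2 = 0 := not_not.1 h.1
    have h2 : b p.1 p.2 = 0 := not_not.1 h.2
    apply hp
    change a p.1 p.2 + b p.1 p.2 = 0
    rw [h1, h2, add_zero]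
  zero_mem' := Set.finite_empty.subset fun p hp => hp rfl
  smul_mem' r c hc := hc.subset fun p hp h => by
    apply hp
    change r • c p.1 p.2 = 0
    rw [h, smul_zero]

/-- The classes in `H^j(fGC_d)` that are represented by a cocycle with finitely many components, e.g. by a
cocycle all of whose graphs have `N` vertices, for some `N`. -/
def finiteCohomology (d : ℕ) (j : ℤ) : Submodule ℝ (fgcCohomology d j) :=
  ((finiteFamilies d).comap (fgcCocycles d j).subtype).map (Submodule.mkQ _)

/-- The class of a cocycle with finitely many components. -/
def cocycleClass {d : ℕ} {j : ℤ} (γ : fgcCocycles d j)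
    (hγ : (γ : GraFamily d) ∈ finiteFamilies d) : finiteCohomology d j :=
  ⟨Submodule.mkQ _ γ, Submodule.mem_map_of_mem hγ⟩

/-! ## Graded symplectic manifolds in Darboux coordinates -/

/-- An NP-manifold of degree `n` in Darboux coordinates: finitely many coordinates `z_a` of degrees
`deg a ≥ 0`; the coordinates of degree zero range over the open set `dom`, the other ones are
formal; the matrix `pairing` consists of the (constant) coefficients of the Poisson bracket, see
`DarbouxChart.bracket` below.  For Darboux coordinates `x, p, ψ, χ, ξ` the nonzero coefficients are
`±1` on the pairs `(x, p)`, `(p, x)`, `(ψ, χ)`, `(χ, ψ)` and `κ^{ab}` on the pairs `(ξ_a, ξ_b)`. -/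
structure DarbouxChart (n : ℕ) where
  /-- the number of coordinates -/
  r : ℕ
  /-- the degrees of the coordinates -/
  deg : Fin r → ℕ
  /-- the domain of the coordinates of degree zero, which is the base manifold -/
  dom : TopologicalSpace.Opens ({a : Fin r // deg a = 0} → ℝ)
  /-- the constant Poisson tensor -/
  pairing : Fin r → Fin r → ℝ
  /-- the Poisson tensor has degree `-n` -/
  pairing_degree : ∀ a b, pairing a b ≠ 0 → deg a + deg b = n
  /-- the Poisson tensor is graded (skew)symmetric -/
  pairing_symm : ∀ a b, pairing a b = (-1) ^ (n + 1 + deg a * deg b) * pairing b a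
  /-- the Poisson tensor is nondegenerate -/
  pairing_nondeg : IsUnit (Matrix.of pairing).det

/-- Extension by zero of a function on an open set. -/
def extendZero {ι : Type} (U : TopologicalSpace.Opens (ι → ℝ)) (f : U → ℝ) : (ι → ℝ) → ℝ :=
  Function.extend Subtype.val f 0

theorem extendZero_apply {ι : Type} (U : TopologicalSpace.Opens (ι → ℝ)) (f : U → ℝ) (x : U) :
    extendZero U f x = f x := Subtype.val_injective.extend_apply f 0 x

theorem extendZero_eqOn {ι : Type} (U : TopologicalSpace.Opens (ι → ℝ)) (f : U → ℝ)
    (F : (ι → ℝ) → ℝ) (h : ∀ x : U, f x = F x) : Set.EqOn (extendZero U f) F U := fun x hx => by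
  have := extendZero_apply U f ⟨x, hx⟩
  rw [h] at this
  exact this

/-- The algebra of smooth functions on an open subset of `ℝ^ι`. -/
def SmoothFun {ι : Type} [Fintype ι] (U : TopologicalSpace.Opens (ι → ℝ)) :
    Subalgebra ℝ (U → ℝ) where
  carrier := {f | ContDiffOn ℝ ∞ (extendZero U f) U}
  mul_mem' {f g} hf hg := (ContDiffOn.mul hf hg).congr
    (extendZero_eqOn U _ _ fun x => by simp [extendZero_apply])
  add_mem' {f g} hf hg := (ContDiffOn.add hf hg).congr
    (extendZero_eqOn U _ _ fun x => by simp [extendZero_apply])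
  algebraMap_mem' r := (contDiffOn_const (c := r)).congr
    (extendZero_eqOn U _ _ fun x => by simp)

theorem extendZero_add {ι : Type} (U : TopologicalSpace.Opens (ι → ℝ)) (f g : U → ℝ) :
    extendZero U (f + g) = extendZero U f + extendZero U g := by
  simp only [extendZero]
  rw [← Function.extend_add, add_zero]

theorem extendZero_smul {ι : Type} (U : TopologicalSpace.Opens (ι → ℝ)) (c : ℝ) (f : U → ℝ) :
    extendZero U (c • f) = c • extendZero U f := by
  simp only [extendZero]
  rw [← Function.extend_smul, smul_zero]

theorem smoothFun_differentiableAt {ι : Type} [Fintype ι] {U : TopologicalSpace.Opens (ι → ℝ)}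
    (f : SmoothFun U) (x : U) : DifferentiableAt ℝ (extendZero U f) x :=
  (ContDiffOn.contDiffAt f.2 (U.isOpen.mem_nhds x.2)).differentiableAt (by simp)

/-- The partial derivative of a smooth function in the direction of the coordinate `i`. -/
def SmoothFun.partialDeriv {ι : Type} [Fintype ι] [DecidableEq ι]
    (U : TopologicalSpace.Opens (ι → ℝ)) (i : ι) : SmoothFun U →ₗ[ℝ] SmoothFun U where
  toFun f := ⟨fun x => fderiv ℝ (extendZero U f) x (Pi.single i 1),
    ((ContDiffOn.fderiv_of_isOpen f.2 U.isOpen (m := ∞) (by simp)).clm_apply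
      contDiffOn_const).congr (extendZero_eqOn U _ _ fun _ => rfl)⟩
  map_add' f g := by
    ext x
    change fderiv ℝ (extendZero U (f + g : U → ℝ)) x _ = _
    rw [extendZero_add,
      fderiv_add (smoothFun_differentiableAt f x) (smoothFun_differentiableAt g x)]
    rfl
  map_smul' c f := by
    ext x
    change fderiv ℝ (extendZero U (c • f : U → ℝ)) x _ = _
    rw [extendZero_smul, fderiv_const_smul (smoothFun_differentiableAt f x)]
    rfl

namespace DarbouxChart

variable {n : ℕ} (V : DarbouxChart n)

/-- The coordinates of degree zero. -/
abbrev BaseIdx : Type := {a : Fin V.r // V.deg a = 0}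

/-- The coordinates of positive even degree. -/
abbrev EvenIdx : Type := {a : Fin V.r // V.deg a ≠ 0 ∧ Even (V.deg a)}

/-- The coordinates of odd degree. -/
abbrev OddIdx : Type := {a : Fin V.r // Odd (V.deg a)}

/-- The graded commutative algebra of functions: smooth in the coordinates of degree zero, polynomial in
those of positive even degree, and exterior in those of odd degree. -/
def Fun : Type :=
  SmoothFun V.dom ⊗[ℝ] (MvPolynomial V.EvenIdx ℝ ⊗[ℝ] ExteriorAlgebra ℝ (V.OddIdx → ℝ))

instance : Ring V.Fun := inferInstanceAs (Ring (SmoothFun V.dom ⊗[ℝ]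
  (MvPolynomial V.EvenIdx ℝ ⊗[ℝ] ExteriorAlgebra ℝ (V.OddIdx → ℝ))))

instance : Algebra ℝ V.Fun := inferInstanceAs (Algebra ℝ (SmoothFun V.dom ⊗[ℝ]
  (MvPolynomial V.EvenIdx ℝ ⊗[ℝ] ExteriorAlgebra ℝ (V.OddIdx → ℝ))))

/-- The product of a function on the base, a polynomial in the coordinates of positive even degree and an
element of the exterior algebra on the coordinates of odd degree. -/
def monom (f : SmoothFun V.dom) (p : MvPolynomial V.EvenIdx ℝ)
    (q : ExteriorAlgebra ℝ (V.OddIdx → ℝ)) : V.Fun :=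
  f ⊗ₜ[ℝ] (p ⊗ₜ[ℝ] q)

/-- The linear map on functions given by linear maps on the three tensor factors. -/
def mapFun (A : SmoothFun V.dom →ₗ[ℝ] SmoothFun V.dom)
    (B : MvPolynomial V.EvenIdx ℝ →ₗ[ℝ] MvPolynomial V.EvenIdx ℝ)
    (C : ExteriorAlgebra ℝ (V.OddIdx → ℝ) →ₗ[ℝ] ExteriorAlgebra ℝ (V.OddIdx → ℝ)) :
    Module.End ℝ V.Fun :=
  (TensorProduct.map A (TensorProduct.map B C) :
    SmoothFun V.dom ⊗[ℝ] (MvPolynomial V.EvenIdx ℝ ⊗[ℝ] ExteriorAlgebra ℝ (V.OddIdx → ℝ)) →ₗ[ℝ]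
      SmoothFun V.dom ⊗[ℝ] (MvPolynomial V.EvenIdx ℝ ⊗[ℝ] ExteriorAlgebra ℝ (V.OddIdx → ℝ)))

theorem mapFun_monom (A : SmoothFun V.dom →ₗ[ℝ] SmoothFun V.dom)
    (B : MvPolynomial V.EvenIdx ℝ →ₗ[ℝ] MvPolynomial V.EvenIdx ℝ)
    (C : ExteriorAlgebra ℝ (V.OddIdx → ℝ) →ₗ[ℝ] ExteriorAlgebra ℝ (V.OddIdx → ℝ))
    (f : SmoothFun V.dom) (p : MvPolynomial V.EvenIdx ℝ) (q : ExteriorAlgebra ℝ (V.OddIdx → ℝ)) :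
    V.mapFun A B C (V.monom f p q) = V.monom (A f) (B p) (C q) := rfl

/-- The homogeneous functions of degree `k`, spanned by the products of a function on the base with
monomials of degree `k` in the other coordinates. -/
def homogeneous (k : ℤ) : Submodule ℝ V.Fun :=
  Submodule.span ℝ {x | ∃ (f : SmoothFun V.dom) (m : V.EvenIdx →₀ ℕ) (l : List V.OddIdx),
    ((m.sum fun i e => e * V.deg i : ℕ) : ℤ) + ((l.map fun i => V.deg i).sum : ℕ) = k ∧
    x = V.monom f (MvPolynomial.monomial m 1)
      (l.map fun i => ExteriorAlgebra.ι ℝ (Pi.single i (1 : ℝ) : V.OddIdx → ℝ)).prod}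

/-- The parity operator `f ↦ (-1)^{|f|} f`. -/
def parity : Module.End ℝ V.Fun :=
  V.mapFun LinearMap.id LinearMap.id
    (CliffordAlgebra.involute (Q := (0 : QuadraticForm ℝ (V.OddIdx → ℝ)))).toLinearMap

/-- The (left) partial derivative with respect to the coordinate `z_a`. -/
def pd (a : Fin V.r) : Module.End ℝ V.Fun :=
  if h0 : V.deg a = 0 then
    V.mapFun (SmoothFun.partialDeriv V.dom ⟨a, h0⟩) LinearMap.id LinearMap.id
  else if he : Even (V.deg a) then
    V.mapFun LinearMap.id (MvPolynomial.pderiv (⟨a, h0, he⟩ : V.EvenIdx)).toLinearMap LinearMap.id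
  else
    V.mapFun LinearMap.id LinearMap.id
      (CliffordAlgebra.contractLeft (Q := (0 : QuadraticForm ℝ (V.OddIdx → ℝ)))
        (LinearMap.proj (⟨a, Nat.not_even_iff_odd.mp he⟩ : V.OddIdx)))

/-- The Poisson bracket
`{f, g} = ∑_{a, b} (-1)^{|z_b| |f|} (∂f/∂z_a) ω^{ab} (∂g/∂z_b)`. -/
def bracket : V.Fun →ₗ[ℝ] V.Fun →ₗ[ℝ] V.Fun :=
  ∑ a, ∑ b, V.pairing a b •
    (LinearMap.mul ℝ V.Fun).compl₁₂ (V.pd a * V.parity ^ V.deg b) (V.pd b)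

/-! ### The representation of the graph operad on functions -/

/-- The operator on the `N`-th tensor power of the functions that differentiates the `i`-th factor with respect to
`z_a`, with the Koszul sign rule. -/
def pdAt {N : ℕ} (i : Fin N) (a : Fin V.r) : Module.End ℝ (⨂[ℝ] _ : Fin N, V.Fun) :=
  PiTensorProduct.map fun j =>
    if j < i then V.parity ^ V.deg a else if j = i then V.pd a else 1

/-- The operator `Δ_{ij}` attached to an edge from the vertex `i` to the vertex `j`. -/
def edgeOp {N : ℕ} (i j : Fin N) : Module.End ℝ (⨂[ℝ] _ : Fin N, V.Fun) :=
  ∑ a, ∑ b, V.pairing a b • (V.pdAt i a * V.pdAt j b)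

/-- The ordered product of the operators of the edges of a graph. -/
def graphOp {N k : ℕ} (g : LGraph N k) : Module.End ℝ (⨂[ℝ] _ : Fin N, V.Fun) :=
  (List.ofFn fun e => V.edgeOp (g e).1 (g e).2).prod

/-- The multidifferential operator `f₁ ⊗ ⋯ ⊗ f_N ↦ μ_N (∏_{(i,j)} Δ_{ij} (f₁ ⊗ ⋯ ⊗ f_N))` of a graph. -/
def repGraph {N k : ℕ} (g : LGraph N k) : MultilinearMap ℝ (fun _ : Fin N => V.Fun) V.Fun :=
  (PiTensorProduct.lift (MultilinearMap.mkPiAlgebraFin ℝ N V.Fun) ∘ₗ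
    V.graphOp g).compMultilinearMap (PiTensorProduct.tprod ℝ)

theorem partialDeriv_comm {ι : Type} [Fintype ι] [DecidableEq ι]
    (U : TopologicalSpace.Opens (ι → ℝ)) (i j : ι) :
    SmoothFun.partialDeriv U i ∘ₗ SmoothFun.partialDeriv U j =
      SmoothFun.partialDeriv U j ∘ₗ SmoothFun.partialDeriv U i := by
  have key : ∀ (i j : ι) (f : SmoothFun U) (x : U),
      (SmoothFun.partialDeriv U i (SmoothFun.partialDeriv U j f)).1 x =
        fderiv ℝ (fderiv ℝ (extendZero U f)) x (Pi.single i 1) (Pi.single j 1) := by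
    intro i j f x
    have hnhds := U.isOpen.mem_nhds x.2
    have hd : DifferentiableAt ℝ (fderiv ℝ (extendZero U f)) x :=
      ((ContDiffOn.fderiv_of_isOpen f.2 U.isOpen (m := ∞) (by simp)).contDiffAt
        hnhds).differentiableAt (by simp)
    change fderiv ℝ (extendZero U (SmoothFun.partialDeriv U j f : U → ℝ)) x (Pi.single i 1) = _
    have heq : extendZero U (SmoothFun.partialDeriv U j f : U → ℝ) =ᶠ[nhds (x : ι → ℝ)]
        fun y => fderiv ℝ (extendZero U f) y (Pi.single j 1) :=
      Filter.eventuallyEq_of_mem hnhds (extendZero_eqOn U _ _ fun _ => rfl)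
    rw [heq.fderiv_eq, fderiv_clm_apply hd (differentiableAt_const _)]
    simp
  ext f x
  have hs : IsSymmSndFDerivAt ℝ (extendZero U f) x :=
    (ContDiffOn.contDiffAt f.2 (U.isOpen.mem_nhds x.2)).isSymmSndFDerivAt
      (by simp only [minSmoothness_of_isRCLikeNormedField]; exact WithTop.coe_le_coe.2 le_top)
  change (SmoothFun.partialDeriv U i (SmoothFun.partialDeriv U j f)).1 x =
    (SmoothFun.partialDeriv U j (SmoothFun.partialDeriv U i f)).1 x
  rw [key, key]
  exact hs _ _

theorem pderiv_comm {σ : Type} (i j : σ) :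
    (MvPolynomial.pderiv (R := ℝ) i).toLinearMap ∘ₗ (MvPolynomial.pderiv (R := ℝ) j).toLinearMap =
      (MvPolynomial.pderiv (R := ℝ) j).toLinearMap ∘ₗ
        (MvPolynomial.pderiv (R := ℝ) i).toLinearMap := by
  classical
  have : ⁅MvPolynomial.pderiv (R := ℝ) i, MvPolynomial.pderiv (R := ℝ) j⁆ = 0 := by
    apply MvPolynomial.derivation_ext
    intro k
    rw [Derivation.commutator_apply]
    simp only [MvPolynomial.pderiv_X, Derivation.zero_apply, Pi.single_apply]
    split_ifs <;> simp
  refine LinearMap.ext fun p => ?_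
  have h := DFunLike.congr_fun this p
  rw [Derivation.commutator_apply, Derivation.zero_apply, sub_eq_zero] at h
  exact h

theorem involute_contractLeft {M : Type} [AddCommGroup M] [Module ℝ M] (φ : Module.Dual ℝ M) :
    (CliffordAlgebra.involute (Q := (0 : QuadraticForm ℝ M))).toLinearMap ∘ₗ
        CliffordAlgebra.contractLeft φ =
      -(CliffordAlgebra.contractLeft φ ∘ₗ
        (CliffordAlgebra.involute (Q := (0 : QuadraticForm ℝ M))).toLinearMap) := by
  refine LinearMap.ext fun x => ?_
  simp only [LinearMap.comp_apply, LinearMap.neg_apply, AlgHom.toLinearMap_apply]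
  induction x using CliffordAlgebra.left_induction with
  | algebraMap r => simp [CliffordAlgebra.contractLeft_algebraMap]
  | add x y hx hy => simp [hx, hy, add_comm]
  | ι_mul x a hx =>
    rw [CliffordAlgebra.contractLeft_ι_mul]
    simp only [map_sub, map_smul, map_mul, CliffordAlgebra.involute_ι, hx, neg_mul, map_neg,
      CliffordAlgebra.contractLeft_ι_mul, mul_neg]
    abel

theorem fun_ext {A B : Module.End ℝ V.Fun}
    (h : ∀ f p q, A (V.monom f p q) = B (V.monom f p q)) : A = B := by
  refine LinearMap.ext fun x => ?_
  refine TensorProduct.induction_on (motive := fun x : V.Fun => A x = B x) x ?_ ?_ ?_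
  · exact (map_zero A).trans (map_zero B).symm
  · intro f y
    refine TensorProduct.induction_on (motive := fun y => A (f ⊗ₜ[ℝ] y : SmoothFun V.dom ⊗[ℝ] _) =
      B (f ⊗ₜ[ℝ] y : SmoothFun V.dom ⊗[ℝ] _)) y ?_ (fun p q => h f p q) ?_
    · rw [TensorProduct.tmul_zero]
      exact (map_zero A).trans (map_zero B).symm
    · intro y z hy hz
      rw [TensorProduct.tmul_add]
      exact ((map_add A _ _).trans (congrArg₂ _ hy hz)).trans (map_add B _ _).symm
  · intro y z hy hz
    exact ((map_add A _ _).trans (congrArg₂ _ hy hz)).trans (map_add B _ _).symm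

theorem mapFun_mul (A A' : SmoothFun V.dom →ₗ[ℝ] SmoothFun V.dom)
    (B B' : MvPolynomial V.EvenIdx ℝ →ₗ[ℝ] MvPolynomial V.EvenIdx ℝ)
    (C C' : ExteriorAlgebra ℝ (V.OddIdx → ℝ) →ₗ[ℝ] ExteriorAlgebra ℝ (V.OddIdx → ℝ)) :
    V.mapFun A B C * V.mapFun A' B' C' = V.mapFun (A ∘ₗ A') (B ∘ₗ B') (C ∘ₗ C') :=
  V.fun_ext fun _ _ _ => rfl

theorem mapFun_neg (A : SmoothFun V.dom →ₗ[ℝ] SmoothFun V.dom)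
    (B : MvPolynomial V.EvenIdx ℝ →ₗ[ℝ] MvPolynomial V.EvenIdx ℝ)
    (C : ExteriorAlgebra ℝ (V.OddIdx → ℝ) →ₗ[ℝ] ExteriorAlgebra ℝ (V.OddIdx → ℝ)) :
    V.mapFun A B (-C) = (-1 : ℝ) • V.mapFun A B C :=
  V.fun_ext fun f p q => by
    have h : ∀ (f : SmoothFun V.dom) (p : MvPolynomial V.EvenIdx ℝ)
        (q : ExteriorAlgebra ℝ (V.OddIdx → ℝ)), V.monom f p (-q) = (-1 : ℝ) • V.monom f p q := by
      intro f p q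
      rw [← neg_one_smul ℝ q]
      unfold monom
      rw [TensorProduct.tmul_smul, TensorProduct.tmul_smul]
      rfl
    exact h _ _ _

theorem parity_mul_pd (a : Fin V.r) :
    V.parity * V.pd a = (-1 : ℝ) ^ V.deg a • (V.pd a * V.parity) := by
  unfold pd parity
  split_ifs with h0 he
  · rw [h0, mapFun_mul, mapFun_mul, pow_zero, one_smul]
    rfl
  · rw [he.neg_one_pow, mapFun_mul, mapFun_mul, one_smul]
    rfl
  · rw [(Nat.not_even_iff_odd.mp he).neg_one_pow, mapFun_mul, mapFun_mul,
      involute_contractLeft, mapFun_neg]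

theorem contractLeft_contractLeft_neg {M : Type} [AddCommGroup M] [Module ℝ M]
    (φ ψ : Module.Dual ℝ M) :
    CliffordAlgebra.contractLeft (Q := (0 : QuadraticForm ℝ M)) φ ∘ₗ
        CliffordAlgebra.contractLeft ψ =
      -(CliffordAlgebra.contractLeft ψ ∘ₗ CliffordAlgebra.contractLeft φ) :=
  LinearMap.ext fun x => CliffordAlgebra.contractLeft_comm φ ψ x

theorem pd_comm (a b : Fin V.r) :
    V.pd a * V.pd b = (-1 : ℝ) ^ (V.deg a * V.deg b) • (V.pd b * V.pd a) := by
  have hsign : ((-1 : ℝ) ^ (V.deg a * V.deg b) = if Even (V.deg a) ∨ Even (V.deg b) then 1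
      else -1) := by
    rw [neg_one_pow_eq_ite]
    simp [Nat.even_mul]
  rw [hsign]
  unfold pd
  by_cases ha0 : V.deg a = 0 <;> by_cases hb0 : V.deg b = 0 <;>
  by_cases hae : Even (V.deg a) <;> by_cases hbe : Even (V.deg b) <;>
  simp only [ha0, hb0, hae, hbe, dif_pos, dif_neg, not_false_eq_true, mapFun_mul, true_or,
    or_true, if_true, or_self, if_false, one_smul, LinearMap.comp_id, LinearMap.id_comp, Even.zero]
  all_goals first
    | rw [partialDeriv_comm]
    | rw [pderiv_comm]
    | (rw [contractLeft_contractLeft_neg, mapFun_neg])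


theorem parity_pow_mul_pd (k : ℕ) (a : Fin V.r) :
    V.parity ^ k * V.pd a = (-1 : ℝ) ^ (V.deg a * k) • (V.pd a * V.parity ^ k) := by
  induction k with
  | zero => simp
  | succ k ih =>
    rw [pow_succ, mul_assoc, parity_mul_pd, mul_smul_comm, ← mul_assoc, ih, smul_mul_assoc,
      smul_smul, mul_assoc, ← pow_add]
    congr 2
    ring

theorem pairing_eq_zero {a b : Fin V.r} (h : V.deg a + V.deg b ≠ n) : V.pairing a b = 0 := by
  by_contra h'
  exact h (V.pairing_degree a b h')

theorem pdAt_comm_of_lt {N : ℕ} {i j : Fin N} (hij : i < j) (a b : Fin V.r) :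
    V.pdAt i a * V.pdAt j b = (-1 : ℝ) ^ (V.deg a * V.deg b) • (V.pdAt j b * V.pdAt i a) := by
  unfold pdAt
  rw [← PiTensorProduct.map_mul, ← PiTensorProduct.map_mul]
  set F : Fin N → Module.End ℝ V.Fun := fun k =>
    (if k < j then V.parity ^ V.deg b else if k = j then V.pd b else 1) *
      (if k < i then V.parity ^ V.deg a else if k = i then V.pd a else 1) with hF
  have key : (fun k => (if k < i then V.parity ^ V.deg a else if k = i then V.pd a else 1) *
      (if k < j then V.parity ^ V.deg b else if k = j then V.pd b else 1)) =
      Function.update F i ((-1 : ℝ) ^ (V.deg a * V.deg b) • F i) := by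
    funext k
    rcases lt_trichotomy k i with h | h | h
    · rw [Function.update_of_ne h.ne]
      simp only [hF, h, h.trans hij, if_true]
      exact ((Commute.refl V.parity).pow_pow _ _).eq
    · subst h
      rw [Function.update_self]
      simp only [hF, lt_irrefl, hij, if_true, if_false]
      rw [parity_pow_mul_pd, smul_smul, ← pow_add, (Even.add_self _).neg_one_pow, one_smul]
    · rw [Function.update_of_ne h.ne']
      simp only [hF, h.not_gt, h.ne', if_false, one_mul, mul_one]
  rw [key]
  have := PiTensorProduct.map_update_smul (R := ℝ) F i ((-1 : ℝ) ^ (V.deg a * V.deg b)) (F i)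
  rw [Function.update_eq_self] at this
  exact this

theorem pdAt_comm_self {N : ℕ} (i : Fin N) (a b : Fin V.r) :
    V.pdAt i a * V.pdAt i b = (-1 : ℝ) ^ (V.deg a * V.deg b) • (V.pdAt i b * V.pdAt i a) := by
  unfold pdAt
  rw [← PiTensorProduct.map_mul, ← PiTensorProduct.map_mul]
  set F : Fin N → Module.End ℝ V.Fun := fun k =>
    (if k < i then V.parity ^ V.deg b else if k = i then V.pd b else 1) *
      (if k < i then V.parity ^ V.deg a else if k = i then V.pd a else 1) with hF
  have key : (fun k => (if k < i then V.parity ^ V.deg a else if k = i then V.pd a else 1) *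
      (if k < i then V.parity ^ V.deg b else if k = i then V.pd b else 1)) =
      Function.update F i ((-1 : ℝ) ^ (V.deg a * V.deg b) • F i) := by
    funext k
    rcases lt_trichotomy k i with h | h | h
    · rw [Function.update_of_ne h.ne]
      simp only [hF, h, if_true]
      exact ((Commute.refl V.parity).pow_pow _ _).eq
    · subst h
      rw [Function.update_self]
      simp only [hF, lt_irrefl, if_true, if_false]
      exact V.pd_comm a b
    · rw [Function.update_of_ne h.ne']
      simp only [hF, h.not_gt, h.ne', if_false, one_mul]
  rw [key]
  have := PiTensorProduct.map_update_smul (R := ℝ) F i ((-1 : ℝ) ^ (V.deg a * V.deg b)) (F i)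
  rw [Function.update_eq_self] at this
  exact this

theorem pdAt_comm {N : ℕ} (i j : Fin N) (a b : Fin V.r) :
    V.pdAt i a * V.pdAt j b = (-1 : ℝ) ^ (V.deg a * V.deg b) • (V.pdAt j b * V.pdAt i a) := by
  rcases lt_trichotomy i j with h | h | h
  · exact V.pdAt_comm_of_lt h a b
  · subst h
    exact V.pdAt_comm_self i a b
  · rw [V.pdAt_comm_of_lt h b a, smul_smul, mul_comm (V.deg b), ← pow_add,
      (Even.add_self _).neg_one_pow, one_smul]

section EdgeSigns

variable {R : Type*} [Ring R] [Algebra ℝ R]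

theorem swap_relation {r n : ℕ} (deg : Fin r → ℕ) (w : Fin r → Fin r → ℝ)
    (hw : ∀ a b, w a b = (-1) ^ (n + 1 + deg a * deg b) * w b a) (X Y : Fin r → R)
    (h : ∀ a b, Y a * X b = (-1 : ℝ) ^ (deg a * deg b) • (X b * Y a)) :
    ∑ a, ∑ b, w a b • (Y a * X b) = (-1 : ℝ) ^ (n + 1) • ∑ a, ∑ b, w a b • (X a * Y b) := by
  rw [Finset.sum_comm, Finset.smul_sum]
  refine Finset.sum_congr rfl fun b _ => ?_
  rw [Finset.smul_sum]
  refine Finset.sum_congr rfl fun a _ => ?_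
  rw [h, hw, smul_smul, smul_smul, mul_right_comm, ← pow_add, add_assoc, pow_add,
    (Even.add_self (deg a * deg b)).neg_one_pow, mul_one]

theorem comm_relation {r n : ℕ} (deg : Fin r → ℕ) (w : Fin r → Fin r → ℝ)
    (hw : ∀ a b, w a b ≠ 0 → deg a + deg b = n) (X Y Z W : Fin r → R)
    (hXZ : ∀ a b, X a * Z b = (-1 : ℝ) ^ (deg a * deg b) • (Z b * X a))
    (hXW : ∀ a b, X a * W b = (-1 : ℝ) ^ (deg a * deg b) • (W b * X a))
    (hYZ : ∀ a b, Y a * Z b = (-1 : ℝ) ^ (deg a * deg b) • (Z b * Y a))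
    (hYW : ∀ a b, Y a * W b = (-1 : ℝ) ^ (deg a * deg b) • (W b * Y a)) :
    (∑ a, ∑ b, w a b • (X a * Y b)) * (∑ a, ∑ b, w a b • (Z a * W b)) =
      (-1 : ℝ) ^ n • ((∑ a, ∑ b, w a b • (Z a * W b)) * (∑ a, ∑ b, w a b • (X a * Y b))) := by
  have key : ∀ a b c e, (w a b • (X a * Y b)) * (w c e • (Z c * W e)) =
      (-1 : ℝ) ^ n • ((w c e • (Z c * W e)) * (w a b • (X a * Y b))) := by
    intro a b c e
    by_cases h1 : w a b = 0
    · simp [h1]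
    by_cases h2 : w c e = 0
    · simp [h2]
    have e1 : X a * Y b * (Z c * W e) =
        (-1 : ℝ) ^ ((deg a + deg b) * (deg c + deg e)) • (Z c * W e * (X a * Y b)) := by
      calc X a * Y b * (Z c * W e) = X a * (Y b * Z c) * W e := by simp only [mul_assoc]
        _ = (-1 : ℝ) ^ (deg b * deg c) • ((X a * Z c) * (Y b * W e)) := by
          rw [hYZ]; simp only [mul_smul_comm, smul_mul_assoc, mul_assoc]
        _ = (-1 : ℝ) ^ (deg b * deg c + deg a * deg c + deg b * deg e) •
            (Z c * (X a * W e) * Y b) := by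
          rw [hXZ, hYW]
          simp only [mul_smul_comm, smul_mul_assoc, mul_assoc, smul_smul, pow_add]
          congr 1
          ring
        _ = _ := by
          rw [hXW]
          simp only [mul_smul_comm, smul_mul_assoc, mul_assoc, smul_smul, ← pow_add]
          congr 2
          ring
    rw [hw a b h1, hw c e h2] at e1
    have e2 : (-1 : ℝ) ^ (n * n) = (-1) ^ n := by
      rcases Nat.even_or_odd n with h | h
      · rw [(h.mul_left n).neg_one_pow, h.neg_one_pow]
      · rw [(h.mul h).neg_one_pow, h.neg_one_pow]
    rw [e2] at e1
    rw [smul_mul_smul_comm, e1, smul_mul_smul_comm, smul_comm, mul_comm (w a b)]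
  simp only [← Fintype.sum_prod_type']
  rw [Finset.sum_mul_sum, Finset.sum_mul_sum, Finset.sum_comm, Finset.smul_sum]
  refine Finset.sum_congr rfl fun p _ => ?_
  rw [Finset.smul_sum]
  exact Finset.sum_congr rfl fun q _ => key _ _ _ _

theorem prod_ofFn_swap (ε : ℝ) : ∀ {k : ℕ} (X : Fin (k + 1) → R)
    (_ : ∀ e f, X e * X f = ε • (X f * X e)) (i : Fin k),
    (List.ofFn fun e => X (Equiv.swap i.castSucc i.succ e)).prod = ε • (List.ofFn X).prod
  | 0, _, _, i => i.elim0
  | k + 1, X, h, i => by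
    refine Fin.cases ?_ (fun i => ?_) i
    · rw [List.ofFn_succ, List.ofFn_succ, List.ofFn_succ (f := X), List.ofFn_succ]
      simp only [List.prod_cons, ← mul_assoc]
      have h1 : Equiv.swap (Fin.castSucc (0 : Fin (k + 1))) (Fin.succ 0) 0 = Fin.succ 0 :=
        Equiv.swap_apply_left _ _
      have h2 : Equiv.swap (Fin.castSucc (0 : Fin (k + 1))) (Fin.succ 0) (Fin.succ 0) = 0 :=
        Equiv.swap_apply_right _ _
      have h3 : ∀ j : Fin k, Equiv.swap (Fin.castSucc (0 : Fin (k + 1))) (Fin.succ 0)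
          (Fin.succ (Fin.succ j)) = Fin.succ (Fin.succ j) := fun j =>
        Equiv.swap_apply_of_ne_of_ne (Fin.succ_ne_zero _)
          (fun hh => Fin.succ_ne_zero _ (Fin.succ_injective _ hh))
      simp only [h1, h2, h3]
      rw [h, smul_mul_assoc]
    · rw [List.ofFn_succ, List.ofFn_succ (f := X)]
      simp only [List.prod_cons]
      have h1 : Equiv.swap (Fin.castSucc (Fin.succ i)) (Fin.succ (Fin.succ i)) 0 = 0 :=
        Equiv.swap_apply_of_ne_of_ne (Fin.castSucc_ne_zero_iff.mpr (Fin.succ_ne_zero _)).symm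
          (Fin.succ_ne_zero _).symm
      have h2 : ∀ j : Fin (k + 1), Equiv.swap (Fin.castSucc (Fin.succ i))
          (Fin.succ (Fin.succ i)) (Fin.succ j) =
            Fin.succ (Equiv.swap (Fin.castSucc i) (Fin.succ i) j) := fun j => by
        rw [← Fin.succ_castSucc]
        exact (Fin.succ_injective _).swap_apply _ _ _
      simp only [h1, h2]
      rw [prod_ofFn_swap ε (fun j => X (Fin.succ j)) (fun _ _ => h _ _) i, mul_smul_comm]

theorem prod_ofFn_perm (n : ℕ) {k : ℕ} (X : Fin k → R)
    (h : ∀ e f, X e * X f = (-1 : ℝ) ^ n • (X f * X e)) (σ : Equiv.Perm (Fin k)) :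
    (List.ofFn fun e => X (σ e)).prod =
      ((Equiv.Perm.sign σ : ℤ) : ℝ) ^ (n + 1 + 1) • (List.ofFn X).prod := by
  rcases k with _ | k
  · have : σ = 1 := Subsingleton.elim _ _
    subst this
    simp
  have hσ : σ ∈ Submonoid.closure
      (Set.range fun i : Fin k => Equiv.swap i.castSucc i.succ) := by
    rw [Equiv.Perm.mclosure_swap_castSucc_succ]
    trivial
  induction hσ using Submonoid.closure_induction generalizing X with
  | mem x hx =>
    obtain ⟨i, rfl⟩ := hx
    have hne : i.castSucc ≠ i.succ := (Fin.castSucc_lt_succ).ne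
    rw [prod_ofFn_swap _ X h i, Equiv.Perm.sign_swap hne]
    simp [pow_succ]
  | one => simp
  | mul x y _ _ hx hy =>
    have := hy (fun e => X (x e)) (fun _ _ => h _ _)
    simp only [Equiv.Perm.mul_apply]
    rw [this, hx X h, smul_smul, ← mul_pow, map_mul, mul_comm]
    push_cast
    rfl

end EdgeSigns

theorem edgeOp_swap {N : ℕ} (i j : Fin N) :
    V.edgeOp j i = (-1 : ℝ) ^ (n + 1) • V.edgeOp i j :=
  swap_relation V.deg V.pairing V.pairing_symm (V.pdAt i) (V.pdAt j) (V.pdAt_comm j i)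

theorem edgeOp_comm {N : ℕ} (i j k l : Fin N) :
    V.edgeOp i j * V.edgeOp k l = (-1 : ℝ) ^ n • (V.edgeOp k l * V.edgeOp i j) :=
  comm_relation V.deg V.pairing V.pairing_degree (V.pdAt i) (V.pdAt j) (V.pdAt k) (V.pdAt l)
    (V.pdAt_comm i k) (V.pdAt_comm i l) (V.pdAt_comm j k) (V.pdAt_comm j l)

theorem prod_ofFn_smul {R : Type*} [Ring R] [Algebra ℝ R] (c : ℝ) : ∀ {k : ℕ} (X Y : Fin k → R)
    (e : Fin k) (_ : Y e = c • X e) (_ : ∀ e', e' ≠ e → Y e' = X e'),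
    (List.ofFn Y).prod = c • (List.ofFn X).prod
  | 0, _, _, e, _, _ => e.elim0
  | k + 1, X, Y, e, h1, h2 => by
    rw [List.ofFn_succ, List.ofFn_succ (f := X), List.prod_cons, List.prod_cons]
    revert h1 h2
    refine Fin.cases (fun h1 h2 => ?_) (fun e h1 h2 => ?_) e
    · rw [h1, smul_mul_assoc]
      congr 4
      funext i
      exact h2 _ (Fin.succ_ne_zero i)
    · rw [h2 0 (Fin.succ_ne_zero e).symm, prod_ofFn_smul c (fun i => X i.succ)
        (fun i => Y i.succ) e h1 fun e' he => h2 _ fun h => he (Fin.succ_injective _ h),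
        mul_smul_comm]

theorem graphOp_flip {N k : ℕ} (g : LGraph N k) (e : Fin k) :
    V.graphOp (g.flip e) = (-1 : ℝ) ^ (n + 1) • V.graphOp g := by
  refine prod_ofFn_smul _ _ _ e ?_ fun e' he => ?_
  · simp only [LGraph.flip, Function.update_self, Prod.fst_swap, Prod.snd_swap]
    exact V.edgeOp_swap _ _
  · simp only [LGraph.flip, Function.update_of_ne he]

theorem graphOp_permEdges {N k : ℕ} (g : LGraph N k) (σ : Equiv.Perm (Fin k)) :
    V.graphOp (g.permEdges σ) =
      ((Equiv.Perm.sign σ : ℤ) : ℝ) ^ (n + 1 + 1) • V.graphOp g :=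
  prod_ofFn_perm n (fun e => V.edgeOp (g e).1 (g e).2) (fun _ _ => V.edgeOp_comm _ _ _ _) σ

theorem repGraph_congr {N k k' : ℕ} (g : LGraph N k) (g' : LGraph N k') (c : ℝ)
    (h : V.graphOp g' = c • V.graphOp g) : V.repGraph g' = c • V.repGraph g := by
  ext f
  exact (congrArg (PiTensorProduct.lift (MultilinearMap.mkPiAlgebraFin ℝ N V.Fun))
    (LinearMap.congr_fun h (PiTensorProduct.tprod ℝ f))).trans
    ((PiTensorProduct.lift (MultilinearMap.mkPiAlgebraFin ℝ N V.Fun)).map_smul c _)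

/-- The representation `Rep_N` of `Gra_d`, `d = n + 1`, on the functions of an NP-manifold of degree `n`. -/
def rep {N k : ℕ} :
    Gra (n + 1) N k →ₗ[ℝ] MultilinearMap ℝ (fun _ : Fin N => V.Fun) V.Fun :=
  Gra.lift V.repGraph (fun g e => V.repGraph_congr _ _ _ (V.graphOp_flip g e))
    (fun g σ => V.repGraph_congr _ _ _ (V.graphOp_permEdges g σ))

/-! ### Hamiltonian functions and Hamiltonian flows -/

/-- Evaluation of a family of graphs on a function:
`∑ Rep_N(c_N)(H ⊗ ⋯ ⊗ H)` for a family with finitely many nonzero members. -/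
def evalAt (c : GraFamily (n + 1)) (H : V.Fun) : V.Fun :=
  ∑ᶠ p : ℕ × ℕ, V.rep (c p.1 p.2) fun _ => H

/-- The Hamiltonian functions: the functions `H` of degree `n + 1` with `{H, H} = 0`. -/
def Ham : Type := {H : V.Fun // H ∈ V.homogeneous (n + 1) ∧ V.bracket H H = 0}

/-- The cocycles of degree `k` of the differential `Q = {H, ·}`. -/
def qCocycles (H : V.Ham) (k : ℤ) : Submodule ℝ V.Fun :=
  V.homogeneous k ⊓ LinearMap.ker (V.bracket H.1)

/-- The coboundaries of degree `k` of the differential `Q = {H, ·}`. -/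
def qCoboundaries (H : V.Ham) (k : ℤ) : Submodule ℝ V.Fun :=
  (V.homogeneous (k - 1)).map (V.bracket H.1)

/-- The cohomology `H^k(C^∞(V) | Q)` of the functions with differential `Q = {H, ·}`. -/
abbrev QCohomology (H : V.Ham) (k : ℤ) : Type :=
  V.qCocycles H k ⧸ (V.qCoboundaries H k).comap (V.qCocycles H k).subtype

/-- The function `f` is a cocycle of degree `k` and represents the class `c`. -/
def IsClassOf {H : V.Ham} {k : ℤ} (f : V.Fun) (c : V.QCohomology H k) : Prop :=
  ∃ hf : f ∈ V.qCocycles H k, c = Submodule.Quotient.mk ⟨f, hf⟩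

variable {V} in
theorem IsClassOf.add {H : V.Ham} {k : ℤ} {f f' : V.Fun} {c c' : V.QCohomology H k}
    (h : V.IsClassOf f c) (h' : V.IsClassOf f' c') : V.IsClassOf (f + f') (c + c') := by
  obtain ⟨hf, rfl⟩ := h
  obtain ⟨hf', rfl⟩ := h'
  exact ⟨add_mem hf hf', rfl⟩

variable {V} in
theorem IsClassOf.smul {H : V.Ham} {k : ℤ} {f : V.Fun} {c : V.QCohomology H k} (r : ℝ)
    (h : V.IsClassOf f c) : V.IsClassOf (r • f) (r • c) := by
  obtain ⟨hf, rfl⟩ := h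
  exact ⟨Submodule.smul_mem _ r hf, rfl⟩

variable {V} in
theorem isClassOf_zero {H : V.Ham} {k : ℤ} : V.IsClassOf (0 : V.Fun) (0 : V.QCohomology H k) :=
  ⟨zero_mem _, rfl⟩

theorem evalAt_support (c : GraFamily (n + 1)) (hc : c ∈ finiteFamilies (n + 1)) (H : V.Fun) :
    (Function.support fun p : ℕ × ℕ => V.rep (c p.1 p.2) fun _ => H).Finite := by
  refine Set.Finite.subset hc fun p hp h => hp ?_
  change V.rep (c p.1 p.2) (fun _ => H) = 0
  rw [h, map_zero]
  rfl

theorem evalAt_add (c c' : GraFamily (n + 1)) (hc : c ∈ finiteFamilies (n + 1))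
    (hc' : c' ∈ finiteFamilies (n + 1)) (H : V.Fun) :
    V.evalAt (c + c') H = V.evalAt c H + V.evalAt c' H := by
  unfold evalAt
  rw [← finsum_add_distrib (V.evalAt_support c hc H) (V.evalAt_support c' hc' H)]
  refine finsum_congr fun p => ?_
  change V.rep (c p.1 p.2 + c' p.1 p.2) _ = _
  rw [map_add]
  rfl

theorem evalAt_zero (H : V.Fun) : V.evalAt 0 H = 0 := by
  refine finsum_eq_zero_of_forall_eq_zero fun p => ?_
  change V.rep 0 _ = _
  rw [map_zero]
  rfl

theorem evalAt_smul (r : ℝ) (c : GraFamily (n + 1)) (hc : c ∈ finiteFamilies (n + 1))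
    (H : V.Fun) : V.evalAt (r • c) H = r • V.evalAt c H := by
  unfold evalAt
  rw [smul_finsum' r (V.evalAt_support c hc H)]
  refine finsum_congr fun p => ?_
  change V.rep (r • c p.1 p.2) _ = _
  rw [map_smul]
  rfl

/-- The universal Hamiltonian flows: the maps assigning to every Hamiltonian function `H` a class in
`H^{n+1}(C^∞(V) | {H, ·})` that is represented by a universal formula in `H`, that is, by the
evaluation at `H` of a fixed finite linear combination of graphs which yields cocycles on all
NP-manifolds of degree `n`. -/
def HFlow : Submodule ℝ (∀ H : V.Ham, V.QCohomology H (n + 1)) where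
  carrier := {F | ∃ c ∈ finiteFamilies (n + 1),
    (∀ (W : DarbouxChart n) (H : W.Ham), W.evalAt c H.1 ∈ W.qCocycles H (n + 1)) ∧
      ∀ H : V.Ham, V.IsClassOf (V.evalAt c H.1) (F H)}
  add_mem' := by
    rintro F F' ⟨c, hc, hW, h⟩ ⟨c', hc', hW', h'⟩
    refine ⟨c + c', add_mem hc hc', fun W H => ?_, fun H => ?_⟩
    · rw [W.evalAt_add c c' hc hc']
      exact add_mem (hW W H) (hW' W H)
    · rw [V.evalAt_add c c' hc hc']
      exact (h H).add (h' H)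
  zero_mem' := ⟨0, zero_mem _, fun W H => by
    rw [W.evalAt_zero]
    exact zero_mem _, fun H => by
    rw [V.evalAt_zero]
    exact isClassOf_zero⟩
  smul_mem' := by
    rintro r F ⟨c, hc, hW, h⟩
    refine ⟨r • c, Submodule.smul_mem _ r hc, fun W H => ?_, fun H => ?_⟩
    · rw [W.evalAt_smul r c hc]
      exact Submodule.smul_mem _ r (hW W H)
    · rw [V.evalAt_smul r c hc]
      exact (h H).smul r

/-- The conformal Hamiltonian flows: the universal Hamiltonian flows of the form `H ↦ Ω(H) · H` for a
function `Ω(H)` on the base (the functions of degree zero) with `{H, Ω(H)} = 0`. -/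
def cHFlow : Submodule ℝ V.HFlow where
  carrier := {F | ∃ Ω : V.Ham → V.Fun, ∀ H : V.Ham,
    Ω H ∈ V.homogeneous 0 ∧ V.bracket H.1 (Ω H) = 0 ∧ V.IsClassOf (Ω H * H.1) (F.1 H)}
  add_mem' := by
    rintro F F' ⟨Ω, h⟩ ⟨Ω', h'⟩
    refine ⟨fun H => Ω H + Ω' H, fun H => ⟨add_mem (h H).1 (h' H).1, ?_, ?_⟩⟩
    · rw [map_add, (h H).2.1, (h' H).2.1, add_zero]
    · rw [add_mul]
      exact (h H).2.2.add (h' H).2.2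
  zero_mem' := ⟨fun _ => 0, fun H => ⟨zero_mem _, map_zero _, by
    rw [zero_mul]
    exact isClassOf_zero⟩⟩
  smul_mem' := by
    rintro r F ⟨Ω, h⟩
    refine ⟨fun H => r • Ω H, fun H => ⟨Submodule.smul_mem _ r (h H).1, ?_, ?_⟩⟩
    · rw [map_smul, (h H).2.1, smul_zero]
    · rw [smul_mul_assoc]
      exact (h H).2.2.smul r

/-- `Φ` sends the class of a cocycle `γ` of degree zero to the flow `H ↦ [∑ Rep_N(γ_N)(H ⊗ ⋯ ⊗ H)]`. -/
def IsHamiltonianFlowMap (Φ : finiteCohomology (n + 1) 0 →ₗ[ℝ] V.HFlow) : Prop :=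
  ∀ (γ : fgcCocycles (n + 1) 0) (hγ : (γ : GraFamily (n + 1)) ∈ finiteFamilies (n + 1))
    (H : V.Ham), V.IsClassOf (V.evalAt γ H.1) ((Φ (cocycleClass γ hγ)).1 H)

/-- `Φ` sends the class of a cocycle `γ` of degree `-d`, `d = n + 1`, to the flow `H ↦ [Ω(H) · H]` with
conformal factor `Ω(H) = ∑ Rep_N(γ_N)(H ⊗ ⋯ ⊗ H)`. -/
def IsConformalFlowMap (Φ : finiteCohomology (n + 1) (-((n : ℤ) + 1)) →ₗ[ℝ] V.cHFlow) : Prop :=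
  ∀ (γ : fgcCocycles (n + 1) (-((n : ℤ) + 1)))
    (hγ : (γ : GraFamily (n + 1)) ∈ finiteFamilies (n + 1)) (H : V.Ham),
    V.IsClassOf (V.evalAt γ H.1 * H.1) ((Φ (cocycleClass γ hγ)).1.1 H)

end DarbouxChart

end GraphFlow

end

/-!
The representation turns an insertion of graphs into an insertion of multidifferential operators,
and the single edge acts as the Poisson bracket.  Hence on powers `H ⊗ ⋯ ⊗ H` with `{H, H} = 0` the
differential `δ = [edge, ·]` becomes `{H, ·}`, so that cocycles of graphs give cocycles of `Q` and
coboundaries give coboundaries.  For `γ` of degree `-d` the function `Ω_γ(H) · H` is again given by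
a universal formula, since multiplying by `H` amounts to adding an isolated vertex to every graph.

Nonsurjectivity is seen for `n = 2` over a point, with six coordinates `ξ₀, …, ξ₅` of degree one.
The theta graph is a cocycle of degree `-3`; on `H = s ξ₀ξ₁ξ₂ + t ξ₃ξ₄ξ₅` its conformal factor is
`6 (s² + t²)`, so the `ξ₀ξ₁ξ₂`-component of its flow is cubic and not additive in `(s, t)`.  This
component does not change within a class of `Q`-cohomology.  If a cocycle `γ` of degree zero gave
the same flow, its component with three vertices would produce this cubic expression; mixed terms in
`s` and `t` come only from graphs all of whose edges join the same two of the three vertices, and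
comparing coefficients in `δ γ = 0` shows that such graphs do not contribute to `γ`.
-/

noncomputable section

namespace GraphFlow

open CliffordAlgebra (involute involute_ι involute_involute contractLeft)

section ExteriorAlgebra

variable {R M : Type*} [CommRing R] [AddCommGroup M] [Module R M]

theorem contractLeft_mul {Q : QuadraticForm R M} (φ : Module.Dual R M) (x y : CliffordAlgebra Q) :
    contractLeft φ (x * y) = contractLeft φ x * y + involute x * contractLeft φ y := by
  induction x using CliffordAlgebra.left_induction with
  | algebraMap r =>
    rw [CliffordAlgebra.contractLeft_algebraMap_mul, CliffordAlgebra.contractLeft_algebraMap,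
      AlgHom.commutes, zero_mul, zero_add]
  | add x z hx hz => simp only [add_mul, map_add, hx, hz]; abel
  | ι_mul x v hx =>
    rw [mul_assoc, CliffordAlgebra.contractLeft_ι_mul, hx, CliffordAlgebra.contractLeft_ι_mul,
      map_mul, involute_ι, sub_mul, mul_add, smul_mul_assoc, neg_mul, neg_mul, ← mul_assoc,
      ← mul_assoc]
    abel

local notation "inv" => involute (Q := (0 : QuadraticForm R M))

theorem ι_mul_eq_involute_mul_ι (v : M) (y : ExteriorAlgebra R M) :
    ExteriorAlgebra.ι R v * y = inv y * ExteriorAlgebra.ι R v := by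
  induction y using CliffordAlgebra.left_induction with
  | algebraMap r => rw [AlgHom.commutes, ← Algebra.commutes]
  | add x y hx hy => rw [mul_add, hx, hy, map_add, add_mul]
  | ι_mul y w hy =>
    have anticomm : ExteriorAlgebra.ι R v * ExteriorAlgebra.ι R w =
        -(ExteriorAlgebra.ι R w * ExteriorAlgebra.ι R v) :=
      eq_neg_of_add_eq_zero_left (ExteriorAlgebra.ι_add_mul_swap v w)
    change ExteriorAlgebra.ι R v * (ExteriorAlgebra.ι R w * y) = _
    rw [← mul_assoc, anticomm, neg_mul, mul_assoc, hy, map_mul, involute_ι, neg_mul, neg_mul,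
      mul_assoc]

/- Graded commutativity without a choice of parities: on homogeneous `x` and `y` the signs of the
four terms add up to `2 (-1)^{|x| |y|}`. -/
theorem two_nsmul_mul_eq (x y : ExteriorAlgebra R M) :
    2 • (x * y) = y * x + inv y * x + y * inv x - inv y * inv x := by
  induction x using CliffordAlgebra.left_induction with
  | algebraMap r =>
    rw [AlgHom.commutes, Algebra.commutes r y]
    abel
  | add x z hx hz =>
    rw [add_mul, nsmul_add, hx, hz]
    simp only [map_add]
    noncomm_ring
  | ι_mul x v hx =>
    have mul_ι (z : ExteriorAlgebra R M) :
        z * ExteriorAlgebra.ι R v = ExteriorAlgebra.ι R v * inv z := by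
      rw [ι_mul_eq_involute_mul_ι, involute_involute]
    change 2 • (ExteriorAlgebra.ι R v * x * y) = y * (ExteriorAlgebra.ι R v * x) +
      inv y * (ExteriorAlgebra.ι R v * x) + y * inv (ExteriorAlgebra.ι R v * x) -
      inv y * inv (ExteriorAlgebra.ι R v * x)
    rw [map_mul, show inv (ExteriorAlgebra.ι R v) = -ExteriorAlgebra.ι R v from involute_ι v,
      mul_assoc, ← mul_smul_comm, hx]
    simp only [neg_mul, mul_neg, ← mul_assoc, mul_ι, involute_involute]
    simp only [mul_assoc, mul_add, mul_sub]
    abel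

end ExteriorAlgebra

theorem partialDeriv_mul {ι : Type} [Fintype ι] [DecidableEq ι]
    (U : TopologicalSpace.Opens (ι → ℝ)) (i : ι) (f g : SmoothFun U) :
    SmoothFun.partialDeriv U i (f * g) =
      SmoothFun.partialDeriv U i f * g + f * SmoothFun.partialDeriv U i g := by
  ext x
  have extend_mul : extendZero U (f * g : SmoothFun U) =ᶠ[nhds (x : ι → ℝ)]
      extendZero U f * extendZero U g :=
    Filter.eventuallyEq_of_mem (U.isOpen.mem_nhds x.2)
      (extendZero_eqOn U _ _ fun x => by simp [extendZero_apply])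
  change fderiv ℝ (extendZero U (f * g : SmoothFun U)) x (Pi.single i 1) =
    fderiv ℝ (extendZero U f) x (Pi.single i 1) * g.1 x +
      f.1 x * fderiv ℝ (extendZero U g) x (Pi.single i 1)
  rw [extend_mul.fderiv_eq,
    fderiv_mul (smoothFun_differentiableAt f x) (smoothFun_differentiableAt g x)]
  simp only [_root_.add_apply, _root_.smul_apply, extendZero_apply, smul_eq_mul]
  ring

namespace DarbouxChart

variable {n : ℕ} (V : DarbouxChart n)

/-! ### The graded algebra of functions -/

@[elab_as_elim]
theorem monom_induction {p : V.Fun → Prop} (x : V.Fun) (zero : p 0)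
    (monom : ∀ f q r, p (V.monom f q r)) (add : ∀ x y, p x → p y → p (x + y)) : p x := by
  refine TensorProduct.induction_on (motive := p) x zero (fun f y => ?_) add
  refine TensorProduct.induction_on
    (motive := fun y => p (f ⊗ₜ[ℝ] y : SmoothFun V.dom ⊗[ℝ] _)) y ?_ (fun p q => monom f p q) ?_
  · rw [TensorProduct.tmul_zero]
    exact zero
  · intro y z hy hz
    rw [TensorProduct.tmul_add]
    exact add _ _ hy hz

/-- The map `monom` as a trilinear map. -/
def monomₗ : SmoothFun V.dom →ₗ[ℝ] MvPolynomial V.EvenIdx ℝ →ₗ[ℝ]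
    ExteriorAlgebra ℝ (V.OddIdx → ℝ) →ₗ[ℝ] V.Fun :=
  TensorProduct.lcurry (.id ℝ) _ _ _ ∘ₗ TensorProduct.mk ℝ _ _

theorem monomₗ_apply (f p q) : V.monomₗ f p q = V.monom f p q := rfl

theorem monom_mul_monom (f f' p p' q q') :
    V.monom f p q * V.monom f' p' q' = V.monom (f * f') (p * p') (q * q') := by
  refine (Algebra.TensorProduct.tmul_mul_tmul f f' (p ⊗ₜ[ℝ] q) (p' ⊗ₜ[ℝ] q')).trans ?_
  rw [Algebra.TensorProduct.tmul_mul_tmul]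
  rfl

theorem one_eq_monom : (1 : V.Fun) = V.monom 1 1 1 := rfl

theorem parity_monom (f p q) : V.parity (V.monom f p q) =
    V.monom f p (involute (Q := (0 : QuadraticForm ℝ (V.OddIdx → ℝ))) q) := rfl

theorem parity_mul (x y : V.Fun) : V.parity (x * y) = V.parity x * V.parity y :=
  map_mul (Algebra.TensorProduct.map (AlgHom.id ℝ (SmoothFun V.dom))
    (Algebra.TensorProduct.map (AlgHom.id ℝ (MvPolynomial V.EvenIdx ℝ)) involute)) x y

theorem parity_one : V.parity 1 = 1 := by
  rw [one_eq_monom, parity_monom, map_one]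

theorem parity_mul_parity : V.parity * V.parity = 1 :=
  V.fun_ext fun f p q => by
    rw [Module.End.mul_apply, parity_monom, parity_monom, involute_involute, Module.End.one_apply]

theorem parity_pow_of_even {k : ℕ} (hk : Even k) : V.parity ^ k = 1 := by
  obtain ⟨m, rfl⟩ := hk
  rw [← two_mul, pow_mul, sq, parity_mul_parity, one_pow]

theorem parity_pow_of_odd {k : ℕ} (hk : Odd k) : V.parity ^ k = V.parity := by
  obtain ⟨m, rfl⟩ := hk
  rw [pow_succ, V.parity_pow_of_even (even_two_mul m), one_mul]

theorem parity_pow_mul (k : ℕ) (x y : V.Fun) :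
    (V.parity ^ k) (x * y) = (V.parity ^ k) x * (V.parity ^ k) y := by
  rcases Nat.even_or_odd k with hk | hk
  · simp only [V.parity_pow_of_even hk, Module.End.one_apply]
  · rw [V.parity_pow_of_odd hk, parity_mul]

theorem parity_pow_one (k : ℕ) : (V.parity ^ k) 1 = 1 := by
  rcases Nat.even_or_odd k with hk | hk
  · rw [V.parity_pow_of_even hk, Module.End.one_apply]
  · rw [V.parity_pow_of_odd hk, parity_one]

theorem two_nsmul_fun_mul_eq (x y : V.Fun) :
    2 • (x * y) = y * x + V.parity y * x + y * V.parity x - V.parity y * V.parity x := by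
  induction x using V.monom_induction with
  | zero => simp
  | add x x' h h' => rw [add_mul, nsmul_add, h, h']; simp only [map_add]; noncomm_ring
  | monom f p q =>
    induction y using V.monom_induction with
    | zero => simp
    | add y y' h h' => rw [mul_add, nsmul_add, h, h']; simp only [map_add]; noncomm_ring
    | monom f' p' q' =>
      simp only [parity_monom, monom_mul_monom]
      rw [mul_comm f' f, mul_comm p' p]
      simp only [← monomₗ_apply, ← map_add, ← map_sub, ← map_nsmul]
      rw [two_nsmul_mul_eq]

theorem pd_mul (a : Fin V.r) (x y : V.Fun) :
    V.pd a (x * y) = V.pd a x * y + (V.parity ^ V.deg a) x * V.pd a y := by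
  induction x using V.monom_induction with
  | zero => simp
  | add x x' h h' => rw [add_mul, map_add, h, h']; simp only [map_add, add_mul]; abel
  | monom f p q =>
    induction y using V.monom_induction with
    | zero => simp
    | add y y' h h' => rw [mul_add, map_add, h, h']; simp only [map_add, mul_add]; abel
    | monom f' p' q' =>
      unfold pd
      split_ifs with h0 he
      · rw [h0, pow_zero, Module.End.one_apply]
        simp only [monom_mul_monom, mapFun_monom, partialDeriv_mul, LinearMap.id_apply]
        simp only [← monomₗ_apply, map_add, LinearMap.add_apply]
      · rw [V.parity_pow_of_even he, Module.End.one_apply]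
        simp only [monom_mul_monom, mapFun_monom, LinearMap.id_apply, Derivation.coeFn_coe,
          Derivation.leibniz, smul_eq_mul]
        simp only [← monomₗ_apply, map_add, LinearMap.add_apply]
        rw [add_comm, mul_comm p']
      · rw [V.parity_pow_of_odd (Nat.not_even_iff_odd.mp he), parity_monom]
        simp only [monom_mul_monom, mapFun_monom, LinearMap.id_apply, contractLeft_mul]
        simp only [← monomₗ_apply, map_add]

theorem pd_one (a : Fin V.r) : V.pd a 1 = 0 := by
  simpa [parity_pow_one] using V.pd_mul a 1 1

/-! ### Degrees -/

/-- The coordinate `z_i` of odd degree as a function on the chart. -/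
def oddCoord (i : V.OddIdx) : V.Fun :=
  V.monom 1 1 (ExteriorAlgebra.ι ℝ (Pi.single i 1))

/-- The product of the coordinates of odd degree in the list `l`, in the exterior algebra. -/
def oddProd (l : List V.OddIdx) : ExteriorAlgebra ℝ (V.OddIdx → ℝ) :=
  (l.map fun i => ExteriorAlgebra.ι ℝ (Pi.single i (1 : ℝ) : V.OddIdx → ℝ)).prod

theorem homogeneous_eq_span (k : ℤ) :
    V.homogeneous k = Submodule.span ℝ {x | ∃ (f : SmoothFun V.dom) (m : V.EvenIdx →₀ ℕ)
      (l : List V.OddIdx), (Finsupp.weight (fun i : V.EvenIdx => V.deg i) m : ℤ) +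
        (l.map fun i : V.OddIdx => V.deg i).sum = k ∧
        V.monom f (MvPolynomial.monomial m 1) (V.oddProd l) = x} := by
  have coe_eq_map (l : List V.OddIdx) : (do let a ← l; pure (a : Fin V.r)) = l.map Subtype.val := by
    exact List.flatMap_pure_eq_map Subtype.val l
  simp only [homogeneous, coe_eq_map, List.map_map, eq_comm (b := V.monom _ _ _)]
  rfl

theorem monom_mem_homogeneous (f : SmoothFun V.dom) (m : V.EvenIdx →₀ ℕ) (l : List V.OddIdx)
    {k : ℤ} (hk : (Finsupp.weight (fun i : V.EvenIdx => V.deg i) m : ℤ) +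
      (l.map fun i : V.OddIdx => V.deg i).sum = k) :
    V.monom f (MvPolynomial.monomial m 1) (V.oddProd l) ∈ V.homogeneous k := by
  rw [homogeneous_eq_span]
  exact Submodule.subset_span ⟨f, m, l, hk, rfl⟩

variable {V} in
theorem homogeneous_le {k : ℤ} {S : Submodule ℝ V.Fun}
    (h : ∀ f m l, (Finsupp.weight (fun i : V.EvenIdx => V.deg i) m : ℤ) +
      (l.map fun i : V.OddIdx => V.deg i).sum = k →
        V.monom f (MvPolynomial.monomial m 1) (V.oddProd l) ∈ S) : V.homogeneous k ≤ S := by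
  rw [homogeneous_eq_span, Submodule.span_le]
  rintro _ ⟨f, m, l, hk, rfl⟩
  exact h f m l hk

instance homogeneous.gradedMonoid : SetLike.GradedMonoid V.homogeneous where
  one_mem := V.monom_mem_homogeneous 1 0 [] (by simp)
  mul_mem := by
    intro j k x y hx hy
    refine homogeneous_le (S := (V.homogeneous (j + k)).comap (LinearMap.mulRight ℝ y))
      (fun f m l hj => ?_) hx
    refine homogeneous_le (S := (V.homogeneous (j + k)).comap (LinearMap.mulLeft ℝ _))
      (fun f' m' l' hk => ?_) hy
    rw [Submodule.mem_comap, LinearMap.mulLeft_apply, monom_mul_monom, MvPolynomial.monomial_mul,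
      one_mul, oddProd, oddProd, ← List.prod_append, ← List.map_append]
    refine V.monom_mem_homogeneous _ _ (l ++ l') ?_
    rw [map_add, List.map_append, List.sum_append, ← hj, ← hk]
    push_cast
    ring

theorem homogeneous_eq_bot_of_neg {k : ℤ} (hk : k < 0) : V.homogeneous k = ⊥ :=
  eq_bot_iff.2 (homogeneous_le fun f m l h => by omega)

theorem oddCoord_mem_homogeneous (i : V.OddIdx) : V.oddCoord i ∈ V.homogeneous (V.deg i) := by
  simpa [oddProd, oddCoord] using V.monom_mem_homogeneous 1 0 [i] rfl

theorem parity_oddCoord (i : V.OddIdx) : V.parity (V.oddCoord i) = -V.oddCoord i := by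
  rw [oddCoord, parity_monom, ← monomₗ_apply, ← monomₗ_apply, ← map_neg]
  exact congrArg _ (involute_ι _)

theorem involute_oddProd (l : List V.OddIdx) :
    involute (Q := (0 : QuadraticForm ℝ (V.OddIdx → ℝ))) (V.oddProd l) =
      (-1 : ℝ) ^ (l.map fun i : V.OddIdx => V.deg i).sum • V.oddProd l := by
  induction l with
  | nil => simp [oddProd]
  | cons i l ih =>
    unfold oddProd at ih ⊢
    rw [List.map_cons, List.prod_cons, map_mul, ih, ExteriorAlgebra.ι, involute_ι, List.map_cons,
      List.sum_cons, pow_add, i.2.neg_one_pow]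
    simp

variable {V} in
theorem parity_apply_of_mem_homogeneous {k : ℤ} {x : V.Fun} (hx : x ∈ V.homogeneous k) :
    V.parity x = (-1 : ℝ) ^ k • x := by
  refine homogeneous_le (S := LinearMap.eqLocus V.parity ((-1 : ℝ) ^ k • LinearMap.id)) ?_ hx
  intro f m l hk
  have even_weight : Even (Finsupp.weight (fun i : V.EvenIdx => V.deg i) m) :=
    Finset.even_sum _ fun i _ => i.2.2.mul_left _
  rw [LinearMap.mem_eqLocus, parity_monom, involute_oddProd, ← monomₗ_apply, map_smul, ← hk,
    zpow_add₀ (by norm_num), zpow_natCast, zpow_natCast, even_weight.neg_one_pow, one_mul]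
  rfl

variable {V} in
theorem parity_pow_mem_homogeneous (j : ℕ) {k : ℤ} {x : V.Fun} (hx : x ∈ V.homogeneous k) :
    (V.parity ^ j) x ∈ V.homogeneous k := by
  rcases Nat.even_or_odd j with hj | hj
  · rwa [V.parity_pow_of_even hj]
  · rw [V.parity_pow_of_odd hj, parity_apply_of_mem_homogeneous hx]
    exact Submodule.smul_mem _ _ hx

theorem monom_contractLeft_oddProd_mem_homogeneous (a : V.OddIdx) (l : List V.OddIdx) :
    V.monom 1 1 (contractLeft (Q := (0 : QuadraticForm ℝ (V.OddIdx → ℝ)))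
      (LinearMap.proj a) (V.oddProd l)) ∈
        V.homogeneous ((l.map fun i : V.OddIdx => V.deg i).sum - V.deg a) := by
  induction l with
  | nil =>
    have contract_nil : contractLeft (Q := (0 : QuadraticForm ℝ (V.OddIdx → ℝ)))
        (LinearMap.proj a) (V.oddProd []) = 0 :=
      CliffordAlgebra.contractLeft_one (Q := (0 : QuadraticForm ℝ (V.OddIdx → ℝ))) _
    rw [contract_nil, ← monomₗ_apply, map_zero]
    exact zero_mem _
  | cons i l ih =>
    have oddProd_cons : V.oddProd (i :: l) =
      ExteriorAlgebra.ι ℝ (Pi.single i (1 : ℝ) : V.OddIdx → ℝ) * V.oddProd l := rfl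
    rw [oddProd_cons, ExteriorAlgebra.ι, CliffordAlgebra.contractLeft_ι_mul, ← monomₗ_apply,
      map_sub, map_smul, List.map_cons, List.sum_cons, Nat.cast_add]
    refine sub_mem ?_ ?_
    · by_cases h : i = a
      · subst h
        refine Submodule.smul_mem _ _ (V.monom_mem_homogeneous 1 0 l ?_)
        simp
      · rw [LinearMap.proj_apply, Pi.single_eq_of_ne (Ne.symm h), zero_smul]
        exact zero_mem _
    · have mul_mem := SetLike.mul_mem_graded (V.oddCoord_mem_homogeneous i) ih
      rwa [oddCoord, monom_mul_monom, one_mul, one_mul, ← add_sub_assoc] at mul_mem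

variable {V} in
theorem pd_mem_homogeneous (a : Fin V.r) {k : ℤ} {x : V.Fun} (hx : x ∈ V.homogeneous k) :
    V.pd a x ∈ V.homogeneous (k - V.deg a) := by
  refine homogeneous_le (S := (V.homogeneous (k - V.deg a)).comap (V.pd a)) ?_ hx
  rintro f m l rfl
  rw [Submodule.mem_comap]
  unfold pd
  split_ifs with h0 he
  · exact V.monom_mem_homogeneous _ m l (by rw [h0]; simp)
  · rw [mapFun_monom, Derivation.coeFn_coe, MvPolynomial.pderiv_monomial, one_mul]
    by_cases hm : m ⟨a, h0, he⟩ = 0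
    · rw [hm, Nat.cast_zero, MvPolynomial.monomial_zero, ← monomₗ_apply, map_zero]
      exact zero_mem _
    · rw [← mul_one ((m ⟨a, h0, he⟩ : ℕ) : ℝ), ← smul_eq_mul, ← MvPolynomial.smul_monomial,
        ← monomₗ_apply, map_smul]
      refine Submodule.smul_mem _ _ (V.monom_mem_homogeneous _ _ l ?_)
      rw [← Finsupp.weight_sub_single_add (w := fun i : V.EvenIdx => V.deg i) hm]
      push_cast
      ring
  · have mul_mem := SetLike.mul_mem_graded (V.monom_mem_homogeneous f m [] rfl)
      (V.monom_contractLeft_oddProd_mem_homogeneous ⟨a, Nat.not_even_iff_odd.mp he⟩ l)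
    rwa [monom_mul_monom, mul_one, mul_one, show V.oddProd [] = 1 from rfl, one_mul, List.map_nil,
      List.sum_nil, Nat.cast_zero, add_zero, ← add_sub_assoc] at mul_mem

end DarbouxChart

section TensorPower

open PiTensorProduct (tprod)

theorem comp_prod_ofFn {R X Y : Type*} [Semiring R] [AddCommMonoid X] [Module R X]
    [AddCommMonoid Y] [Module R Y] (m : X →ₗ[R] Y) {k : ℕ} (A : Fin k → Module.End R X)
    (B : Fin k → Module.End R Y) (h : ∀ e, m ∘ₗ A e = B e ∘ₗ m) :
    m ∘ₗ (List.ofFn A).prod = (List.ofFn B).prod ∘ₗ m := by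
  induction k with
  | zero => rfl
  | succ k ih =>
    rw [List.ofFn_succ, List.prod_cons, List.ofFn_succ, List.prod_cons, Module.End.mul_eq_comp,
      Module.End.mul_eq_comp, ← LinearMap.comp_assoc, h, LinearMap.comp_assoc,
      ih _ _ fun e => h e.succ, LinearMap.comp_assoc]

variable {R A : Type*} [CommSemiring R]

section Module

variable [AddCommMonoid A] [Module R A]

theorem tensorPower_hom_ext {X : Type*} [AddCommMonoid X] [Module R X] {N M : ℕ}
    {φ ψ : (⨂[R]^(N + M) A) →ₗ[R] X}
    (h : ∀ (f : Fin N → A) (f' : Fin M → A),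
      φ (tprod R (Fin.append f f')) = ψ (tprod R (Fin.append f f'))) : φ = ψ :=
  PiTensorProduct.ext <| MultilinearMap.ext fun f => by
    rw [← Fin.append_castAdd_natAdd (f := f)]
    exact h _ _

/-- The map `x ⊗ t ↦ x ⊗ t` that adjoins a tensor factor on the left. -/
def consTensor (M : ℕ) : A →ₗ[R] (⨂[R]^M A) →ₗ[R] ⨂[R]^(M + 1) A :=
  PiTensorProduct.lift.toLinearMap ∘ₗ
    (PiTensorProduct.tprod R (s := fun _ : Fin (M + 1) => A)).curryLeft

theorem consTensor_tprod {M : ℕ} (x : A) (f : Fin M → A) :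
    consTensor M x (tprod R f) = tprod R (Fin.cons x f : Fin (M + 1) → A) :=
  PiTensorProduct.lift.tprod _

/-- The map `t ↦ t ⊗ f'₁ ⊗ ⋯ ⊗ f'_M`. -/
def tensorRight (N : ℕ) {M : ℕ} (f' : Fin M → A) : (⨂[R]^N A) →ₗ[R] ⨂[R]^(N + M) A :=
  TensorPower.mulEquiv.toLinearMap ∘ₗ (TensorProduct.mk R _ _).flip (tprod R f')

theorem tensorRight_tprod {N M : ℕ} (f : Fin N → A) (f' : Fin M → A) :
    tensorRight N f' (tprod R f) = tprod R (Fin.append f f') :=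
  TensorPower.tprod_mul_tprod R f f'

end Module

variable [Semiring A] [Algebra R A]

/-- Multiplication of all the tensor factors. -/
def mulAll (N : ℕ) : (⨂[R]^N A) →ₗ[R] A :=
  PiTensorProduct.lift (MultilinearMap.mkPiAlgebraFin R N A)

theorem mulAll_tprod {N : ℕ} (f : Fin N → A) : mulAll N (tprod R f) = (List.ofFn f).prod := by
  rw [mulAll, PiTensorProduct.lift.tprod, MultilinearMap.mkPiAlgebraFin_apply]

/-- Multiplication of the first `N` tensor factors. -/
def merge (N M : ℕ) : (⨂[R]^(N + M) A) →ₗ[R] ⨂[R]^(M + 1) A :=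
  TensorProduct.lift (consTensor M ∘ₗ mulAll N) ∘ₗ TensorPower.mulEquiv.symm.toLinearMap

theorem merge_tprod {N M : ℕ} (f : Fin N → A) (f' : Fin M → A) :
    merge N M (tprod R (Fin.append f f')) =
      tprod R (Fin.cons (List.ofFn f).prod f' : Fin (M + 1) → A) := by
  rw [← TensorPower.tprod_mul_tprod, TensorPower.gMul_def, merge, LinearMap.comp_apply,
    LinearEquiv.coe_coe, LinearEquiv.symm_apply_apply, TensorProduct.lift.tmul,
    LinearMap.comp_apply, mulAll_tprod, consTensor_tprod]

theorem mulAll_merge {N M : ℕ} :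
    (mulAll (M + 1) ∘ₗ merge N M : (⨂[R]^(N + M) A) →ₗ[R] A) = mulAll (N + M) :=
  tensorPower_hom_ext fun f f' => by
    rw [LinearMap.comp_apply, merge_tprod, mulAll_tprod, mulAll_tprod, List.ofFn_cons,
      List.prod_cons, List.ofFn_fin_append, List.prod_append]

theorem merge_comp_tensorRight {N M : ℕ} (f' : Fin M → A) :
    (merge N M ∘ₗ tensorRight N f' : (⨂[R]^N A) →ₗ[R] ⨂[R]^(M + 1) A) =
      (consTensor M).flip (tprod R f') ∘ₗ mulAll N :=
  PiTensorProduct.ext <| MultilinearMap.ext fun f => by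
    simp only [LinearMap.compMultilinearMap_apply, LinearMap.comp_apply, tensorRight_tprod,
      merge_tprod, mulAll_tprod, LinearMap.flip_apply, consTensor_tprod]

end TensorPower

namespace Gra

@[elab_as_elim]
theorem mk_induction {d N k : ℕ} {p : Gra d N k → Prop} (x : Gra d N k) (zero : p 0)
    (add : ∀ x y, p x → p y → p (x + y)) (smul : ∀ (c : ℝ) x, p x → p (c • x))
    (mk : ∀ g, p (mk d g)) : p x := by
  obtain ⟨x, rfl⟩ := Submodule.mkQ_surjective _ x
  induction x using Finsupp.induction_linear with
  | zero => rw [map_zero]; exact zero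
  | add x y hx hy => rw [map_add]; exact add _ _ hx hy
  | single g c =>
    rw [← mul_one c, ← smul_eq_mul, ← Finsupp.smul_single, map_smul]
    exact smul c _ (mk g)

open Classical in
/-- The pairs of vertices lying over the pair `p`: the ways of reconnecting an edge with ends `p`
along the inverse of `φ`. -/
def fiber {N N' : ℕ} (φ : Fin N → Fin N') (p : Fin N' × Fin N') : Finset (Fin N × Fin N) :=
  ({u | φ u = p.1} : Finset (Fin N)) ×ˢ ({u | φ u = p.2} : Finset (Fin N))

theorem insertGraph_eq_sum_piFinset (d : ℕ) {M N j k : ℕ} (g : LGraph (M + 1) j)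
    (h : LGraph N k) : insertGraph d g h =
      ∑ g' ∈ Fintype.piFinset fun e => fiber (collapse M N) (g e),
        mk d (Fin.append g' (h.mapVertices (Fin.castAdd M))) := by
  classical
  refine Finset.sum_congr ?_ fun _ _ => rfl
  ext g'
  simp [fiber, LGraph.mapVertices, funext_iff, Prod.ext_iff]

theorem collapse_castAdd {M N : ℕ} (i : Fin N) : collapse M N (Fin.castAdd M i) = 0 :=
  Fin.addCases_left _

theorem collapse_natAdd {M N : ℕ} (j : Fin M) : collapse M N (Fin.natAdd N j) = j.succ :=
  Fin.addCases_right _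

end Gra

namespace DarbouxChart

variable {n : ℕ} (V : DarbouxChart n)

open PiTensorProduct (tprod)

theorem rep_mk {N k : ℕ} (g : LGraph N k) : V.rep (Gra.mk (n + 1) g) = V.repGraph g :=
  Gra.lift_mk _ _ _ _

theorem repGraph_apply {N k : ℕ} (g : LGraph N k) (f : Fin N → V.Fun) :
    V.repGraph g f = mulAll N (V.graphOp g (tprod ℝ f)) := rfl

/-- The tensor factors of `∂_a^{(i)} (f₁ ⊗ ⋯ ⊗ f_N)`: the `i`-th one is differentiated and the
Koszul sign is distributed over the preceding ones. -/
def pdTuple {N : ℕ} (i : Fin N) (a : Fin V.r) (f : Fin N → V.Fun) (j : Fin N) : V.Fun :=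
  if j < i then (V.parity ^ V.deg a) (f j) else if j = i then V.pd a (f j) else f j

theorem pdAt_tprod {N : ℕ} (i : Fin N) (a : Fin V.r) (f : Fin N → V.Fun) :
    V.pdAt i a (tprod ℝ f) = tprod ℝ (V.pdTuple i a f) := by
  rw [pdAt, PiTensorProduct.map_tprod]
  congr 1
  funext j
  unfold pdTuple
  split_ifs <;> rfl

theorem pdTuple_zero_cons {N : ℕ} (a : Fin V.r) (x : V.Fun) (f : Fin N → V.Fun) :
    V.pdTuple 0 a (Fin.cons x f : Fin (N + 1) → V.Fun) = Fin.cons (V.pd a x) f := by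
  funext j
  cases j using Fin.cases <;> simp [pdTuple]

theorem pdTuple_succ_cons {N : ℕ} (i : Fin N) (a : Fin V.r) (x : V.Fun) (f : Fin N → V.Fun) :
    V.pdTuple i.succ a (Fin.cons x f : Fin (N + 1) → V.Fun) =
      Fin.cons ((V.parity ^ V.deg a) x) (V.pdTuple i a f) := by
  funext j
  cases j using Fin.cases <;> simp [pdTuple]

theorem pdTuple_castAdd_append {N M : ℕ} (i : Fin N) (a : Fin V.r) (f : Fin N → V.Fun)
    (f' : Fin M → V.Fun) :
    V.pdTuple (Fin.castAdd M i) a (Fin.append f f') = Fin.append (V.pdTuple i a f) f' := by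
  funext j
  cases j using Fin.addCases with
  | left j => simp [pdTuple, (Fin.strictMono_castAdd M).lt_iff_lt]
  | right j =>
    have castAdd_lt : Fin.castAdd M i < Fin.natAdd N j := by
      simp only [Fin.lt_def, Fin.val_castAdd, Fin.val_natAdd]
      lia
    simp [pdTuple, castAdd_lt.not_gt, castAdd_lt.ne']

theorem pdTuple_natAdd_append {N M : ℕ} (i : Fin M) (a : Fin V.r) (f : Fin N → V.Fun)
    (f' : Fin M → V.Fun) :
    V.pdTuple (Fin.natAdd N i) a (Fin.append f f') =
      Fin.append (fun j => (V.parity ^ V.deg a) (f j)) (V.pdTuple i a f') := by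
  funext j
  cases j using Fin.addCases with
  | left j =>
    have castAdd_lt : Fin.castAdd M j < Fin.natAdd N i := by
      simp only [Fin.lt_def, Fin.val_castAdd, Fin.val_natAdd]
      lia
    simp [pdTuple, castAdd_lt]
  | right j => simp [pdTuple]

theorem parity_pow_prod (k : ℕ) {N : ℕ} (f : Fin N → V.Fun) :
    (V.parity ^ k) (List.ofFn f).prod = (List.ofFn fun j => (V.parity ^ k) (f j)).prod := by
  induction N with
  | zero => simp [parity_pow_one]
  | succ N ih => simp only [List.ofFn_succ, List.prod_cons, parity_pow_mul, ih]

theorem pd_prod (a : Fin V.r) {N : ℕ} (f : Fin N → V.Fun) :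
    V.pd a (List.ofFn f).prod = ∑ i, (List.ofFn (V.pdTuple i a f)).prod := by
  induction N with
  | zero => simp [pd_one]
  | succ N ih =>
    obtain ⟨x, f, rfl⟩ : ∃ x f', f = Fin.cons x f' := ⟨_, _, (Fin.cons_self_tail f).symm⟩
    simp only [List.ofFn_cons, List.prod_cons, pd_mul, ih, Fin.sum_univ_succ, Finset.mul_sum,
        pdTuple_zero_cons, pdTuple_succ_cons]

open Classical in
theorem merge_comp_sum_pdAt {N M : ℕ} (v : Fin (M + 1)) (a : Fin V.r) :
    merge N M ∘ₗ (∑ u with Gra.collapse M N u = v, V.pdAt u a) = V.pdAt v a ∘ₗ merge N M := by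
  refine tensorPower_hom_ext fun f f' => ?_
  simp only [LinearMap.comp_apply, LinearMap.sum_apply, map_sum, pdAt_tprod, merge_tprod]
  rw [Finset.sum_filter, Fin.sum_univ_add]
  simp only [Gra.collapse_castAdd, Gra.collapse_natAdd, pdTuple_castAdd_append,
    pdTuple_natAdd_append, merge_tprod]
  cases v using Fin.cases with
  | zero =>
    simp only [Fin.succ_ne_zero, if_true, if_false, Finset.sum_const_zero, add_zero,
      pdTuple_zero_cons, pd_prod, ← consTensor_tprod, map_sum, LinearMap.sum_apply]
  | succ v =>
    simp only [(Fin.succ_ne_zero v).symm, if_false, Finset.sum_const_zero, zero_add, Fin.succ_inj,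
      Finset.sum_ite_eq', Finset.mem_univ, if_true, pdTuple_succ_cons, parity_pow_prod]

theorem comp_sum_pairing {X Y : Type*} [AddCommGroup X] [Module ℝ X] [AddCommGroup Y]
    [Module ℝ Y] (m : X →ₗ[ℝ] Y) {P Q : Fin V.r → Module.End ℝ X}
    {P' Q' : Fin V.r → Module.End ℝ Y} (hP : ∀ a, m ∘ₗ P a = P' a ∘ₗ m)
    (hQ : ∀ a, m ∘ₗ Q a = Q' a ∘ₗ m) :
    m ∘ₗ (∑ a, ∑ b, V.pairing a b • (P a * Q b)) =
      (∑ a, ∑ b, V.pairing a b • (P' a * Q' b)) ∘ₗ m := by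
  ext x
  have hPx (a : Fin V.r) (y : X) : m (P a y) = P' a (m y) := LinearMap.congr_fun (hP a) y
  have hQx (a : Fin V.r) (y : X) : m (Q a y) = Q' a (m y) := LinearMap.congr_fun (hQ a) y
  simp only [LinearMap.comp_apply, LinearMap.sum_apply, LinearMap.smul_apply, map_sum, map_smul,
    Module.End.mul_apply, hPx, hQx]

theorem merge_comp_sum_edgeOp {N M : ℕ} (p : Fin (M + 1) × Fin (M + 1)) :
    merge N M ∘ₗ (∑ q ∈ Gra.fiber (Gra.collapse M N) p, V.edgeOp q.1 q.2) =
      V.edgeOp p.1 p.2 ∘ₗ merge N M := by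
  classical
  have sum_edgeOp : (∑ q ∈ Gra.fiber (Gra.collapse M N) p, V.edgeOp q.1 q.2) =
      ∑ a, ∑ b, V.pairing a b • ((∑ u with Gra.collapse M N u = p.1, V.pdAt u a) *
        ∑ u with Gra.collapse M N u = p.2, V.pdAt u b) := by
    simp only [edgeOp]
    rw [Finset.sum_comm]
    refine Finset.sum_congr rfl fun a _ => ?_
    rw [Finset.sum_comm]
    refine Finset.sum_congr rfl fun b _ => ?_
    rw [Finset.sum_mul_sum, ← Finset.sum_product', Finset.smul_sum, Gra.fiber]
  rw [sum_edgeOp]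
  exact V.comp_sum_pairing _ (V.merge_comp_sum_pdAt p.1) (V.merge_comp_sum_pdAt p.2)

theorem merge_comp_sum_graphOp {N M j : ℕ} (g : LGraph (M + 1) j) :
    merge N M ∘ₗ (∑ g' ∈ Fintype.piFinset fun e => Gra.fiber (Gra.collapse M N) (g e),
      V.graphOp g') = V.graphOp g ∘ₗ merge N M := by
  have expand := MultilinearMap.map_sum_finset
    (MultilinearMap.mkPiAlgebraFin ℝ j (Module.End ℝ (⨂[ℝ]^(N + M) V.Fun)))
    (fun _ (q : Fin (N + M) × Fin (N + M)) => V.edgeOp q.1 q.2)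
    (fun e => Gra.fiber (Gra.collapse M N) (g e))
  simp only [MultilinearMap.mkPiAlgebraFin_apply] at expand
  unfold graphOp
  rw [← expand]
  exact comp_prod_ofFn _ _ _ fun e => V.merge_comp_sum_edgeOp (g e)

theorem tensorRight_comp_pdAt {N M : ℕ} (f' : Fin M → V.Fun) (i : Fin N) (a : Fin V.r) :
    tensorRight N f' ∘ₗ V.pdAt i a = V.pdAt (Fin.castAdd M i) a ∘ₗ tensorRight N f' :=
  PiTensorProduct.ext <| MultilinearMap.ext fun f => by
    simp only [LinearMap.compMultilinearMap_apply, LinearMap.comp_apply, pdAt_tprod,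
      tensorRight_tprod, pdTuple_castAdd_append]

theorem tensorRight_comp_graphOp {N M k : ℕ} (f' : Fin M → V.Fun) (h : LGraph N k) :
    tensorRight N f' ∘ₗ V.graphOp h =
      V.graphOp (h.mapVertices (Fin.castAdd M)) ∘ₗ tensorRight N f' :=
  comp_prod_ofFn _ _ _ fun _ =>
    V.comp_sum_pairing _ (V.tensorRight_comp_pdAt f' _) (V.tensorRight_comp_pdAt f' _)

theorem graphOp_append {N j k : ℕ} (g : LGraph N j) (h : LGraph N k) :
    V.graphOp (Fin.append g h) = V.graphOp g * V.graphOp h := by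
  have edges : (fun e => V.edgeOp (Fin.append g h e).1 (Fin.append g h e).2) =
      Fin.append (fun e => V.edgeOp (g e).1 (g e).2) fun e => V.edgeOp (h e).1 (h e).2 := by
    funext e
    cases e using Fin.addCases <;> simp only [Fin.append_left, Fin.append_right]
  rw [graphOp, edges, List.ofFn_fin_append, List.prod_append, graphOp, graphOp]

theorem sum_repGraph_append {M N j k : ℕ} (g : LGraph (M + 1) j) (h : LGraph N k)
    (f : Fin N → V.Fun) (f' : Fin M → V.Fun) :
    ∑ g' ∈ Fintype.piFinset fun e => Gra.fiber (Gra.collapse M N) (g e),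
      V.repGraph (Fin.append g' (h.mapVertices (Fin.castAdd M))) (Fin.append f f') =
        V.repGraph g (Fin.cons (V.repGraph h f) f') := by
  have apply_h := LinearMap.congr_fun (V.tensorRight_comp_graphOp f' h) (tprod ℝ f)
  rw [LinearMap.comp_apply, LinearMap.comp_apply, tensorRight_tprod] at apply_h
  simp only [repGraph_apply, graphOp_append, Module.End.mul_apply, ← apply_h]
  rw [← map_sum, ← LinearMap.sum_apply, ← mulAll_merge, LinearMap.comp_apply,
    ← LinearMap.comp_apply (merge N M), merge_comp_sum_graphOp, LinearMap.comp_apply,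
    ← LinearMap.comp_apply (merge N M), merge_comp_tensorRight, LinearMap.comp_apply,
    LinearMap.flip_apply, consTensor_tprod]

theorem rep_comp₁ {M N j k : ℕ} (x : Gra (n + 1) (M + 1) j) (y : Gra (n + 1) N k)
    (f : Fin N → V.Fun) (f' : Fin M → V.Fun) :
    V.rep (Gra.comp₁ (n + 1) x y) (Fin.append f f') =
      V.rep x (Fin.cons (V.rep y f) f') := by
  induction x using Gra.mk_induction with
  | zero => simp
  | add x x' h h' => simp only [map_add, LinearMap.add_apply, _root_.add_apply, h, h']
  | smul c x h => simp only [map_smul, LinearMap.smul_apply, _root_.smul_apply, h]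
  | mk g =>
    induction y using Gra.mk_induction with
    | zero =>
      rw [map_zero, map_zero]
      exact (MultilinearMap.map_coord_zero _ 0 rfl).symm
    | add y y' h h' =>
      simp only [map_add, _root_.add_apply, h, h', MultilinearMap.cons_add]
    | smul c y h => simp only [map_smul, _root_.smul_apply, h, MultilinearMap.cons_smul]
    | mk h =>
      rw [Gra.comp₁, Gra.lift_mk, Gra.lift_mk, Gra.insertGraph_eq_sum_piFinset, map_sum,
        _root_.sum_apply]
      simp only [rep_mk]
      exact V.sum_repGraph_append g h f f'

end DarbouxChart

section KoszulSign

variable {R : Type*} [Ring R] [Algebra ℝ R]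

/-- The sign `(-1)^(p q)` in terms of the commuting involutions `P = (-1)^p` and `Q = (-1)^q`. -/
def koszulSign (P Q : R) : R :=
  (1 / 2 : ℝ) • (1 + P + Q - P * Q)

theorem koszulSign_comm {P Q : R} (hPQ : Commute P Q) : koszulSign P Q = koszulSign Q P := by
  rw [koszulSign, koszulSign, hPQ.eq, add_right_comm]

theorem koszulSign_mul_self {P Q : R} (hP : P * P = 1) (hQ : Q * Q = 1) (hPQ : Commute P Q) :
    koszulSign P Q * koszulSign P Q = 1 := by
  have hQP : Q * P = P * Q := hPQ.eq.symm
  have square : (1 + P + Q - P * Q) * (1 + P + Q - P * Q) = (4 : ℝ) • (1 : R) := by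
    have hPPQ (Z : R) : P * (P * Z) = Z := by rw [← mul_assoc, hP, one_mul]
    have hQPQ : Q * (P * Q) = P := by rw [hPQ.eq, ← mul_assoc, hQ, one_mul]
    simp only [mul_add, add_mul, mul_sub, sub_mul, mul_one, one_mul, hP, hQ, hQP, hPPQ, hQPQ,
      mul_assoc]
    module
  rw [koszulSign, smul_mul_smul_comm, square, smul_smul]
  norm_num

theorem koszulSign_semiconjBy {P Q P' Q' X : R} (hP : SemiconjBy X P P')
    (hQ : SemiconjBy X Q Q') : SemiconjBy X (koszulSign P Q) (koszulSign P' Q') := by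
  have h := (((SemiconjBy.one_right X).add_right hP).add_right hQ).sub_right (hP.mul_right hQ)
  rw [SemiconjBy, koszulSign, mul_smul_comm, h.eq, koszulSign, smul_mul_assoc]

theorem koszulSign_mul {P Q X : R} {k : ℕ} (hP : P * P = 1) (hPX : P * X = X * P)
    (hQX : Q * X = (-1 : ℝ) ^ k • (X * Q)) :
    koszulSign P Q * X = P ^ k * X * koszulSign P Q := by
  simp only [koszulSign, smul_mul_assoc, mul_smul_comm]
  congr 1
  rcases k.even_or_odd with hk | ⟨l, rfl⟩
  · obtain ⟨l, rfl⟩ := hk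
    rw [(Even.add_self l).neg_one_pow, one_smul] at hQX
    rw [← two_mul, pow_mul, pow_two, hP, one_pow, one_mul]
    simp only [mul_add, add_mul, mul_sub, sub_mul, mul_one, one_mul, mul_assoc, hQX, hPX]
    rw [← mul_assoc P X Q, hPX, mul_assoc]
  · rw [(odd_two_mul_add_one l).neg_one_pow, neg_one_smul] at hQX
    have hXP (Z : R) : X * (P * (P * Z)) = X * Z := by rw [← mul_assoc P, hP, one_mul]
    rw [pow_add, pow_mul, pow_two, hP, one_pow, one_mul, pow_one, hPX]
    simp only [mul_add, add_mul, mul_sub, sub_mul, mul_one, one_mul, mul_assoc, hQX, hPX, hP,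
      mul_neg, hXP]
    rw [← mul_assoc P X Q, hPX, mul_assoc]
    abel

theorem koszulSign_apply {M : Type*} [AddCommGroup M] [Module ℝ M] {P Q : Module.End ℝ M} {x : M}
    {ε δ : ℝ} (hP : P x = ε • x) (hQ : Q x = δ • x) :
    koszulSign P Q x = ((1 + ε + δ - ε * δ) / 2) • x := by
  simp only [koszulSign, LinearMap.smul_apply, LinearMap.sub_apply, LinearMap.add_apply,
    Module.End.one_apply, Module.End.mul_apply, hP, hQ, map_smul]
  module

end KoszulSign

theorem exists_prod_ofFn_eq {R : Type*} [Monoid R] {N : ℕ} (i : Fin N) (f : Fin (N + 1) → R) :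
    ∃ A B : R, ∀ g : Fin (N + 1) → R, (∀ k, k ≠ i.castSucc → k ≠ i.succ → g k = f k) →
      (List.ofFn g).prod = A * (g i.castSucc * g i.succ) * B := by
  induction N with
  | zero => exact i.elim0
  | succ N ih =>
    cases i using Fin.cases with
    | zero =>
      refine ⟨1, (List.ofFn fun j : Fin N => f j.succ.succ).prod, fun g hg => ?_⟩
      have tail_eq : (fun j : Fin N => g j.succ.succ) = fun j => f j.succ.succ :=
        funext fun j => hg _ (Fin.succ_ne_zero _) ((Fin.succ_injective _).ne (Fin.succ_ne_zero j))
      rw [List.ofFn_succ, List.ofFn_succ, List.prod_cons, List.prod_cons, tail_eq, one_mul,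
        mul_assoc]
      rfl
    | succ i =>
      obtain ⟨A, B, h⟩ := ih i fun j => f j.succ
      refine ⟨f 0 * A, B, fun g hg => ?_⟩
      have g_zero : g 0 = f 0 := 
        hg 0 (Fin.castSucc_ne_zero_iff.mpr (Fin.succ_ne_zero i)).symm (Fin.succ_ne_zero _).symm
      rw [List.ofFn_succ, List.prod_cons, g_zero, h fun j => g j.succ]
      · simp only [mul_assoc, Fin.succ_castSucc]
      · exact fun k hc hs => hg _ ((Fin.succ_injective _).ne hc) ((Fin.succ_injective _).ne hs)

theorem lt_or_eq_castSucc_or_eq_succ_or_lt {N : ℕ} (i : Fin N) (j : Fin (N + 1)) :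
    j < i.castSucc ∨ j = i.castSucc ∨ j = i.succ ∨ i.succ < j := by
  rw [Fin.lt_def, Fin.lt_def, Fin.ext_iff, Fin.ext_iff, Fin.val_castSucc, Fin.val_succ]
  lia

namespace DarbouxChart

variable {n : ℕ} (V : DarbouxChart n)

open PiTensorProduct (tprod)

/-- The parity operator of the `i`-th tensor factor. -/
def parityAt {N : ℕ} (i : Fin N) : Module.End ℝ (⨂[ℝ]^N V.Fun) :=
  PiTensorProduct.map (Pi.mulSingle i V.parity)

theorem parityAt_tprod {N : ℕ} (i : Fin N) (f : Fin N → V.Fun) :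
    V.parityAt i (tprod ℝ f) = tprod ℝ (Function.update f i (V.parity (f i))) := by
  rw [parityAt, PiTensorProduct.map_tprod]
  congr 1
  funext j
  obtain rfl | hj := eq_or_ne j i
  · simp
  · simp [hj]

theorem parityAt_tprod_of_parity_eq {N : ℕ} {i : Fin N} {f : Fin N → V.Fun} {ε : ℝ}
    (h : V.parity (f i) = ε • f i) : V.parityAt i (tprod ℝ f) = ε • tprod ℝ f := by
  rw [parityAt_tprod, h, MultilinearMap.map_update_smul, Function.update_eq_self]

theorem parityAt_mul_self {N : ℕ} (i : Fin N) : V.parityAt i * V.parityAt i = 1 := by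
  rw [parityAt, ← PiTensorProduct.map_mul]
  exact (congrArg _ ((Pi.mulSingle_mul i _ _).symm.trans
    ((congrArg _ V.parity_mul_parity).trans (Pi.mulSingle_one i)))).trans PiTensorProduct.map_one

theorem parityAt_pow_mul_map {N : ℕ} (i : Fin N) (k : ℕ) (G : Fin N → Module.End ℝ V.Fun) :
    V.parityAt i ^ k * PiTensorProduct.map G =
      PiTensorProduct.map (Function.update G i (V.parity ^ k * G i)) := by
  rw [parityAt, ← PiTensorProduct.map_pow, ← PiTensorProduct.map_mul]
  congr 1
  funext j
  obtain rfl | hj := eq_or_ne j i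
  · simp
  · simp [hj]

theorem parityAt_mul_map {N : ℕ} {i : Fin N} {G : Fin N → Module.End ℝ V.Fun} {c : ℝ}
    (h : V.parity * G i = c • (G i * V.parity)) :
    V.parityAt i * PiTensorProduct.map G = c • (PiTensorProduct.map G * V.parityAt i) := by
  have map_mul_parityAt : PiTensorProduct.map G * V.parityAt i =
      PiTensorProduct.map (Function.update G i (G i * V.parity)) := by
    rw [parityAt, ← PiTensorProduct.map_mul]
    congr 1
    funext j
    obtain rfl | hj := eq_or_ne j i
    · simp
    · simp [hj]
  rw [map_mul_parityAt, ← PiTensorProduct.map_update_smul, ← h, ← pow_one (V.parityAt i),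
    parityAt_pow_mul_map, pow_one]

theorem commute_parityAt {N : ℕ} (i j : Fin N) : Commute (V.parityAt i) (V.parityAt j) := by
  have h := V.parityAt_mul_map (i := i) (G := Pi.mulSingle j V.parity) (c := 1) (by
    rw [one_smul]
    obtain rfl | hij := eq_or_ne i j
    · rw [Pi.mulSingle_eq_same]
    · rw [Pi.mulSingle_eq_of_ne hij, mul_one, one_mul])
  rwa [one_smul] at h

/-- The permutation of the tensor factors without signs. -/
def permFactors {N : ℕ} (s : Equiv.Perm (Fin N)) : Module.End ℝ (⨂[ℝ]^N V.Fun) :=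
  (PiTensorProduct.reindex ℝ (fun _ : Fin N => V.Fun) s).toLinearMap

theorem permFactors_tprod {N : ℕ} (s : Equiv.Perm (Fin N)) (f : Fin N → V.Fun) :
    V.permFactors s (tprod ℝ f) = tprod ℝ fun j => f (s.symm j) :=
  PiTensorProduct.reindex_tprod s f

theorem permFactors_mul_map {N : ℕ} (s : Equiv.Perm (Fin N)) (F : Fin N → Module.End ℝ V.Fun) :
    V.permFactors s * PiTensorProduct.map F =
      PiTensorProduct.map (fun j => F (s.symm j)) * V.permFactors s :=
  PiTensorProduct.ext <| MultilinearMap.ext fun f => by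
    simp only [LinearMap.compMultilinearMap_apply, Module.End.mul_apply, permFactors_tprod,
      PiTensorProduct.map_tprod]

theorem permFactors_mul_parityAt {N : ℕ} (s : Equiv.Perm (Fin N)) (i : Fin N) :
    V.permFactors s * V.parityAt i = V.parityAt (s i) * V.permFactors s := by
  rw [parityAt, permFactors_mul_map, parityAt]
  congr 2
  funext j
  obtain rfl | hj := eq_or_ne j (s i)
  · rw [Equiv.symm_apply_apply, Pi.mulSingle_eq_same, Pi.mulSingle_eq_same]
  · rw [Pi.mulSingle_eq_of_ne hj, Pi.mulSingle_eq_of_ne (by rwa [Ne, Equiv.symm_apply_eq])]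

/-- The exchange of two neighbouring tensor factors with the Koszul sign. -/
def koszulSwap {N : ℕ} (i : Fin N) : Module.End ℝ (⨂[ℝ]^(N + 1) V.Fun) :=
  koszulSign (V.parityAt i.castSucc) (V.parityAt i.succ) *
    V.permFactors (Equiv.swap i.castSucc i.succ)

theorem koszulSwap_mul_self {N : ℕ} (i : Fin N) : V.koszulSwap i * V.koszulSwap i = 1 := by
  set s := Equiv.swap i.castSucc i.succ with hs
  have permFactors_mul_self : V.permFactors s * V.permFactors s = 1 :=
    PiTensorProduct.ext <| MultilinearMap.ext fun f => by
      simp only [LinearMap.compMultilinearMap_apply, Module.End.mul_apply, permFactors_tprod,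
        Module.End.one_apply, hs, Equiv.symm_swap, Equiv.swap_apply_self]
  have semiconj_castSucc := V.permFactors_mul_parityAt s i.castSucc
  have semiconj_succ := V.permFactors_mul_parityAt s i.succ
  rw [hs, Equiv.swap_apply_left] at semiconj_castSucc
  rw [hs, Equiv.swap_apply_right] at semiconj_succ
  rw [koszulSwap, mul_assoc, ← mul_assoc (V.permFactors _),
    (koszulSign_semiconjBy semiconj_castSucc semiconj_succ).eq, mul_assoc, ← hs,
    permFactors_mul_self, mul_one, koszulSign_comm (V.commute_parityAt _ _),
    koszulSign_mul_self (V.parityAt_mul_self _) (V.parityAt_mul_self _) (V.commute_parityAt _ _)]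

theorem koszulSwap_mul_pdAt_of_ne {N : ℕ} {i : Fin N} {j : Fin (N + 1)} (a : Fin V.r)
    (hc : j ≠ i.castSucc) (hs : j ≠ i.succ) :
    V.koszulSwap i * V.pdAt j a = V.pdAt j a * V.koszulSwap i := by
  have permFactors_mul : V.permFactors (Equiv.swap i.castSucc i.succ) * V.pdAt j a =
      V.pdAt j a * V.permFactors (Equiv.swap i.castSucc i.succ) := by
    rw [pdAt, permFactors_mul_map]
    congr 2
    funext k
    have hcs : i.castSucc < i.succ := Fin.castSucc_lt_succ
    rw [Equiv.symm_swap, Equiv.swap_apply_def]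
    rcases lt_or_eq_castSucc_or_eq_succ_or_lt i j with hj | hj | hj | hj
    · split_ifs <;> simp_all [hj.not_gt, (hj.trans hcs).not_gt]
    · exact absurd hj hc
    · exact absurd hj hs
    · split_ifs <;> simp_all [hcs.trans hj]
  have parityAt_mul {k : Fin (N + 1)} (hk : k ≠ j) :
      V.parityAt k * V.pdAt j a = (-1 : ℝ) ^ 0 • (V.pdAt j a * V.parityAt k) := by
    refine V.parityAt_mul_map ?_
    rw [pow_zero, one_smul, if_neg hk]
    split_ifs
    · exact ((Commute.refl V.parity).pow_right _).eq
    · rw [mul_one, one_mul]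
  have commute_castSucc := parityAt_mul hc.symm
  rw [pow_zero, one_smul] at commute_castSucc
  rw [koszulSwap, mul_assoc, permFactors_mul, ← mul_assoc,
    koszulSign_mul (V.parityAt_mul_self _) commute_castSucc (parityAt_mul hs.symm), pow_zero,
    one_mul, mul_assoc]

theorem koszulSwap_mul_pdAt_castSucc {N : ℕ} (i : Fin N) (a : Fin V.r) :
    V.koszulSwap i * V.pdAt i.castSucc a = V.pdAt i.succ a * V.koszulSwap i := by
  have hcs : i.castSucc < i.succ := Fin.castSucc_lt_succ
  let G (j : Fin (N + 1)) : Module.End ℝ V.Fun :=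
    if j < i.castSucc then V.parity ^ V.deg a else if j = i.succ then V.pd a else 1
  have G_castSucc : G i.castSucc = 1 := by simp [G, hcs.ne]
  have G_succ : G i.succ = V.pd a := by simp [G, hcs.not_gt]
  have permFactors_mul : V.permFactors (Equiv.swap i.castSucc i.succ) * V.pdAt i.castSucc a =
      PiTensorProduct.map G * V.permFactors (Equiv.swap i.castSucc i.succ) := by
    rw [pdAt, permFactors_mul_map]
    congr 2
    funext j
    rcases lt_or_eq_castSucc_or_eq_succ_or_lt i j with hj | rfl | rfl | hj
    · simp [G, hj, hj.ne, (hj.trans hcs).ne, Equiv.swap_apply_of_ne_of_ne]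
    · simp [G_castSucc, hcs.ne', hcs.not_gt]
    · simp [G_succ]
    · simp [G, hj.ne', (hcs.trans hj).ne', (hcs.trans hj).not_gt, Equiv.swap_apply_of_ne_of_ne]
  have parityAt_pow_mul :
      V.parityAt i.castSucc ^ V.deg a * PiTensorProduct.map G = V.pdAt i.succ a := by
    rw [parityAt_pow_mul_map, G_castSucc, mul_one, pdAt]
    congr 1
    funext j
    rcases lt_or_eq_castSucc_or_eq_succ_or_lt i j with hj | rfl | rfl | hj
    · simp [G, hj, hj.ne, hj.trans hcs]
    · simp [hcs]
    · simp [G, hcs.ne', hcs.not_gt]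
    · simp [G, (hcs.trans hj).ne', (hcs.trans hj).not_gt, hj.ne', hj.not_gt]
  have commute_castSucc : V.parityAt i.castSucc * PiTensorProduct.map G =
      PiTensorProduct.map G * V.parityAt i.castSucc := by
    have h := V.parityAt_mul_map (i := i.castSucc) (G := G) (c := 1) (by simp [G_castSucc])
    rwa [one_smul] at h
  have commute_succ := V.parityAt_mul_map (i := i.succ) (G := G)
    (by rw [G_succ, parity_mul_pd])
  rw [koszulSwap, mul_assoc, permFactors_mul, ← mul_assoc,
    koszulSign_mul (V.parityAt_mul_self _) commute_castSucc commute_succ, parityAt_pow_mul,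
    mul_assoc]

theorem koszulSwap_comp_pdAt {N : ℕ} (i : Fin N) (j : Fin (N + 1)) (a : Fin V.r) :
    V.koszulSwap i ∘ₗ V.pdAt j a =
      V.pdAt (Equiv.swap i.castSucc i.succ j) a ∘ₗ V.koszulSwap i := by
  simp only [← Module.End.mul_eq_comp]
  by_cases hc : j = i.castSucc
  · rw [hc, Equiv.swap_apply_left, koszulSwap_mul_pdAt_castSucc]
  by_cases hs : j = i.succ
  · rw [hs, Equiv.swap_apply_right]
    calc V.koszulSwap i * V.pdAt i.succ a
        = V.koszulSwap i * (V.pdAt i.succ a * V.koszulSwap i) * V.koszulSwap i := by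
          rw [mul_assoc, mul_assoc (V.pdAt _ _), koszulSwap_mul_self, mul_one]
      _ = V.pdAt i.castSucc a * V.koszulSwap i := by
          rw [← koszulSwap_mul_pdAt_castSucc, ← mul_assoc, koszulSwap_mul_self, one_mul]
  · rw [Equiv.swap_apply_of_ne_of_ne hc hs, koszulSwap_mul_pdAt_of_ne _ _ hc hs]

theorem koszulSwap_comp_graphOp {N k : ℕ} (i : Fin N) (g : LGraph (N + 1) k) :
    V.koszulSwap i ∘ₗ V.graphOp g =
      V.graphOp (g.mapVertices (Equiv.swap i.castSucc i.succ)) ∘ₗ V.koszulSwap i :=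
  comp_prod_ofFn _ _ _ fun _ =>
    V.comp_sum_pairing _ (V.koszulSwap_comp_pdAt i _) (V.koszulSwap_comp_pdAt i _)

theorem mulAll_comp_koszulSwap {N : ℕ} (i : Fin N) :
    mulAll (N + 1) ∘ₗ V.koszulSwap i = mulAll (N + 1) := by
  refine PiTensorProduct.ext (MultilinearMap.ext fun f => ?_)
  have hcs : i.castSucc ≠ i.succ := Fin.castSucc_lt_succ.ne
  obtain ⟨A, B, prod_eq⟩ := exists_prod_ofFn_eq i f
  have sum_eq := V.two_nsmul_fun_mul_eq (f i.castSucc) (f i.succ)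
  simp only [LinearMap.compMultilinearMap_apply, LinearMap.comp_apply, koszulSwap, koszulSign,
    Module.End.mul_apply, permFactors_tprod, LinearMap.smul_apply, LinearMap.sub_apply,
    LinearMap.add_apply, Module.End.one_apply, parityAt_tprod, map_smul, map_add, map_sub,
    mulAll_tprod, Equiv.symm_swap]
  rw [prod_eq f fun _ _ _ => rfl]
  repeat rw [prod_eq _ fun k hc hs => by
    simp [Function.update_of_ne, hc, hs, Equiv.swap_apply_of_ne_of_ne hc hs]]
  simp only [Function.update_self, Function.update_of_ne hcs, Function.update_of_ne hcs.symm,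
    Equiv.swap_apply_left, Equiv.swap_apply_right]
  rw [← add_mul, ← add_mul, ← sub_mul, ← mul_add, ← mul_add, ← mul_sub, ← sum_eq,
    ← Nat.cast_smul_eq_nsmul ℝ, mul_smul_comm, smul_mul_assoc, smul_smul]
  norm_num

theorem repGraph_swap {N k : ℕ} (i : Fin N) (g : LGraph (N + 1) k) (f : Fin (N + 1) → V.Fun)
    {ε δ : ℝ} (hc : V.parity (f i.castSucc) = ε • f i.castSucc)
    (hs : V.parity (f i.succ) = δ • f i.succ) :
    V.repGraph g f = ((1 + ε + δ - ε * δ) / 2) •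
      V.repGraph (g.mapVertices (Equiv.swap i.castSucc i.succ))
        fun j => f (Equiv.swap i.castSucc i.succ j) := by
  have koszulSwap_tprod : V.koszulSwap i (tprod ℝ f) = ((1 + ε + δ - ε * δ) / 2) •
      tprod ℝ fun j => f (Equiv.swap i.castSucc i.succ j) := by
    rw [koszulSwap, koszulSign_comm (V.commute_parityAt _ _), Module.End.mul_apply,
      permFactors_tprod, Equiv.symm_swap]
    refine koszulSign_apply (V.parityAt_tprod_of_parity_eq ?_) (V.parityAt_tprod_of_parity_eq ?_)
    · rwa [Equiv.swap_apply_right]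
    · rwa [Equiv.swap_apply_left]
  rw [repGraph_apply, ← V.mulAll_comp_koszulSwap i, LinearMap.comp_apply,
    ← LinearMap.comp_apply (V.koszulSwap i), koszulSwap_comp_graphOp, LinearMap.comp_apply,
    koszulSwap_tprod, map_smul, map_smul, repGraph_apply]

theorem repGraph_mapVertices {N k : ℕ} (d : ℕ) (g : LGraph N k) {H : V.Fun}
    (hH : V.parity H = (-1 : ℝ) ^ d • H) (σ : Equiv.Perm (Fin N)) :
    (V.repGraph (g.mapVertices σ) fun _ => H) =
      ((Equiv.Perm.sign σ : ℤ) : ℝ) ^ d • V.repGraph g fun _ => H := by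
  rcases N with _ | N
  · obtain rfl : σ = 1 := Subsingleton.elim _ _
    simp only [Equiv.Perm.sign_one, Units.val_one, Int.cast_one, one_pow, one_smul]
    rfl
  have mem_closure : σ ∈ Submonoid.closure
      (Set.range fun i : Fin N => Equiv.swap i.castSucc i.succ) := by
    rw [Equiv.Perm.mclosure_swap_castSucc_succ]
    trivial
  induction mem_closure using Submonoid.closure_induction generalizing g with
  | mem x hx =>
    obtain ⟨i, rfl⟩ := hx
    rw [V.repGraph_swap i g (fun _ => H) hH hH, smul_smul,
      Equiv.Perm.sign_swap Fin.castSucc_lt_succ.ne]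
    rcases neg_one_pow_eq_or ℝ d with h | h <;> norm_num [h]
  | one =>
    simp only [Equiv.Perm.sign_one, Units.val_one, Int.cast_one, one_pow, one_smul]
    rfl
  | mul x y _ _ hx hy =>
    have mapVertices_mul : g.mapVertices ⇑(x * y) = (g.mapVertices ⇑y).mapVertices ⇑x := rfl
    rw [mapVertices_mul, hx, hy, smul_smul, map_mul, ← mul_pow]
    push_cast
    rfl

theorem rep_permVertices {N k : ℕ} (x : Gra (n + 1) N k) {H : V.Fun}
    (hH : V.parity H = (-1 : ℝ) ^ (n + 1) • H) (σ : Equiv.Perm (Fin N)) :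
    (V.rep (Gra.permVertices (n + 1) σ x) fun _ => H) =
      ((Equiv.Perm.sign σ : ℤ) : ℝ) ^ (n + 1) • V.rep x fun _ => H := by
  induction x using Gra.mk_induction with
  | zero => simp
  | add x y hx hy => simp only [map_add, _root_.add_apply, hx, hy, smul_add]
  | smul c x hx => simp only [map_smul, _root_.smul_apply, hx, smul_comm c]
  | mk g =>
    rw [Gra.permVertices, Gra.lift_mk, rep_mk, rep_mk, V.repGraph_mapVertices _ _ hH,
      Equiv.Perm.sign_inv]

/-- The tensors of total degree `s`. -/
def tensorHomogeneous (N : ℕ) (s : ℤ) : Submodule ℝ (⨂[ℝ] _ : Fin N, V.Fun) :=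
  Submodule.span ℝ {x | ∃ (f : Fin N → V.Fun) (κ : Fin N → ℤ),
    (∀ i, f i ∈ V.homogeneous (κ i)) ∧ ∑ i, κ i = s ∧ x = PiTensorProduct.tprod ℝ f}

theorem tprod_mem_tensorHomogeneous {N : ℕ} {f : Fin N → V.Fun} {κ : Fin N → ℤ}
    (hf : ∀ i, f i ∈ V.homogeneous (κ i)) {s : ℤ} (hs : ∑ i, κ i = s) :
    PiTensorProduct.tprod ℝ f ∈ V.tensorHomogeneous N s :=
  Submodule.subset_span ⟨f, κ, hf, hs, rfl⟩

theorem pdTuple_mem_homogeneous {N : ℕ} (i : Fin N) (a : Fin V.r) {f : Fin N → V.Fun}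
    {κ : Fin N → ℤ} (hf : ∀ j, f j ∈ V.homogeneous (κ j)) (j : Fin N) :
    V.pdTuple i a f j ∈ V.homogeneous (κ j - if j = i then (V.deg a : ℤ) else 0) := by
  rcases lt_trichotomy j i with hlt | rfl | hgt
  · simpa [pdTuple, hlt, hlt.ne] using V.parity_pow_mem_homogeneous _ (hf j)
  · simpa [pdTuple] using V.pd_mem_homogeneous a (hf j)
  · simpa [pdTuple, hgt.not_gt, hgt.ne'] using hf j

theorem pdAt_mem_tensorHomogeneous {N : ℕ} (i : Fin N) (a : Fin V.r) {s : ℤ}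
    {x : ⨂[ℝ] _ : Fin N, V.Fun} (hx : x ∈ V.tensorHomogeneous N s) :
    V.pdAt i a x ∈ V.tensorHomogeneous N (s - V.deg a) := by
  induction hx using Submodule.span_induction with
  | zero => rw [map_zero]; exact zero_mem _
  | add x y _ _ hx hy => rw [map_add]; exact add_mem hx hy
  | smul c x _ hx => rw [map_smul]; exact Submodule.smul_mem _ c hx
  | mem x h =>
    obtain ⟨f, κ, hf, rfl, rfl⟩ := h
    rw [pdAt_tprod]
    refine V.tprod_mem_tensorHomogeneous (V.pdTuple_mem_homogeneous i a hf) ?_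
    rw [Finset.sum_sub_distrib, Finset.sum_ite_eq' _ i, if_pos (Finset.mem_univ i)]

theorem edgeOp_mem_tensorHomogeneous {N : ℕ} (i j : Fin N) {s : ℤ} {x : ⨂[ℝ] _ : Fin N, V.Fun}
    (hx : x ∈ V.tensorHomogeneous N s) :
    V.edgeOp i j x ∈ V.tensorHomogeneous N (s - n) := by
  simp only [edgeOp, LinearMap.sum_apply, LinearMap.smul_apply, Module.End.mul_apply]
  refine Submodule.sum_mem _ fun a _ => Submodule.sum_mem _ fun b _ => ?_
  by_cases hab : V.pairing a b = 0
  · rw [hab, zero_smul]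
    exact zero_mem _
  · refine Submodule.smul_mem _ _ ?_
    convert V.pdAt_mem_tensorHomogeneous i a (V.pdAt_mem_tensorHomogeneous j b hx) using 2
    have := V.pairing_degree a b hab
    omega

theorem graphOp_mem_tensorHomogeneous {N k : ℕ} (g : LGraph N k) {s : ℤ}
    {x : ⨂[ℝ] _ : Fin N, V.Fun} (hx : x ∈ V.tensorHomogeneous N s) :
    V.graphOp g x ∈ V.tensorHomogeneous N (s - k * n) := by
  unfold graphOp
  induction k with
  | zero => simpa using hx
  | succ k ih =>
    rw [List.ofFn_succ, List.prod_cons, Module.End.mul_apply]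
    convert V.edgeOp_mem_tensorHomogeneous (g 0).1 (g 0).2 (ih fun e => g e.succ) using 2
    push_cast
    ring

theorem mulAll_mem_homogeneous {N : ℕ} {s : ℤ} {x : ⨂[ℝ] _ : Fin N, V.Fun}
    (hx : x ∈ V.tensorHomogeneous N s) : mulAll N x ∈ V.homogeneous s := by
  induction hx using Submodule.span_induction with
  | zero => rw [map_zero]; exact zero_mem _
  | add x y _ _ hx hy => rw [map_add]; exact add_mem hx hy
  | smul c x _ hx => rw [map_smul]; exact Submodule.smul_mem _ c hx
  | mem x h =>
    obtain ⟨f, κ, hf, rfl, rfl⟩ := h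
    rw [mulAll_tprod, ← List.sum_ofFn]
    exact SetLike.list_prod_ofFn_mem_graded κ f hf

theorem rep_mem_homogeneous {N k : ℕ} (x : Gra (n + 1) N k) {f : Fin N → V.Fun} {κ : Fin N → ℤ}
    (hf : ∀ i, f i ∈ V.homogeneous (κ i)) : V.rep x f ∈ V.homogeneous (∑ i, κ i - k * n) := by
  induction x using Gra.mk_induction with
  | zero => rw [map_zero]; exact zero_mem _
  | add x y hx hy => rw [map_add]; exact add_mem hx hy
  | smul c x hx => rw [map_smul]; exact Submodule.smul_mem _ c hx
  | mk g =>
    rw [rep_mk, repGraph_apply]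
    exact V.mulAll_mem_homogeneous
      (V.graphOp_mem_tensorHomogeneous g (V.tprod_mem_tensorHomogeneous hf rfl))

theorem rep_const_mem_homogeneous {N k : ℕ} (x : Gra (n + 1) (N + 1) k) {H : V.Fun}
    (hH : H ∈ V.homogeneous (n + 1)) :
    (V.rep x fun _ => H) ∈ V.homogeneous (fgcDegree (n + 1) N k + (n + 1)) := by
  have degree_eq : ∑ _i : Fin (N + 1), ((n : ℤ) + 1) - k * n =
      fgcDegree (n + 1) N k + (n + 1) := by
    simp only [fgcDegree, Finset.sum_const, Finset.card_univ, Fintype.card_fin, nsmul_eq_mul]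
    push_cast
    ring
  exact degree_eq ▸ V.rep_mem_homogeneous x fun _ => hH

theorem rep_mem_homogeneous_of_mem_fgcCochains {j : ℤ} {γ : GraFamily (n + 1)}
    (hγ : γ ∈ fgcCochains (n + 1) j) (N k : ℕ) {H : V.Fun} (hH : H ∈ V.homogeneous (n + 1)) :
    (V.rep (γ N k) fun _ => H) ∈ V.homogeneous (j + (n + 1)) := by
  by_cases hdeg : fgcDegree (n + 1) N k = j
  · exact hdeg ▸ V.rep_const_mem_homogeneous _ hH
  · rw [hγ.2 N k hdeg, map_zero]
    exact zero_mem _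

/-! ### The bracket and the differential -/

theorem bracket_apply (f g : V.Fun) : V.bracket f g =
    ∑ a, ∑ b, V.pairing a b • (V.pd a ((V.parity ^ V.deg b) f) * V.pd b g) := by
  simp [bracket, LinearMap.sum_apply]

theorem repGraph_edge (f g : V.Fun) :
    V.repGraph (fun _ : Fin 1 => ((0, 1) : Fin (1 + 1) × Fin (1 + 1))) ![f, g] =
      V.bracket f g := by
  rw [repGraph_apply, graphOp, List.ofFn_succ, List.ofFn_zero, List.prod_singleton, bracket_apply]
  simp only [edgeOp, LinearMap.sum_apply, LinearMap.smul_apply, Module.End.mul_apply, map_sum,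
    map_smul, pdAt_tprod, mulAll_tprod]
  refine Finset.sum_congr rfl fun a _ => Finset.sum_congr rfl fun b _ => ?_
  simp [List.ofFn_succ, pdTuple]

theorem neg_one_zpow_mul_eq (k l : ℤ) :
    (1 + (-1) ^ k + (-1) ^ l - (-1) ^ k * (-1) ^ l) / 2 = (-1 : ℝ) ^ (k * l) := by
  rcases Int.even_or_odd k with hk | hk
  · rw [(hk.mul_right l).neg_one_zpow, hk.neg_one_zpow]
    ring
  rcases Int.even_or_odd l with hl | hl
  · rw [(hl.mul_left k).neg_one_zpow, hl.neg_one_zpow]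
    ring
  · rw [(hk.mul hl).neg_one_zpow, hk.neg_one_zpow, hl.neg_one_zpow]
    ring

theorem bracket_swap {f g : V.Fun} {k l : ℤ} (hf : f ∈ V.homogeneous k)
    (hg : g ∈ V.homogeneous l) :
    V.bracket f g = ((-1 : ℝ) ^ (k * l) * (-1) ^ (n + 1)) • V.bracket g f := by
  let edge : LGraph (1 + 1) 1 := fun _ => (0, 1)
  have swap_vertices : edge.mapVertices (Equiv.swap (Fin.castSucc 0) (Fin.succ 0)) =
      edge.flip 0 := by
    funext e
    fin_cases e
    rfl
  have swap_functions : (fun j => (![f, g] : Fin (1 + 1) → V.Fun)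
      (Equiv.swap (Fin.castSucc (0 : Fin 1)) (Fin.succ 0) j)) = ![g, f] := by
    funext j
    fin_cases j <;> rfl
  have swapped := V.repGraph_swap 0 edge ![f, g] (V.parity_apply_of_mem_homogeneous hf)
    (V.parity_apply_of_mem_homogeneous hg)
  rwa [swap_vertices, swap_functions, V.repGraph_congr _ _ _ (V.graphOp_flip edge 0),
    _root_.smul_apply, repGraph_edge, repGraph_edge, smul_smul, neg_one_zpow_mul_eq] at swapped

theorem rep_cast {N N' k k' : ℕ} (hN : N = N') (hk : k = k') (x : Gra (n + 1) N k) (H : V.Fun) :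
    (V.rep (Gra.cast (n + 1) hN hk x) fun _ => H) = V.rep x fun _ => H := by
  subst hN hk
  rfl

theorem rep_comp₁_const {M N j k : ℕ} (x : Gra (n + 1) (M + 1) j) (y : Gra (n + 1) N k)
    (H : V.Fun) : (V.rep (Gra.comp₁ (n + 1) x y) fun _ => H) =
      V.rep x (Fin.cons (V.rep y fun _ => H) fun _ => H) := by
  rw [← rep_comp₁]
  congr 1
  funext i
  cases i using Fin.addCases <;> simp

open Classical in
theorem rep_preLie {M N j k : ℕ} (x : Gra (n + 1) (M + 1) j) (y : Gra (n + 1) N k) {H : V.Fun}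
    (hH : V.parity H = (-1 : ℝ) ^ (n + 1) • H) : (V.rep (Gra.preLie (n + 1) x y) fun _ => H) =
      ((Finset.univ.filter fun σ : Equiv.Perm (Fin (N + M)) => Gra.IsUnshuffle σ).card : ℝ) •
        V.rep x (Fin.cons (V.rep y fun _ => H) fun _ => H) := by
  rw [Gra.preLie, LinearMap.sum_apply, LinearMap.sum_apply, map_sum, _root_.sum_apply,
    ← rep_comp₁_const, Nat.cast_smul_eq_nsmul, ← Finset.sum_const]
  refine Finset.sum_congr rfl fun σ _ => ?_
  rw [LinearMap.smul_apply, LinearMap.smul_apply, map_smul, _root_.smul_apply,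
    LinearMap.compr₂_apply, V.rep_permVertices _ hH, smul_smul, ← mul_pow]
  rcases Int.units_eq_one_or (Equiv.Perm.sign σ) with h | h <;> simp [h]

theorem rep_edge_cons (f g : V.Fun) :
    V.rep (Gra.edge (n + 1)) (Fin.cons f fun _ => g) = V.bracket f g := by
  rw [Gra.edge, rep_mk, ← repGraph_edge]
  congr 1
  funext i
  fin_cases i <;> rfl

theorem rep_edge_const (f : V.Fun) : (V.rep (Gra.edge (n + 1)) fun _ => f) = V.bracket f f := by
  rw [← rep_edge_cons]
  congr 1
  funext i
  cases i using Fin.cases <;> rfl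

open Classical in
theorem card_isUnshuffle_ne_zero (N M : ℕ) :
    (Finset.univ.filter fun σ : Equiv.Perm (Fin (N + M)) => Gra.IsUnshuffle σ).card ≠ 0 :=
  Finset.card_ne_zero.2 ⟨1, Finset.mem_filter.2
    ⟨Finset.mem_univ _, fun _ _ h => h, fun _ _ h => Nat.add_lt_add_left h N⟩⟩

theorem exists_rep_diff_eq_smul_bracket (c : GraFamily (n + 1)) (N k : ℕ) (H : V.Ham) :
    ∃ r : ℝ, r ≠ 0 ∧ (V.rep (diff (n + 1) c (N + 1) (k + 1)) fun _ => H.1) =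
      r • V.bracket H.1 (V.rep (c N k) fun _ => H.1) := by
  classical
  obtain ⟨H, hH, hHH⟩ := H
  have parity_H : V.parity H = (-1 : ℝ) ^ (n + 1) • H := by
    rw [V.parity_apply_of_mem_homogeneous hH, ← zpow_natCast]
    push_cast
    rfl
  have rep_edge : (V.rep (Gra.edge (n + 1)) fun _ => H) = 0 := (V.rep_edge_const H).trans hHH
  have rep_cons_zero : V.rep (c N k) (Fin.cons 0 fun _ => H) = 0 :=
    (V.rep (c N k)).map_coord_zero 0 (Fin.cons_zero _ _)
  obtain ⟨s, hs, rep_bracket⟩ : ∃ s : ℝ, s ≠ 0 ∧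
      V.bracket (V.rep (c N k) fun _ => H) H = s • V.bracket H (V.rep (c N k) fun _ => H) :=
    ⟨_, mul_ne_zero (zpow_ne_zero _ (by norm_num)) (pow_ne_zero _ (by norm_num)),
      V.bracket_swap (V.rep_const_mem_homogeneous (c N k) hH) hH⟩
  refine ⟨_, mul_ne_zero (Nat.cast_ne_zero.2 (card_isUnshuffle_ne_zero (N + 1) 1)) hs, ?_⟩
  change (V.rep (Gra.cast (n + 1) _ _ (Gra.bracket (n + 1) (Gra.edge (n + 1)) (c N k)))
    fun _ => H) = _
  rw [rep_cast, Gra.bracket, LinearMap.sub_apply, LinearMap.smul_apply, LinearMap.comp_apply,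
    LinearMap.comp_apply, LinearMap.flip_apply, map_sub, map_smul, _root_.sub_apply,
    _root_.smul_apply, rep_cast, rep_cast, V.rep_preLie _ _ parity_H, V.rep_preLie _ _ parity_H,
    rep_edge_cons, rep_edge, rep_cons_zero, smul_zero, smul_zero, sub_zero,
    rep_bracket, smul_smul]

theorem bracket_rep_eq_zero_of_mem_fgcCocycles {j : ℤ} {γ : GraFamily (n + 1)}
    (hγ : γ ∈ fgcCocycles (n + 1) j) (N k : ℕ) (H : V.Ham) :
    V.bracket H.1 (V.rep (γ N k) fun _ => H.1) = 0 := by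
  obtain ⟨r, hr, h⟩ := V.exists_rep_diff_eq_smul_bracket γ N k H
  have diff_eq_zero : diff (n + 1) γ (N + 1) (k + 1) = 0 :=
    congrFun (congrFun hγ.2 (N + 1)) (k + 1)
  rw [diff_eq_zero, map_zero] at h
  exact (smul_eq_zero.1 h.symm).resolve_left hr

theorem rep_diff_mem_qCoboundaries {j : ℤ} {η : GraFamily (n + 1)}
    (hη : η ∈ fgcCochains (n + 1) (j - 1)) (N k : ℕ) (H : V.Ham) :
    (V.rep (diff (n + 1) η N k) fun _ => H.1) ∈ V.qCoboundaries H (j + (n + 1)) := by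
  match N, k with
  | 0, _ | N + 1, 0 =>
    change (V.rep 0 fun _ => H.1) ∈ _
    rw [map_zero]
    exact zero_mem _
  | N + 1, k + 1 =>
    obtain ⟨r, -, h⟩ := V.exists_rep_diff_eq_smul_bracket η N k H
    rw [h]
    refine Submodule.smul_mem _ r (Submodule.mem_map_of_mem ?_)
    have := V.rep_mem_homogeneous_of_mem_fgcCochains hη N k H.2.1
    rwa [show j - 1 + ((n : ℤ) + 1) = j + (n + 1) - 1 by ring] at this

end DarbouxChart

theorem existsUnique_comp_eq {R M M' P : Type*} [Semiring R] [AddCommGroup M] [Module R M]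
    [AddCommGroup M'] [Module R M'] [AddCommMonoid P] [Module R P] {f : M →ₗ[R] M'}
    (hf : Function.Surjective f) {g : M →ₗ[R] P}
    (hfg : LinearMap.ker f ≤ LinearMap.ker g) : ∃! h : M' →ₗ[R] P, h ∘ₗ f = g := by
  have eq_of_eq : ∀ {x y}, f x = f y → g x = g y := fun {x y} hxy => by
    have sub_mem_ker : x - y ∈ LinearMap.ker f := by
      rw [LinearMap.mem_ker, map_sub, hxy, sub_self]
    rw [← sub_add_cancel x y, map_add, LinearMap.mem_ker.1 (hfg sub_mem_ker), zero_add]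
  have f_inv := Function.surjInv_eq hf
  let h : M' →ₗ[R] P :=
    { toFun := fun y => g (Function.surjInv hf y)
      map_add' := fun y y' => by rw [← map_add]; exact eq_of_eq (by simp only [map_add, f_inv])
      map_smul' := fun r y => by
        rw [RingHom.id_apply, ← map_smul]
        exact eq_of_eq (by simp only [map_smul, f_inv]) }
  have h_comp : h ∘ₗ f = g := LinearMap.ext fun x => eq_of_eq (f_inv (f x))
  exact ⟨h, h_comp, fun h' hh' => (LinearMap.cancel_right hf).1 (hh'.trans h_comp.symm)⟩

/-! ### The flows of cocycles -/

/-- The cocycles with finitely many components. -/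
abbrev finiteCocycles (d : ℕ) (j : ℤ) : Submodule ℝ (fgcCocycles d j) :=
  (finiteFamilies d).comap (fgcCocycles d j).subtype

/-- The projection `γ ↦ cocycleClass γ` as a linear map. -/
def finiteCocycleClass (d : ℕ) (j : ℤ) : finiteCocycles d j →ₗ[ℝ] finiteCohomology d j :=
  (Submodule.mkQ _).submoduleMap (finiteCocycles d j)

theorem finiteCocycleClass_surjective (d : ℕ) (j : ℤ) :
    Function.Surjective (finiteCocycleClass d j) :=
  LinearMap.submoduleMap_surjective _ _

theorem finiteCocycleClass_eq_zero_iff {d : ℕ} {j : ℤ} {γ : finiteCocycles d j} :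
    finiteCocycleClass d j γ = 0 ↔ (γ.1 : GraFamily d) ∈ fgcCoboundaries d j :=
  Subtype.ext_iff.trans
    (Submodule.Quotient.mk_eq_zero ((fgcCoboundaries d j).comap (fgcCocycles d j).subtype))

/-- The family of graphs with one more, isolated, vertex. -/
def addVertex {d : ℕ} (c : GraFamily d) : GraFamily d
  | 0, _ => 0
  | N + 1, k => Gra.cast d rfl (Nat.zero_add k)
      (Gra.comp₁ d (Gra.mk d (Fin.elim0 : LGraph (1 + 1) 0)) (c N k))

theorem addVertex_mem_finiteFamilies {d : ℕ} {c : GraFamily d} (hc : c ∈ finiteFamilies d) :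
    addVertex c ∈ finiteFamilies d := by
  refine (Set.Finite.image (fun p : ℕ × ℕ => (p.1 + 1, p.2)) hc).subset ?_
  rintro ⟨N | N, k⟩ hNk
  · exact absurd rfl hNk
  · refine ⟨(N, k), fun hzero : c N k = 0 => hNk ?_, rfl⟩
    change Gra.cast d _ _ (Gra.comp₁ d _ (c N k)) = 0
    rw [hzero, map_zero, map_zero]

namespace DarbouxChart

variable {n : ℕ} (V : DarbouxChart n)

theorem evalAt_mem_of_forall_rep_mem {γ : GraFamily (n + 1)} (hγ : γ ∈ finiteFamilies (n + 1))
    {H : V.Fun} {S : Submodule ℝ V.Fun} (hS : ∀ N k, (V.rep (γ N k) fun _ => H) ∈ S) :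
    V.evalAt γ H ∈ S := by
  rw [evalAt, finsum_eq_sum _ (V.evalAt_support γ hγ H)]
  exact Submodule.sum_mem _ fun p _ => hS p.1 p.2

theorem rep_isolated (f g : V.Fun) :
    V.rep (Gra.mk (n + 1) (Fin.elim0 : LGraph (1 + 1) 0)) (Fin.cons f fun _ => g) = f * g := by
  rw [rep_mk, repGraph_apply, graphOp, List.ofFn_zero, List.prod_nil, Module.End.one_apply,
    mulAll_tprod]
  simp [List.ofFn_succ]

theorem rep_addVertex_succ (c : GraFamily (n + 1)) (N k : ℕ) (H : V.Fun) :
    (V.rep (addVertex c (N + 1) k) fun _ => H) = (V.rep (c N k) fun _ => H) * H :=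
  (V.rep_cast _ _ _ H).trans ((V.rep_comp₁_const _ _ H).trans (V.rep_isolated _ H))

theorem evalAt_addVertex {c : GraFamily (n + 1)} (hc : c ∈ finiteFamilies (n + 1)) (H : V.Fun) :
    V.evalAt (addVertex c) H = V.evalAt c H * H := by
  let shift : ℕ × ℕ → ℕ × ℕ := fun p => (p.1 + 1, p.2)
  have shift_injective : Function.Injective shift := fun p q h => by
    simpa [shift, Prod.ext_iff] using h
  have support_subset : (Function.support fun p : ℕ × ℕ =>
      V.rep (addVertex c p.1 p.2) fun _ => H) ⊆ Set.range shift := by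
    rintro ⟨N | N, k⟩ hNk
    · refine absurd ?_ hNk
      change (V.rep 0 fun _ => H) = 0
      rw [map_zero, _root_.zero_apply]
    · exact ⟨(N, k), rfl⟩
  calc V.evalAt (addVertex c) H
      = ∑ᶠ p ∈ Set.range shift, V.rep (addVertex c p.1 p.2) fun _ => H := by
        rw [finsum_mem_def, Set.indicator_eq_self.2 support_subset, evalAt]
    _ = ∑ᶠ p, V.rep (addVertex c (shift p).1 (shift p).2) fun _ => H :=
        finsum_mem_range shift_injective
    _ = ∑ᶠ p : ℕ × ℕ, (V.rep (c p.1 p.2) fun _ => H) * H :=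
        finsum_congr fun p => V.rep_addVertex_succ c p.1 p.2 H
    _ = V.evalAt c H * H := (finsum_mul' _ H (V.evalAt_support c hc H)).symm

section DegreeZero

variable {V}

theorem parity_pow_apply_of_mem_homogeneous_zero {x : V.Fun} (hx : x ∈ V.homogeneous 0) (k : ℕ) :
    (V.parity ^ k) x = x := by
  have parity_x : V.parity x = x := by
    rw [V.parity_apply_of_mem_homogeneous hx, zpow_zero, one_smul]
  rw [Module.End.pow_apply, Function.iterate_fixed parity_x]

theorem commute_of_mem_homogeneous_zero {x : V.Fun} (hx : x ∈ V.homogeneous 0) (y : V.Fun) :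
    Commute x y := by
  have parity_x : V.parity x = x := by
    simpa only [pow_one] using parity_pow_apply_of_mem_homogeneous_zero hx 1
  have two_smul_eq : (2 : ℝ) • (x * y) = (2 : ℝ) • (y * x) := by
    rw [two_smul, ← two_nsmul, V.two_nsmul_fun_mul_eq, parity_x, two_smul]
    abel
  exact smul_right_injective V.Fun two_ne_zero two_smul_eq

theorem bracket_mul {x : V.Fun} (hx : x ∈ V.homogeneous 0) (f g : V.Fun) :
    V.bracket f (x * g) = V.bracket f x * g + x * V.bracket f g := by
  simp only [bracket_apply, Finset.sum_mul, Finset.mul_sum, ← Finset.sum_add_distrib]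
  refine Finset.sum_congr rfl fun a _ => Finset.sum_congr rfl fun b _ => ?_
  rw [pd_mul, parity_pow_apply_of_mem_homogeneous_zero hx, mul_add, smul_add, ← mul_assoc,
    ← mul_assoc, ← (commute_of_mem_homogeneous_zero hx _).eq, smul_mul_assoc, mul_smul_comm,
    mul_assoc x]

theorem mul_mem_qCocycles {H : V.Ham} {x : V.Fun} (hx : x ∈ V.qCocycles H 0) :
    x * H.1 ∈ V.qCocycles H (n + 1) := by
  have mul_mem : x * H.1 ∈ V.homogeneous (0 + ((n : ℤ) + 1)) :=
    SetLike.mul_mem_graded hx.1 H.2.1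
  have bracket_x : V.bracket H.1 x = 0 := hx.2
  have bracket_mul_eq_zero : V.bracket H.1 (x * H.1) = 0 := by
    rw [bracket_mul hx.1, bracket_x, H.2.2, zero_mul, mul_zero, add_zero]
  rw [zero_add] at mul_mem
  exact ⟨mul_mem, bracket_mul_eq_zero⟩

end DegreeZero

theorem rep_mem_qCocycles {j k : ℤ} (hjk : j + (n + 1) = k) {γ : GraFamily (n + 1)}
    (hγ : γ ∈ fgcCocycles (n + 1) j) (N e : ℕ) (H : V.Ham) :
    (V.rep (γ N e) fun _ => H.1) ∈ V.qCocycles H k := by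
  subst hjk
  exact ⟨V.rep_mem_homogeneous_of_mem_fgcCochains hγ.1 N e H.2.1,
    V.bracket_rep_eq_zero_of_mem_fgcCocycles hγ N e H⟩

theorem evalAt_mem_qCocycles {j k : ℤ} (hjk : j + (n + 1) = k) {γ : GraFamily (n + 1)}
    (hγ : γ ∈ fgcCocycles (n + 1) j) (hfin : γ ∈ finiteFamilies (n + 1)) (H : V.Ham) :
    V.evalAt γ H.1 ∈ V.qCocycles H k :=
  V.evalAt_mem_of_forall_rep_mem hfin fun N e => V.rep_mem_qCocycles hjk hγ N e H

theorem evalAt_mem_qCoboundaries {j k : ℤ} (hjk : j + (n + 1) = k) {γ : GraFamily (n + 1)}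
    (hγ : γ ∈ fgcCoboundaries (n + 1) j) (hfin : γ ∈ finiteFamilies (n + 1)) (H : V.Ham) :
    V.evalAt γ H.1 ∈ V.qCoboundaries H k := by
  subst hjk
  obtain ⟨η, hη, rfl⟩ := hγ
  exact V.evalAt_mem_of_forall_rep_mem hfin fun N e => V.rep_diff_mem_qCoboundaries hη N e H

theorem qCoboundaries_zero (H : V.Ham) : V.qCoboundaries H 0 = ⊥ :=
  (congrArg (Submodule.map (V.bracket H.1)) (V.homogeneous_eq_bot_of_neg (by omega))).trans
    (Submodule.map_bot _)

theorem evalAt_mul_mem_qCocycles {γ : GraFamily (n + 1)}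
    (hγ : γ ∈ fgcCocycles (n + 1) (-((n : ℤ) + 1))) (hfin : γ ∈ finiteFamilies (n + 1))
    (H : V.Ham) : V.evalAt γ H.1 * H.1 ∈ V.qCocycles H (n + 1) :=
  mul_mem_qCocycles (V.evalAt_mem_qCocycles (neg_add_cancel _) hγ hfin H)

/-- The flow of a cocycle of degree zero with finitely many components. -/
def hamiltonianFlow : finiteCocycles (n + 1) 0 →ₗ[ℝ] V.HFlow where
  toFun γ := ⟨fun H => Submodule.Quotient.mk
      ⟨V.evalAt γ.1 H.1, V.evalAt_mem_qCocycles (zero_add _) γ.1.2 γ.2 H⟩,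
    ⟨γ.1, γ.2, fun W => W.evalAt_mem_qCocycles (zero_add _) γ.1.2 γ.2, fun _ => ⟨_, rfl⟩⟩⟩
  map_add' γ γ' := Subtype.ext <| funext fun H =>
    congrArg Submodule.Quotient.mk (Subtype.ext (V.evalAt_add _ _ γ.2 γ'.2 H.1))
  map_smul' r γ := Subtype.ext <| funext fun H =>
    congrArg Submodule.Quotient.mk (Subtype.ext (V.evalAt_smul r _ γ.2 H.1))

/-- The flow `H ↦ [Ω(H) · H]` of a cocycle of degree `-d` with finitely many components.  It is
universal since multiplying by `H` amounts to adding an isolated vertex. -/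
def conformalFlow : finiteCocycles (n + 1) (-((n : ℤ) + 1)) →ₗ[ℝ] V.cHFlow where
  toFun γ := ⟨⟨fun H => Submodule.Quotient.mk
      ⟨V.evalAt γ.1 H.1 * H.1, V.evalAt_mul_mem_qCocycles γ.1.2 γ.2 H⟩,
    ⟨addVertex γ.1, addVertex_mem_finiteFamilies γ.2,
      fun W H => W.evalAt_addVertex γ.2 H.1 ▸ W.evalAt_mul_mem_qCocycles γ.1.2 γ.2 H,
      fun H => V.evalAt_addVertex γ.2 H.1 ▸ ⟨_, rfl⟩⟩⟩,
    ⟨fun H => V.evalAt γ.1 H.1, fun H =>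
      have cocycle := V.evalAt_mem_qCocycles (neg_add_cancel _) γ.1.2 γ.2 H
      ⟨cocycle.1, cocycle.2, _, rfl⟩⟩⟩
  map_add' γ γ' := Subtype.ext <| Subtype.ext <| funext fun H =>
    congrArg Submodule.Quotient.mk <| Subtype.ext <|
      (congrArg (· * H.1) (V.evalAt_add _ _ γ.2 γ'.2 H.1)).trans (add_mul _ _ _)
  map_smul' r γ := Subtype.ext <| Subtype.ext <| funext fun H =>
    congrArg Submodule.Quotient.mk <| Subtype.ext <|
      (congrArg (· * H.1) (V.evalAt_smul r _ γ.2 H.1)).trans (smul_mul_assoc _ _ _)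

section FlowMaps

variable {V}

theorem isClassOf_iff {H : V.Ham} {k : ℤ} {f : V.Fun} {c : V.QCohomology H k}
    (hf : f ∈ V.qCocycles H k) : V.IsClassOf f c ↔ c = Submodule.Quotient.mk ⟨f, hf⟩ :=
  ⟨fun ⟨_, h⟩ => h, fun h => ⟨hf, h⟩⟩

theorem isHamiltonianFlowMap_iff {Φ : finiteCohomology (n + 1) 0 →ₗ[ℝ] V.HFlow} :
    V.IsHamiltonianFlowMap Φ ↔ Φ ∘ₗ finiteCocycleClass (n + 1) 0 = V.hamiltonianFlow :=
  ⟨fun h => LinearMap.ext fun γ => Subtype.ext <| funext fun H =>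
      (isClassOf_iff (V.evalAt_mem_qCocycles (zero_add _) γ.1.2 γ.2 H)).1 (h γ.1 γ.2 H),
    fun h γ hγ H => (isClassOf_iff (V.evalAt_mem_qCocycles (zero_add _) γ.2 hγ H)).2 <|
      congrArg (fun F : V.HFlow => F.1 H) (LinearMap.congr_fun h ⟨γ, hγ⟩)⟩

theorem isConformalFlowMap_iff
    {Φ : finiteCohomology (n + 1) (-((n : ℤ) + 1)) →ₗ[ℝ] V.cHFlow} :
    V.IsConformalFlowMap Φ ↔ Φ ∘ₗ finiteCocycleClass (n + 1) _ = V.conformalFlow :=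
  ⟨fun h => LinearMap.ext fun γ => Subtype.ext <| Subtype.ext <| funext fun H =>
      (isClassOf_iff (V.evalAt_mul_mem_qCocycles γ.1.2 γ.2 H)).1 (h γ.1 γ.2 H),
    fun h γ hγ H => (isClassOf_iff (V.evalAt_mul_mem_qCocycles γ.2 hγ H)).2 <|
      congrArg (fun F : V.cHFlow => F.1.1 H) (LinearMap.congr_fun h ⟨γ, hγ⟩)⟩

end FlowMaps

theorem ker_finiteCocycleClass_le_ker_hamiltonianFlow :
    LinearMap.ker (finiteCocycleClass (n + 1) 0) ≤ LinearMap.ker V.hamiltonianFlow :=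
  fun γ hγ => Subtype.ext <| funext fun H => (Submodule.Quotient.mk_eq_zero _).2 <|
    V.evalAt_mem_qCoboundaries (zero_add _) (finiteCocycleClass_eq_zero_iff.1 hγ) γ.2 H

theorem ker_finiteCocycleClass_le_ker_conformalFlow :
    LinearMap.ker (finiteCocycleClass (n + 1) (-((n : ℤ) + 1))) ≤
      LinearMap.ker V.conformalFlow := by
  refine fun γ hγ => Subtype.ext <| Subtype.ext <| funext fun H =>
    (Submodule.Quotient.mk_eq_zero _).2 ?_
  have evalAt_eq_zero : V.evalAt γ.1 H.1 = 0 :=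
    (Submodule.mem_bot ℝ).1 <| V.qCoboundaries_zero H ▸ V.evalAt_mem_qCoboundaries
      (neg_add_cancel _) (finiteCocycleClass_eq_zero_iff.1 hγ) γ.2 H
  change V.evalAt γ.1 H.1 * H.1 ∈ V.qCoboundaries H (n + 1)
  rw [evalAt_eq_zero, zero_mul]
  exact zero_mem _

theorem existsUnique_isHamiltonianFlowMap :
    ∃! Φ : finiteCohomology (n + 1) 0 →ₗ[ℝ] V.HFlow, V.IsHamiltonianFlowMap Φ := by
  simp only [isHamiltonianFlowMap_iff]
  exact existsUnique_comp_eq (finiteCocycleClass_surjective _ _)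
    V.ker_finiteCocycleClass_le_ker_hamiltonianFlow

theorem existsUnique_isConformalFlowMap :
    ∃! Φ : finiteCohomology (n + 1) (-((n : ℤ) + 1)) →ₗ[ℝ] V.cHFlow,
      V.IsConformalFlowMap Φ := by
  simp only [isConformalFlowMap_iff]
  exact existsUnique_comp_eq (finiteCocycleClass_surjective _ _)
    V.ker_finiteCocycleClass_le_ker_conformalFlow

end DarbouxChart

namespace Gra

/-! ### Graphs all of whose edges join the same two vertices -/

instance decidableIsUnshuffle {p q : ℕ} (σ : Equiv.Perm (Fin (p + q))) :
    Decidable (IsUnshuffle σ) :=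
  inferInstanceAs (Decidable ((∀ i j : Fin p, i < j →
    σ⁻¹ (Fin.castAdd q i) < σ⁻¹ (Fin.castAdd q j)) ∧
      ∀ i j : Fin q, i < j → σ⁻¹ (Fin.natAdd p i) < σ⁻¹ (Fin.natAdd p j)))

/-- The product over the edges of a graph of the values of the antisymmetrization of `w`. -/
def weightGraph {N k : ℕ} (w : Fin N → Fin N → ℤ) (g : LGraph N k) : ℤ :=
  ∏ e, (w (g e).1 (g e).2 - w (g e).2 (g e).1)

/-- The indicator function of the pair of vertices `(p, q)`. The associated weight detects the
graphs all of whose edges join `p` and `q`. -/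
def edgeWeight {N : ℕ} (p q i j : Fin N) : ℤ := if i = p ∧ j = q then 1 else 0

/-- The sum of the values of a function of pairs of vertices over the fibers of `φ`. -/
def pushWeight {N N' : ℕ} (φ : Fin N → Fin N') (w : Fin N → Fin N → ℤ) (u v : Fin N') : ℤ :=
  ∑ i with φ i = u, ∑ j with φ j = v, w i j

theorem weightGraph_flip {N k : ℕ} (w : Fin N → Fin N → ℤ) (g : LGraph N k) (e : Fin k) :
    weightGraph w (g.flip e) = -weightGraph w g := by
  unfold weightGraph
  rw [← Finset.mul_prod_erase _ _ (Finset.mem_univ e),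
    ← Finset.mul_prod_erase _ (fun e => w (g e).1 (g e).2 - w (g e).2 (g e).1)
      (Finset.mem_univ e), ← neg_mul]
  congr 1
  · simp [LGraph.flip]
  · refine Finset.prod_congr rfl fun e' he' => ?_
    simp [LGraph.flip, Function.update_of_ne (Finset.ne_of_mem_erase he')]

theorem weightGraph_permEdges {N k : ℕ} (w : Fin N → Fin N → ℤ) (g : LGraph N k)
    (σ : Equiv.Perm (Fin k)) : weightGraph w (g.permEdges σ) = weightGraph w g :=
  Equiv.prod_comp σ fun e => w (g e).1 (g e).2 - w (g e).2 (g e).1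

theorem weightGraph_append {N j k : ℕ} (w : Fin N → Fin N → ℤ) (g : LGraph N j)
    (h : LGraph N k) : weightGraph w (Fin.append g h) = weightGraph w g * weightGraph w h := by
  simp only [weightGraph, Fin.prod_univ_add, Fin.append_left, Fin.append_right]

theorem pushWeight_sub_pushWeight {N N' : ℕ} (φ : Fin N → Fin N') (w : Fin N → Fin N → ℤ)
    (p : Fin N' × Fin N') : pushWeight φ w p.1 p.2 - pushWeight φ w p.2 p.1 =
      ∑ q ∈ fiber φ p, (w q.1 q.2 - w q.2 q.1) := by
  rw [fiber, Finset.sum_sub_distrib, Finset.sum_product, Finset.sum_product_right]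
  rfl

theorem weightGraph_pushWeight {N N' k : ℕ} (φ : Fin N → Fin N') (w : Fin N → Fin N → ℤ)
    (g : LGraph N' k) : weightGraph (pushWeight φ w) g =
      ∑ g' ∈ Fintype.piFinset fun e => fiber φ (g e), weightGraph w g' := by
  simp only [weightGraph, pushWeight_sub_pushWeight]
  exact Finset.prod_univ_sum _ _

section OddDegree

theorem sign_pow_of_odd {d N : ℕ} (hd : Odd d) (σ : Equiv.Perm (Fin N)) :
    ((Equiv.Perm.sign σ : ℤ) : ℝ) ^ d = (Equiv.Perm.sign σ : ℤ) := by
  rcases Int.units_eq_one_or (Equiv.Perm.sign σ) with h | h <;> simp [h, hd.neg_one_pow]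

theorem sign_pow_of_even {d N : ℕ} (hd : Even d) (σ : Equiv.Perm (Fin N)) :
    ((Equiv.Perm.sign σ : ℤ) : ℝ) ^ d = 1 := by
  rcases Int.units_eq_one_or (Equiv.Perm.sign σ) with h | h <;> simp [h, hd.neg_one_pow]

variable {d : ℕ} (hd : Odd d)

/-- The linear map on `Gra d` extending `weightGraph w`. -/
def weight {N k : ℕ} (w : Fin N → Fin N → ℤ) : Gra d N k →ₗ[ℝ] ℝ :=
  lift (fun g => (weightGraph w g : ℝ))
    (fun g e => by rw [weightGraph_flip, hd.neg_one_pow]; norm_num)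
    (fun g σ => by rw [weightGraph_permEdges, sign_pow_of_even hd.add_one, one_smul])

theorem weight_mk {N k : ℕ} (w : Fin N → Fin N → ℤ) (g : LGraph N k) :
    weight hd w (mk d g) = weightGraph w g := lift_mk _ _ _ _

theorem weight_congr {N k : ℕ} {w w' : Fin N → Fin N → ℤ}
    (h : ∀ i j, w i j - w j i = w' i j - w' j i) (x : Gra d N k) :
    weight hd w x = weight hd w' x := by
  have weight_eq : weight (k := k) hd w = weight hd w' := ext_mk fun g => by
    simp only [weight_mk, weightGraph, h]
  rw [weight_eq]

theorem weight_permVertices {N k : ℕ} (w : Fin N → Fin N → ℤ) (σ : Equiv.Perm (Fin N))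
    (x : Gra d N k) :
    weight hd w (permVertices d σ x) = weight hd (fun i j => w (σ⁻¹ i) (σ⁻¹ j)) x := by
  have weight_comp : weight (k := k) hd w ∘ₗ permVertices d σ =
      weight hd (fun i j => w (σ⁻¹ i) (σ⁻¹ j)) := ext_mk fun g => by
    rw [LinearMap.comp_apply, permVertices, lift_mk, weight_mk, weight_mk]
    rfl
  exact LinearMap.congr_fun weight_comp x

theorem weight_comp₁ {M N j k : ℕ} (w : Fin (N + M) → Fin (N + M) → ℤ) (x : Gra d (M + 1) j)
    (y : Gra d N k) : weight hd w (comp₁ d x y) =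
      weight hd (pushWeight (collapse M N) w) x *
        weight hd (fun i j => w (Fin.castAdd M i) (Fin.castAdd M j)) y := by
  induction x using mk_induction with
  | zero => simp
  | add x x' hx hx' => simp only [map_add, LinearMap.add_apply, hx, hx', add_mul]
  | smul c x hx => simp only [map_smul, LinearMap.smul_apply, hx, smul_mul_assoc]
  | mk g =>
    induction y using mk_induction with
    | zero => simp
    | add y y' hy hy' => simp only [map_add, hy, hy', mul_add]
    | smul c y hy => simp only [map_smul, hy, mul_smul_comm]
    | mk h =>
      rw [comp₁, lift_mk, lift_mk, insertGraph_eq_sum_piFinset, map_sum]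
      simp only [weight_mk, weightGraph_append, weightGraph_pushWeight]
      rw [← Int.cast_sum, ← Int.cast_mul, ← Finset.sum_mul]
      rfl

include hd in
theorem preLie_apply_of_odd {M N j k : ℕ} (x : Gra d (M + 1) j) (y : Gra d N k) :
    preLie d x y = ∑ σ : Equiv.Perm (Fin (N + M)) with IsUnshuffle σ,
      ((Equiv.Perm.sign σ : ℤ) : ℝ) • permVertices d σ (comp₁ d x y) := by
  classical
  rw [preLie, LinearMap.sum_apply, LinearMap.sum_apply]
  refine Finset.sum_congr (by ext σ; simp) fun σ _ => ?_
  rw [sign_pow_of_odd hd]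
  rfl

theorem weight_preLie {M N j k : ℕ} (w : Fin (N + M) → Fin (N + M) → ℤ) (x : Gra d (M + 1) j)
    (y : Gra d N k) : weight hd w (preLie d x y) =
      ∑ σ : Equiv.Perm (Fin (N + M)) with IsUnshuffle σ, ((Equiv.Perm.sign σ : ℤ) : ℝ) *
        (weight hd (pushWeight (collapse M N) fun i j => w (σ⁻¹ i) (σ⁻¹ j)) x *
          weight hd (fun i j => w (σ⁻¹ (Fin.castAdd M i)) (σ⁻¹ (Fin.castAdd M j))) y) := by
  simp only [preLie_apply_of_odd hd, map_sum, map_smul, smul_eq_mul, weight_permVertices,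
    weight_comp₁]

theorem weight_cast {N N' k k' : ℕ} (hN : N = N') (hk : k = k') (w : Fin N' → Fin N' → ℤ)
    (x : Gra d N k) : weight hd w (cast d hN hk x) =
      weight hd (fun i j => w (Fin.cast hN i) (Fin.cast hN j)) x := by
  subst hN hk
  rfl

theorem weight_bracket {M N j k : ℕ} (w : Fin (M + N + 1) → Fin (M + N + 1) → ℤ)
    (x : Gra d (M + 1) j) (y : Gra d (N + 1) k) : weight hd w (bracket d x y) =
      weight hd (fun u v => w (Fin.cast (by omega) u) (Fin.cast (by omega) v)) (preLie d x y) -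
        (-1) ^ (fgcDegree d M j * fgcDegree d N k) *
          weight hd (fun u v => w (Fin.cast (by omega) u) (Fin.cast (by omega) v))
            (preLie d y x) := by
  rw [bracket, LinearMap.sub_apply, LinearMap.smul_apply, LinearMap.comp_apply,
    LinearMap.comp_apply, LinearMap.flip_apply, map_sub, map_smul, weight_cast, weight_cast,
    smul_eq_mul]

theorem weight_edge (w : Fin (1 + 1) → Fin (1 + 1) → ℤ) :
    weight hd w (edge d) = (w 0 1 - w 1 0 : ℤ) := by
  rw [edge, weight_mk, weightGraph, Fin.prod_univ_one]

theorem weight_edgeWeight_perm {N k : ℕ} {x : Gra d N k}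
    (hx : ∀ σ : Equiv.Perm (Fin N), permVertices d σ x = ((Equiv.Perm.sign σ : ℤ) : ℝ) • x)
    (σ : Equiv.Perm (Fin N)) (p q : Fin N) :
    weight hd (edgeWeight (σ p) (σ q)) x =
      ((Equiv.Perm.sign σ : ℤ) : ℝ) * weight hd (edgeWeight p q) x := by
  have weight_perm := weight_permVertices hd (edgeWeight p q) σ x
  rw [hx, map_smul, smul_eq_mul] at weight_perm
  rw [weight_perm]
  unfold edgeWeight
  simp only [Equiv.Perm.inv_eq_iff_eq]

/-- The function of pairs of vertices whose weight detects the graphs on four vertices all of whose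
edges join `0` and `1`, or `2` and `3`. -/
def twoEdgeWeight (i j : Fin 4) : ℤ := edgeWeight 0 1 i j + edgeWeight 2 3 i j

section ThreeVertices

variable {k : ℕ} {x : Gra d 3 k}
  (hx : ∀ σ : Equiv.Perm (Fin 3), permVertices d σ x = ((Equiv.Perm.sign σ : ℤ) : ℝ) • x)

include hx

theorem weight_edgeWeight_one_two :
    weight hd (edgeWeight 1 2) x = weight hd (edgeWeight 0 1) x := by
  have weight_rotate := weight_edgeWeight_perm hd hx (finRotate 3) 0 1
  rwa [show Equiv.Perm.sign (finRotate 3) = 1 by decide, Units.val_one, Int.cast_one,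
    one_mul] at weight_rotate

theorem weight_twoEdgeWeight_preLie_edge_left :
    weight hd twoEdgeWeight (preLie (M := 1) d (edge d) x) = 4 * weight hd (edgeWeight 0 1) x := by
  have sign_mul_pushWeight : ∀ σ : Equiv.Perm (Fin (3 + 1)), IsUnshuffle (p := 3) (q := 1) σ →
      (Equiv.Perm.sign σ : ℤ) *
        (pushWeight (collapse 1 3) (fun i j => twoEdgeWeight (σ⁻¹ i) (σ⁻¹ j)) 0 1 -
          pushWeight (collapse 1 3) (fun i j => twoEdgeWeight (σ⁻¹ i) (σ⁻¹ j)) 1 0) = 1 := by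
    decide +kernel
  have restrict_twoEdgeWeight : ∀ σ : Equiv.Perm (Fin (3 + 1)),
      IsUnshuffle (p := 3) (q := 1) σ →
      (∀ i j : Fin 3, twoEdgeWeight (σ⁻¹ (Fin.castAdd 1 i)) (σ⁻¹ (Fin.castAdd 1 j)) =
        edgeWeight 0 1 i j) ∨
      ∀ i j : Fin 3, twoEdgeWeight (σ⁻¹ (Fin.castAdd 1 i)) (σ⁻¹ (Fin.castAdd 1 j)) =
        edgeWeight 1 2 i j := by
    decide +kernel
  have card_isUnshuffle : (Finset.univ.filter fun σ : Equiv.Perm (Fin (3 + 1)) =>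
      IsUnshuffle (p := 3) (q := 1) σ).card = 4 := by
    decide +kernel
  have summand_eq : ∀ σ : Equiv.Perm (Fin (3 + 1)), IsUnshuffle (p := 3) (q := 1) σ →
      ((Equiv.Perm.sign σ : ℤ) : ℝ) * (weight hd (pushWeight (collapse 1 3)
        fun i j => twoEdgeWeight (σ⁻¹ i) (σ⁻¹ j)) (edge d) * weight hd (fun i j : Fin 3 =>
          twoEdgeWeight (σ⁻¹ (Fin.castAdd 1 i)) (σ⁻¹ (Fin.castAdd 1 j))) x) =
        weight hd (edgeWeight 0 1) x := by
    intro σ hσ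
    have weight_restrict : weight hd (fun i j : Fin 3 => twoEdgeWeight
        (σ⁻¹ (Fin.castAdd 1 i)) (σ⁻¹ (Fin.castAdd 1 j))) x = weight hd (edgeWeight 0 1) x := by
      rcases restrict_twoEdgeWeight σ hσ with h | h
      · simp only [h]
      · simp only [h, weight_edgeWeight_one_two hd hx]
    rw [weight_edge, weight_restrict, ← mul_assoc, ← Int.cast_mul, sign_mul_pushWeight σ hσ,
      Int.cast_one, one_mul]
  rw [weight_preLie (M := 1) (N := 3),
    Finset.sum_congr rfl fun σ hσ => summand_eq σ (Finset.mem_filter.1 hσ).2, Finset.sum_const,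
    card_isUnshuffle, nsmul_eq_mul, Nat.cast_ofNat]

theorem weight_twoEdgeWeight_preLie_edge_right :
    weight hd twoEdgeWeight (preLie (M := 2) d x (edge d)) =
      2 * weight hd (edgeWeight 0 1) x := by
  have push_twoEdgeWeight : ∀ σ : Equiv.Perm (Fin (1 + 1 + 2)),
      IsUnshuffle (p := 1 + 1) (q := 2) σ →
      twoEdgeWeight (σ⁻¹ 0) (σ⁻¹ 1) - twoEdgeWeight (σ⁻¹ 1) (σ⁻¹ 0) = 0 ∨
      ∀ i j : Fin 3,
        pushWeight (collapse 2 (1 + 1)) (fun i j => twoEdgeWeight (σ⁻¹ i) (σ⁻¹ j)) i j -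
        pushWeight (collapse 2 (1 + 1)) (fun i j => twoEdgeWeight (σ⁻¹ i) (σ⁻¹ j)) j i =
          edgeWeight 1 2 i j - edgeWeight 1 2 j i := by
    decide +kernel
  have sum_sign_mul : ∑ σ : Equiv.Perm (Fin (1 + 1 + 2)) with IsUnshuffle (p := 1 + 1) (q := 2) σ,
      (Equiv.Perm.sign σ : ℤ) *
        (twoEdgeWeight (σ⁻¹ 0) (σ⁻¹ 1) - twoEdgeWeight (σ⁻¹ 1) (σ⁻¹ 0)) = 2 := by
    decide +kernel
  have summand_eq : ∀ σ : Equiv.Perm (Fin (1 + 1 + 2)), IsUnshuffle (p := 1 + 1) (q := 2) σ →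
      ((Equiv.Perm.sign σ : ℤ) : ℝ) * (weight hd (pushWeight (collapse 2 (1 + 1))
        fun i j => twoEdgeWeight (σ⁻¹ i) (σ⁻¹ j)) x * weight hd (fun i j : Fin (1 + 1) =>
          twoEdgeWeight (σ⁻¹ (Fin.castAdd 2 i)) (σ⁻¹ (Fin.castAdd 2 j))) (edge d)) =
        (((Equiv.Perm.sign σ : ℤ) * (twoEdgeWeight (σ⁻¹ 0) (σ⁻¹ 1) -
          twoEdgeWeight (σ⁻¹ 1) (σ⁻¹ 0)) : ℤ) : ℝ) * weight hd (edgeWeight 0 1) x := by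
    intro σ hσ
    rw [weight_edge, Int.cast_mul, mul_assoc, mul_comm (weight hd _ x)]
    change _ * (((twoEdgeWeight (σ⁻¹ 0) (σ⁻¹ 1) - twoEdgeWeight (σ⁻¹ 1) (σ⁻¹ 0) : ℤ) : ℝ) * _) = _
    rcases push_twoEdgeWeight σ hσ with h | h
    · rw [h, Int.cast_zero, zero_mul, zero_mul]
    · rw [weight_congr hd h, weight_edgeWeight_one_two hd hx]
  rw [weight_preLie (M := 2) (N := 1 + 1),
    Finset.sum_congr rfl fun σ hσ => summand_eq σ (Finset.mem_filter.1 hσ).2, ← Finset.sum_mul,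
    ← Int.cast_sum, sum_sign_mul, Int.cast_ofNat]

end ThreeVertices

theorem exists_perm_of_ne : ∀ p q : Fin 3, p ≠ q →
    ∃ σ : Equiv.Perm (Fin 3), σ 0 = p ∧ σ 1 = q := by
  decide

theorem weight_edgeWeight_eq_zero_of_mem_fgcCocycles {i : ℤ} {c : GraFamily d}
    (hc : c ∈ fgcCocycles d i) (k : ℕ) {p q : Fin 3} (hpq : p ≠ q) :
    weight hd (edgeWeight p q) (c 2 k) = 0 := by
  have hx : ∀ σ : Equiv.Perm (Fin 3),
      permVertices d σ (c 2 k) = ((Equiv.Perm.sign σ : ℤ) : ℝ) • c 2 k := fun σ =>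
    (hc.1.1 2 k σ).trans (congrArg (· • c 2 k) (sign_pow_of_odd hd σ))
  obtain ⟨σ, rfl, rfl⟩ := exists_perm_of_ne p q hpq
  have weight_bracket_eq_zero :
      weight hd (N := 4) twoEdgeWeight (bracket (M := 1) (N := 2) d (edge d) (c 2 k)) = 0 := by
    have diff_eq_zero : diff d c 3 (k + 1) = 0 := by
      rw [show diff d c = 0 from hc.2]
      rfl
    have weight_diff := congrArg (weight hd (N := 4) twoEdgeWeight) diff_eq_zero
    rw [map_zero] at weight_diff
    exact (weight_cast hd _ _ twoEdgeWeight _).symm.trans weight_diff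
  have weight_bracket_eq : weight hd (N := 4) twoEdgeWeight
      (bracket (M := 1) (N := 2) d (edge d) (c 2 k)) = 4 * weight hd (edgeWeight 0 1) (c 2 k) -
        (-1) ^ (fgcDegree d 1 1 * fgcDegree d 2 k) * (2 * weight hd (edgeWeight 0 1) (c 2 k)) := by
    rw [← weight_twoEdgeWeight_preLie_edge_left hd hx,
      ← weight_twoEdgeWeight_preLie_edge_right hd hx]
    exact weight_bracket hd (M := 1) (N := 2) twoEdgeWeight (edge d) (c 2 k)
  have weight_zero_one : weight hd (edgeWeight 0 1) (c 2 k) = 0 := by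
    rw [weight_bracket_eq_zero] at weight_bracket_eq
    rcases Int.even_or_odd (fgcDegree d 1 1 * fgcDegree d 2 k) with h | h <;>
    · rw [h.neg_one_zpow] at weight_bracket_eq
      linarith
  rw [weight_edgeWeight_perm hd hx, weight_zero_one, mul_zero]

end OddDegree

/-! ### The theta graph -/

/-- The graph with two vertices and three parallel edges. -/
def theta (d : ℕ) : Gra d (1 + 1) 3 := mk d fun _ => (0, 1)

/-- The graph on three vertices with the given four edges. -/
def fourEdges (d : ℕ) (p q r s : Fin 3 × Fin 3) : Gra d 3 4 := mk d (![p, q, r, s] : LGraph 3 4)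

theorem permVertices_mk {N k : ℕ} (d : ℕ) (σ : Equiv.Perm (Fin N)) (g : LGraph N k) :
    permVertices d σ (mk d g) = mk d (g.mapVertices ⇑σ⁻¹) := lift_mk _ _ _ _

theorem permVertices_one {N k : ℕ} (d : ℕ) (x : Gra d N k) : permVertices d 1 x = x := by
  have permVertices_eq_id : permVertices (k := k) d (1 : Equiv.Perm (Fin N)) = LinearMap.id :=
    ext_mk fun g => permVertices_mk d 1 g
  rw [permVertices_eq_id, LinearMap.id_apply]

theorem comp₁_mk {M N j k : ℕ} (d : ℕ) (g : LGraph (M + 1) j) (h : LGraph N k) :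
    comp₁ d (mk d g) (mk d h) = insertGraph d g h := by
  rw [comp₁, lift_mk, lift_mk]

theorem permVertices_fourEdges (d : ℕ) (σ : Equiv.Perm (Fin 3)) (p q r s) :
    permVertices d σ (fourEdges d p q r s) = fourEdges d (σ⁻¹ p.1, σ⁻¹ p.2) (σ⁻¹ q.1, σ⁻¹ q.2)
      (σ⁻¹ r.1, σ⁻¹ r.2) (σ⁻¹ s.1, σ⁻¹ s.2) := by
  rw [fourEdges, permVertices_mk, fourEdges]
  congr 1
  funext e
  fin_cases e <;> rfl

theorem fiber_collapse_zero_one :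
    fiber (collapse 1 (1 + 1)) (0, 1) = ({(0, 2), (1, 2)} : Finset (Fin 3 × Fin 3)) := by
  decide

theorem comp₁_edge_theta (d : ℕ) : (comp₁ d (edge d) (theta d) : Gra d 3 4) =
    fourEdges d (0, 2) (0, 1) (0, 1) (0, 1) + fourEdges d (1, 2) (0, 1) (0, 1) (0, 1) := by
  have attachments : Fintype.piFinset
      (fun _ : Fin 1 => ({(0, 2), (1, 2)} : Finset (Fin 3 × Fin 3))) =
        {fun _ => (0, 2), fun _ => (1, 2)} := by decide
  refine (comp₁_mk (M := 1) d _ _).trans ?_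
  rw [insertGraph_eq_sum_piFinset]
  simp only [fiber_collapse_zero_one]
  refine (Finset.sum_congr attachments fun _ _ => rfl).trans ?_
  rw [Finset.sum_pair (by decide)]
  refine congrArg₂ (· + ·) (congrArg (mk d) ?_) (congrArg (mk d) ?_) <;>
  · funext e
    fin_cases e <;> rfl

section OddDegree

variable {d : ℕ} (hd : Odd d)

include hd

theorem mk_flip_of_odd {N k : ℕ} (g : LGraph N k) (e : Fin k) : mk d (g.flip e) = -mk d g := by
  rw [mk_flip, hd.neg_one_pow, neg_one_smul]

theorem mk_permEdges_of_odd {N k : ℕ} (g : LGraph N k) (σ : Equiv.Perm (Fin k)) :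
    mk d (g.permEdges σ) = mk d g := by
  rw [mk_permEdges, sign_pow_of_even hd.add_one, one_smul]

theorem fourEdges_flip₀ (i j q r s) : fourEdges d (j, i) q r s = -fourEdges d (i, j) q r s := by
  rw [fourEdges, fourEdges, ← mk_flip_of_odd hd _ 0]
  congr 1
  funext e
  fin_cases e <;> rfl

theorem fourEdges_flip₁ (p i j r s) : fourEdges d p (j, i) r s = -fourEdges d p (i, j) r s := by
  rw [fourEdges, fourEdges, ← mk_flip_of_odd hd _ 1]
  congr 1
  funext e
  fin_cases e <;> rfl

theorem fourEdges_flip₂ (p q i j s) : fourEdges d p q (j, i) s = -fourEdges d p q (i, j) s := by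
  rw [fourEdges, fourEdges, ← mk_flip_of_odd hd _ 2]
  congr 1
  funext e
  fin_cases e <;> rfl

theorem fourEdges_swap₀ (p q r s) : fourEdges d p q r s = fourEdges d q p r s := by
  rw [fourEdges, fourEdges, ← mk_permEdges_of_odd hd _ (Equiv.swap 0 1)]
  congr 1
  funext e
  fin_cases e <;> rfl

theorem fourEdges_swap₁ (p q r s) : fourEdges d p q r s = fourEdges d p r q s := by
  rw [fourEdges, fourEdges, ← mk_permEdges_of_odd hd _ (Equiv.swap 1 2)]
  congr 1
  funext e
  fin_cases e <;> rfl

theorem fourEdges_swap₂ (p q r s) : fourEdges d p q r s = fourEdges d p q s r := by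
  rw [fourEdges, fourEdges, ← mk_permEdges_of_odd hd _ (Equiv.swap 2 3)]
  congr 1
  funext e
  fin_cases e <;> rfl

theorem comp₁_theta_edge : (comp₁ d (theta d) (edge d) : Gra d 3 4) =
    fourEdges d (0, 2) (0, 2) (0, 2) (0, 1) + (3 : ℝ) • fourEdges d (0, 2) (0, 2) (1, 2) (0, 1) +
    (3 : ℝ) • fourEdges d (0, 2) (1, 2) (1, 2) (0, 1) +
    fourEdges d (1, 2) (1, 2) (1, 2) (0, 1) := by
  have attachments : Fintype.piFinset
      (fun _ : Fin 3 => ({(0, 2), (1, 2)} : Finset (Fin 3 × Fin 3))) =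
        {![(0, 2), (0, 2), (0, 2)], ![(0, 2), (0, 2), (1, 2)], ![(0, 2), (1, 2), (0, 2)],
          ![(1, 2), (0, 2), (0, 2)], ![(0, 2), (1, 2), (1, 2)], ![(1, 2), (0, 2), (1, 2)],
          ![(1, 2), (1, 2), (0, 2)], ![(1, 2), (1, 2), (1, 2)]} := by decide
  have mk_append : ∀ p q r : Fin 3 × Fin 3, mk d (Fin.append (![p, q, r] : LGraph 3 3)
      (LGraph.mapVertices (Fin.castAdd 1) fun _ : Fin 1 => ((0, 1) : Fin (1 + 1) × Fin (1 + 1)))) =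
        fourEdges d p q r (0, 1) := fun p q r => by
    refine congrArg (mk d) ?_
    funext e
    fin_cases e <;> rfl
  refine (comp₁_mk (M := 1) d _ _).trans ?_
  rw [insertGraph_eq_sum_piFinset]
  simp only [fiber_collapse_zero_one]
  refine (Finset.sum_congr attachments fun _ _ => rfl).trans ?_
  iterate 7 rw [Finset.sum_insert (by decide)]
  rw [Finset.sum_singleton]
  simp only [mk_append]
  rw [fourEdges_swap₁ hd (0, 2) (1, 2) (0, 2), fourEdges_swap₀ hd (1, 2) (0, 2) (0, 2),
    fourEdges_swap₁ hd (0, 2) (1, 2) (0, 2), fourEdges_swap₀ hd (1, 2) (0, 2) (1, 2),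
    fourEdges_swap₁ hd (1, 2) (1, 2) (0, 2), fourEdges_swap₀ hd (1, 2) (0, 2) (1, 2)]
  module

omit hd in
theorem filter_isUnshuffle_two_one : (Finset.univ.filter fun σ : Equiv.Perm (Fin (2 + 1)) =>
    IsUnshuffle (p := 2) (q := 1) σ) = {1, Equiv.swap 1 2, Equiv.swap 1 2 * Equiv.swap 0 1} := by
  decide

theorem preLie_two_one {j k : ℕ} (x : Gra d (1 + 1) j) (y : Gra d (1 + 1) k) :
    preLie (M := 1) d x y = comp₁ (M := 1) d x y -
      permVertices d (Equiv.swap (1 : Fin 3) 2) (comp₁ (M := 1) d x y) +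
      permVertices d (Equiv.swap (1 : Fin 3) 2 * Equiv.swap 0 1) (comp₁ (M := 1) d x y) := by
  refine (preLie_apply_of_odd hd (M := 1) (N := 1 + 1) x y).trans ?_
  refine (Finset.sum_congr filter_isUnshuffle_two_one fun _ _ => rfl).trans ?_
  rw [Finset.sum_insert (by decide), Finset.sum_pair (by decide),
    show Equiv.Perm.sign (Equiv.swap (1 : Fin (2 + 1)) 2 * Equiv.swap 0 1) = 1 by decide,
    show Equiv.Perm.sign (Equiv.swap (1 : Fin (2 + 1)) 2) = -1 by decide, permVertices_one]
  simp only [Equiv.Perm.sign_one, Units.val_one, Units.val_neg, Int.cast_one, Int.cast_neg]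
  module

/-- Writing `x`, `y`, `z` for the edges `(0, 1)`, `(1, 2)`, `(0, 2)`, which commute and change sign
under reversal, this is the polynomial identity `(z + y) x³ - (x - y) z³ - (x + z) y³ +
(z + y)³ x - (x - y)³ z - (x + z)³ y = 0`. -/
theorem bracket_edge_theta : bracket d (edge d) (theta d) = 0 := by
  have degree_odd : Odd (fgcDegree d 1 1 * fgcDegree d 1 3) := by
    rw [show fgcDegree d 1 1 * fgcDegree d 1 3 = 2 * (1 - d) + 1 by
      unfold fgcDegree; push_cast; ring]
    exact odd_two_mul_add_one _
  have bracket_eq : bracket d (edge d) (theta d) =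
      (preLie (M := 1) d (edge d) (theta d) + preLie (M := 1) d (theta d) (edge d) :
        Gra d 3 4) := by
    refine (congrArg (fun s : ℝ => (preLie (M := 1) d (edge d) (theta d) : Gra d 3 4) -
      s • (preLie (M := 1) d (theta d) (edge d) : Gra d 3 4)) degree_odd.neg_one_zpow).trans ?_
    module
  suffices key : ∀ x y : Gra d 3 4, x = _ → y = _ →
      x - permVertices d (Equiv.swap 1 2) x + permVertices d (Equiv.swap 1 2 * Equiv.swap 0 1) x +
        (y - permVertices d (Equiv.swap 1 2) y +
          permVertices d (Equiv.swap 1 2 * Equiv.swap 0 1) y) = 0 by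
    refine bracket_eq.trans ?_
    refine (congrArg₂ (· + ·) (preLie_two_one hd _ _) (preLie_two_one hd _ _)).trans ?_
    exact key _ _ (comp₁_edge_theta d) (comp₁_theta_edge hd)
  rintro _ _ rfl rfl
  have swap_inv : ∀ i, (Equiv.swap 1 2 : Equiv.Perm (Fin 3))⁻¹ i = ![0, 2, 1] i := by decide
  have rotate_inv : ∀ i, (Equiv.swap 1 2 * Equiv.swap 0 1 : Equiv.Perm (Fin 3))⁻¹ i =
      ![1, 2, 0] i := by decide
  simp only [map_add, map_smul, permVertices_fourEdges, swap_inv, rotate_inv, Matrix.cons_val]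
  simp only [fourEdges_flip₀ hd 0 1, fourEdges_flip₀ hd 0 2, fourEdges_flip₀ hd 1 2,
    fun p => fourEdges_flip₁ hd p 0 1, fun p => fourEdges_flip₁ hd p 0 2,
    fun p => fourEdges_flip₁ hd p 1 2, fun p q => fourEdges_flip₂ hd p q 0 1,
    fun p q => fourEdges_flip₂ hd p q 0 2, fun p q => fourEdges_flip₂ hd p q 1 2,
    fourEdges_swap₀ hd (0, 2) (0, 1), fourEdges_swap₀ hd (1, 2) (0, 1),
    fourEdges_swap₀ hd (1, 2) (0, 2), fun p => fourEdges_swap₁ hd p (0, 2) (0, 1),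
    fun p => fourEdges_swap₁ hd p (1, 2) (0, 1), fun p => fourEdges_swap₁ hd p (1, 2) (0, 2),
    fun p q => fourEdges_swap₂ hd p q (0, 2) (0, 1),
    fun p q => fourEdges_swap₂ hd p q (1, 2) (0, 1),
    fun p q => fourEdges_swap₂ hd p q (1, 2) (0, 2)]
  module

theorem permVertices_theta (σ : Equiv.Perm (Fin (1 + 1))) :
    permVertices d σ (theta d) = ((Equiv.Perm.sign σ : ℤ) : ℝ) ^ d • theta d := by
  rw [sign_pow_of_odd hd, theta]
  rcases (by decide : ∀ σ : Equiv.Perm (Fin (1 + 1)), σ = 1 ∨ σ = Equiv.swap 0 1) σ with rfl | rfl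
  · rw [permVertices_one, Equiv.Perm.sign_one, Units.val_one, Int.cast_one, one_smul]
  · have mapVertices_swap : LGraph.mapVertices ((Equiv.swap 0 1)⁻¹ : Equiv.Perm (Fin (1 + 1)))
        (fun _ : Fin 3 => ((0, 1) : Fin (1 + 1) × Fin (1 + 1))) =
          LGraph.flip (LGraph.flip (LGraph.flip (fun _ => (0, 1)) 0) 1) 2 := by
      decide
    rw [permVertices_mk, mapVertices_swap, mk_flip_of_odd hd, mk_flip_of_odd hd,
      mk_flip_of_odd hd, Equiv.Perm.sign_swap (by decide), neg_neg, Units.val_neg, Units.val_one,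
      Int.cast_neg, Int.cast_one, neg_one_smul]

end OddDegree

/-- The family with the single component `theta`. -/
def thetaFamily (d : ℕ) : GraFamily d
  | 1, 3 => theta d
  | _, _ => 0

theorem thetaFamily_eq_zero {d N k : ℕ} (h : ¬(N = 1 ∧ k = 3)) : thetaFamily d N k = 0 := by
  unfold thetaFamily
  split
  · exact absurd ⟨rfl, rfl⟩ h
  · rfl

theorem thetaFamily_mem_finiteFamilies (d : ℕ) : thetaFamily d ∈ finiteFamilies d := by
  refine (Set.finite_singleton ((1, 3) : ℕ × ℕ)).subset fun p hp => ?_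
  by_contra h
  exact hp (thetaFamily_eq_zero fun h' => h (Prod.ext h'.1 h'.2))

theorem diff_thetaFamily {d : ℕ} (hd : Odd d) : diff d (thetaFamily d) = 0 := by
  funext N k
  rcases N with _ | N
  · rfl
  rcases k with _ | k
  · rfl
  change cast d _ _ (bracket d (edge d) (thetaFamily d N k)) = 0
  by_cases h : N = 1 ∧ k = 3
  · obtain ⟨rfl, rfl⟩ := h
    exact (congrArg _ (bracket_edge_theta hd)).trans (map_zero _)
  · rw [thetaFamily_eq_zero h, map_zero, map_zero]

theorem thetaFamily_mem_fgcCocycles {d : ℕ} (hd : Odd d) :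
    thetaFamily d ∈ fgcCocycles d (fgcDegree d 1 3) := by
  refine ⟨⟨fun N k σ => ?_, fun N k h => thetaFamily_eq_zero ?_⟩, diff_thetaFamily hd⟩
  · by_cases h : N = 1 ∧ k = 3
    · obtain ⟨rfl, rfl⟩ := h
      exact permVertices_theta hd σ
    · rw [thetaFamily_eq_zero h, map_zero, smul_zero]
  · rintro ⟨rfl, rfl⟩
    exact h rfl

end Gra

namespace DarbouxChart

open PiTensorProduct (tprod)

variable {n : ℕ} (V : DarbouxChart n)

/-! ### Functions on which a single edge operator acts nontrivially -/

theorem pdAt_tprod_eq_zero {N : ℕ} {i : Fin N} {a : Fin V.r} {f : Fin N → V.Fun}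
    (h : V.pd a (f i) = 0) : V.pdAt i a (tprod ℝ f) = 0 := by
  rw [V.pdAt_tprod]
  exact MultilinearMap.map_coord_zero _ i (by simp [pdTuple, h])

theorem edgeOp_tprod_eq_zero {N : ℕ} {i j : Fin N} {f : Fin N → V.Fun}
    (h : ∀ a b, V.pairing a b ≠ 0 → V.pd a (f i) = 0 ∨ V.pd b (f j) = 0) :
    V.edgeOp i j (tprod ℝ f) = 0 := by
  unfold edgeOp
  simp only [LinearMap.sum_apply, LinearMap.smul_apply]
  refine Finset.sum_eq_zero fun a _ => Finset.sum_eq_zero fun b _ => smul_eq_zero.2 ?_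
  refine or_iff_not_imp_left.2 fun hab => ?_
  rcases h a b hab with hi | hj
  · rw [V.pdAt_comm, LinearMap.smul_apply, Module.End.mul_apply, V.pdAt_tprod_eq_zero hi,
      map_zero, smul_zero]
  · rw [Module.End.mul_apply, V.pdAt_tprod_eq_zero hj, map_zero]

theorem edgeOp_self (hd : Odd (n + 1)) {N : ℕ} (i : Fin N) : V.edgeOp i i = 0 := by
  have swap := V.edgeOp_swap i i
  rw [hd.neg_one_pow] at swap
  have two_smul_edgeOp : (2 : ℝ) • V.edgeOp i i = 0 := by
    rw [two_smul]
    nth_rewrite 1 [swap]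
    module
  exact (smul_eq_zero.1 two_smul_edgeOp).resolve_left two_ne_zero

theorem graphOp_apply_eq_weightGraph_smul {N k : ℕ} (g : LGraph N k) {w : Fin N → Fin N → ℤ}
    {E : Module.End ℝ (⨂[ℝ] _ : Fin N, V.Fun)} {v : ⨂[ℝ] _ : Fin N, V.Fun}
    (hE : ∀ i j, Commute (V.edgeOp i j) E)
    (hv : ∀ i j, V.edgeOp i j v = ((w i j - w j i : ℤ) : ℝ) • E v) :
    V.graphOp g v = (Gra.weightGraph w g : ℝ) • (E ^ k) v := by
  induction k with
  | zero => simp [graphOp, Gra.weightGraph]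
  | succ k ih =>
    have graphOp_succ :
        V.graphOp g = V.edgeOp (g 0).1 (g 0).2 * V.graphOp (fun e => g e.succ) := by
      rw [graphOp, List.ofFn_succ, List.prod_cons, graphOp]
    have weightGraph_succ : Gra.weightGraph w g = (w (g 0).1 (g 0).2 - w (g 0).2 (g 0).1) *
        Gra.weightGraph w (fun e => g e.succ) := Fin.prod_univ_succ _
    have edgeOp_pow : V.edgeOp (g 0).1 (g 0).2 ((E ^ k) v) = (E ^ k) (V.edgeOp (g 0).1 (g 0).2 v) :=
      LinearMap.congr_fun ((hE _ _).pow_right k).eq v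
    rw [graphOp_succ, Module.End.mul_apply, ih, map_smul, edgeOp_pow, hv, map_smul, smul_smul,
      weightGraph_succ, pow_succ, Module.End.mul_apply, mul_comm, Int.cast_mul]

theorem rep_eq_weight_smul (hd : Odd (n + 1)) {N k : ℕ} {p q : Fin N} (hpq : p ≠ q)
    {f : Fin N → V.Fun} (hf : ∀ i j, i ≠ j → ¬(i = p ∧ j = q) → ¬(i = q ∧ j = p) →
      V.edgeOp i j (tprod ℝ f) = 0) (x : Gra (n + 1) N k) :
    V.rep x f = Gra.weight hd (Gra.edgeWeight p q) x •
      mulAll N ((V.edgeOp p q ^ k) (tprod ℝ f)) := by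
  have edgeOp_commute : ∀ i j, Commute (V.edgeOp i j) (V.edgeOp p q) := fun i j => by
    have neg_one_pow : (-1 : ℝ) ^ n = 1 := (Nat.not_odd_iff_even.1 fun h =>
      Nat.not_even_iff_odd.2 hd h.add_one).neg_one_pow
    exact (V.edgeOp_comm i j p q).trans (by rw [neg_one_pow, one_smul])
  have edgeOp_apply : ∀ i j, V.edgeOp i j (tprod ℝ f) =
      ((Gra.edgeWeight p q i j - Gra.edgeWeight p q j i : ℤ) : ℝ) •
        V.edgeOp p q (tprod ℝ f) := fun i j => by
    rcases eq_or_ne i j with rfl | hij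
    · simp [V.edgeOp_self hd]
    by_cases hpq' : i = p ∧ j = q
    · obtain ⟨rfl, rfl⟩ := hpq'
      simp [Gra.edgeWeight, hij]
    by_cases hqp : i = q ∧ j = p
    · obtain ⟨rfl, rfl⟩ := hqp
      simp [V.edgeOp_swap j i, hd.neg_one_pow, Gra.edgeWeight, hij]
    · simp [hf i j hij hpq' hqp, Gra.edgeWeight, hpq', hqp, and_comm]
  induction x using Gra.mk_induction with
  | zero => simp
  | add x y hx hy => rw [map_add, _root_.add_apply, hx, hy, map_add, add_smul]
  | smul c x hx => rw [map_smul, _root_.smul_apply, hx, map_smul, smul_assoc]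
  | mk g =>
    rw [V.rep_mk, V.repGraph_apply, Gra.weight_mk,
      V.graphOp_apply_eq_weightGraph_smul g edgeOp_commute edgeOp_apply, map_smul]

end DarbouxChart

namespace DarbouxChart

open CliffordAlgebra (contractLeft_ι)

variable {n : ℕ} (V : DarbouxChart n)

/-! ### Coordinates of odd degree -/

theorem pd_monom_of_odd (i : V.OddIdx) (f p q) : V.pd i (V.monom f p q) = V.monom f p
    (contractLeft (Q := (0 : QuadraticForm ℝ (V.OddIdx → ℝ))) (LinearMap.proj i) q) := by
  have deg_ne_zero : V.deg i ≠ 0 := i.2.pos.ne'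
  rw [pd, dif_neg deg_ne_zero, dif_neg (Nat.not_even_iff_odd.2 i.2), mapFun_monom]
  rfl

theorem pd_oddCoord (i j : V.OddIdx) : V.pd i (V.oddCoord j) = if i = j then 1 else 0 := by
  have contractLeft_single : contractLeft (Q := (0 : QuadraticForm ℝ (V.OddIdx → ℝ)))
      (LinearMap.proj i) (ExteriorAlgebra.ι ℝ (Pi.single j 1)) = if i = j then 1 else 0 := by
    refine (contractLeft_ι _ _ _).trans ?_
    rw [LinearMap.proj_apply, Pi.single_apply, apply_ite (algebraMap ℝ _), map_one, map_zero]
  rw [oddCoord, pd_monom_of_odd, contractLeft_single]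
  split_ifs
  · rw [one_eq_monom]
  · rw [← monomₗ_apply, map_zero]

theorem oddCoord_mul_self (i : V.OddIdx) : V.oddCoord i * V.oddCoord i = 0 := by
  rw [oddCoord, monom_mul_monom, ExteriorAlgebra.ι_sq_zero, ← monomₗ_apply, map_zero]

theorem oddCoord_mul_oddCoord (i j : V.OddIdx) :
    V.oddCoord i * V.oddCoord j = -(V.oddCoord j * V.oddCoord i) := by
  rw [oddCoord, oddCoord, monom_mul_monom, monom_mul_monom,
    eq_neg_of_add_eq_zero_left (ExteriorAlgebra.ι_add_mul_swap _ _), ← monomₗ_apply, map_neg,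
    monomₗ_apply]

/-- The value of a function at a point of the base, where the coordinates of positive degree
vanish. -/
def eval (x : V.dom) : V.Fun →ₐ[ℝ] ℝ :=
  (Algebra.TensorProduct.lmul' ℝ).comp <|
    Algebra.TensorProduct.map ((Pi.evalAlgHom ℝ (fun _ => ℝ) x).comp (Subalgebra.val _)) <|
      (Algebra.TensorProduct.lmul' ℝ).comp <|
        Algebra.TensorProduct.map (MvPolynomial.aeval 0) ExteriorAlgebra.algebraMapInv

end DarbouxChart

/-- The NP-manifold of degree two over a point with `r` orthonormal coordinates of degree one. -/
def euclideanChart (r : ℕ) : DarbouxChart 2 where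
  r := r
  deg _ := 1
  dom := ⊤
  pairing a b := if a = b then 1 else 0
  pairing_degree _ _ _ := rfl
  pairing_symm a b := by
    simp only [eq_comm (a := a)]
    norm_num
  pairing_nondeg := by
    have of_eq_one : (Matrix.of fun a b : Fin r => if a = b then (1 : ℝ) else 0) = 1 := by
      ext a b
      rw [Matrix.of_apply, Matrix.one_apply]
    rw [of_eq_one, Matrix.det_one]
    exact isUnit_one

namespace euclideanChart

open PiTensorProduct (tprod)

/-! ### Functions of anticommuting variables -/

variable {r : ℕ}

/-- The coordinates of `euclideanChart r`, as functions. -/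
def coord (a : Fin r) : (euclideanChart r).Fun := (euclideanChart r).oddCoord ⟨a, odd_one⟩

local notation "ξ" => coord

local notation "∂" => DarbouxChart.pd (euclideanChart _)

local notation "ε" => DarbouxChart.parity (euclideanChart _)

theorem pd_coord (a b : Fin r) : ∂ a (ξ b) = if a = b then 1 else 0 :=
  ((euclideanChart r).pd_oddCoord ⟨a, odd_one⟩ ⟨b, odd_one⟩).trans
    (if_congr Subtype.mk_eq_mk rfl rfl)

theorem parity_coord (a : Fin r) : ε (ξ a) = -ξ a :=
  (euclideanChart r).parity_oddCoord _

theorem coord_mul_self (a : Fin r) : ξ a * ξ a = 0 :=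
  (euclideanChart r).oddCoord_mul_self _

theorem coord_mul_coord (a b : Fin r) : ξ a * ξ b = -(ξ b * ξ a) :=
  (euclideanChart r).oddCoord_mul_oddCoord _ _

theorem coord_mem_homogeneous (a : Fin r) : ξ a ∈ (euclideanChart r).homogeneous 1 :=
  (euclideanChart r).oddCoord_mem_homogeneous _

theorem parity_mul (x y : (euclideanChart r).Fun) : ε (x * y) = ε x * ε y :=
  (euclideanChart r).parity_mul x y

theorem pd_mul (a : Fin r) (x y : (euclideanChart r).Fun) :
    ∂ a (x * y) = ∂ a x * y + ε x * ∂ a y :=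
  (euclideanChart r).pd_mul a x y

theorem pd_coord_mul_coord (a i j : Fin r) :
    ∂ a (ξ i * ξ j) = (if a = i then ξ j else 0) - if a = j then ξ i else 0 := by
  rw [pd_mul, pd_coord, pd_coord, parity_coord, neg_mul, ← sub_eq_add_neg]
  simp only [ite_mul, one_mul, zero_mul, mul_ite, mul_one, mul_zero]

theorem bracket_eq_sum (f g : (euclideanChart r).Fun) :
    (euclideanChart r).bracket f g = ∑ a : Fin r, ∂ a (ε f) * ∂ a g := by
  rw [DarbouxChart.bracket_apply]
  refine Finset.sum_congr rfl fun a _ => (Finset.sum_eq_single a (fun b _ hb => ?_) ?_).trans ?_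
  · exact (congrArg (· • _) (if_neg hb.symm)).trans (zero_smul ℝ _)
  · exact fun ha => absurd (Finset.mem_univ a) ha
  · exact (congrArg (· • _) (if_pos rfl)).trans (one_smul ℝ _)

theorem edgeOp_tprod_pair (f g : (euclideanChart r).Fun) :
    (euclideanChart r).edgeOp 0 1 (tprod ℝ ![f, g]) =
      ∑ a : Fin r, tprod ℝ ![∂ a (ε f), ∂ a g] := by
  unfold DarbouxChart.edgeOp
  simp only [LinearMap.sum_apply, LinearMap.smul_apply, Module.End.mul_apply,
    DarbouxChart.pdAt_tprod]
  refine Finset.sum_congr rfl fun a _ => (Finset.sum_eq_single a (fun b _ hb => ?_) ?_).trans ?_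
  · exact (congrArg (· • _) (if_neg hb.symm)).trans (zero_smul ℝ _)
  · exact fun ha => absurd (Finset.mem_univ a) ha
  · refine (congrArg (· • _) (if_pos rfl)).trans ((one_smul ℝ _).trans ?_)
    congr 1
    funext j
    fin_cases j <;> rfl

/-- The contraction of two functions along `k` parallel edges. -/
def contraction : ℕ → (euclideanChart r).Fun → (euclideanChart r).Fun → (euclideanChart r).Fun
  | 0, f, g => f * g
  | k + 1, f, g => ∑ a : Fin r, contraction k (∂ a (ε f)) (∂ a g)

theorem contraction_smul_smul (k : ℕ) (c c' : ℝ) (f g : (euclideanChart r).Fun) :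
    contraction k (c • f) (c' • g) = (c * c') • contraction k f g := by
  induction k generalizing f g with
  | zero => exact smul_mul_smul_comm _ _ _ _
  | succ k ih => simp only [contraction, map_smul, ih, Finset.smul_sum]

theorem contraction_one_coord (i : Fin r) : contraction 1 (ξ i) (ξ i) = -1 := by
  simp [contraction, parity_coord, pd_coord]

theorem contraction_two_coord_mul_coord {i j : Fin r} (hij : i ≠ j) :
    contraction 2 (ξ i * ξ j) (ξ i * ξ j) = (-2 : ℝ) • 1 := by
  have parity_eq : ε (ξ i * ξ j) = ξ i * ξ j := by
    rw [parity_mul, parity_coord, parity_coord, neg_mul_neg]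
  have contraction_neg_coord : contraction 1 (-ξ i) (-ξ i) = -1 := by
    simpa [contraction_one_coord] using contraction_smul_smul 1 (-1) (-1) (ξ i) (ξ i)
  rw [contraction, parity_eq, Fintype.sum_eq_add i j hij]
  · simp only [pd_coord_mul_coord, if_pos, if_neg hij, if_neg hij.symm, sub_zero, zero_sub,
      contraction_one_coord, contraction_neg_coord]
    module
  · rintro a ⟨hai, haj⟩
    rw [pd_coord_mul_coord, if_neg hai, if_neg haj, sub_zero]
    simpa using contraction_smul_smul 1 0 0 (0 : (euclideanChart r).Fun) 0

theorem mulAll_edgeOp_pow_tprod_pair (k : ℕ) (f g : (euclideanChart r).Fun) :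
    mulAll 2 (((euclideanChart r).edgeOp 0 1 ^ k) (tprod ℝ ![f, g])) = contraction k f g := by
  induction k generalizing f g with
  | zero =>
    rw [pow_zero, Module.End.one_apply, mulAll_tprod]
    simp [contraction]
  | succ k ih =>
    rw [pow_succ, Module.End.mul_apply, edgeOp_tprod_pair, map_sum, map_sum]
    exact Finset.sum_congr rfl fun a _ => ih _ _

theorem rep_theta (f : (euclideanChart r).Fun) :
    (euclideanChart r).rep (Gra.theta 3) (fun _ => f) = contraction 3 f f := by
  have const_eq_pair : (fun _ : Fin 2 => f) = ![f, f] := by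
    funext j
    fin_cases j <;> rfl
  rw [← mulAll_edgeOp_pow_tprod_pair, ← const_eq_pair, Gra.theta]
  refine (congrFun (congrArg DFunLike.coe ((euclideanChart r).rep_mk _)) _).trans ?_
  rw [DarbouxChart.repGraph_apply, DarbouxChart.graphOp, List.ofFn_const, List.prod_replicate]

theorem homogeneous_two_le {S : Submodule ℝ (euclideanChart r).Fun}
    (hS : ∀ i j : Fin r, ξ i * ξ j ∈ S) : (euclideanChart r).homogeneous 2 ≤ S := by
  refine DarbouxChart.homogeneous_le fun f m l hl => ?_
  have : IsEmpty (euclideanChart r).EvenIdx := ⟨fun i => Nat.not_even_one i.2.2⟩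
  have : IsEmpty (euclideanChart r).BaseIdx := ⟨fun i => one_ne_zero i.2⟩
  have const_f : f = f.1 ⟨0, trivial⟩ • 1 := Subtype.ext <| funext fun x => by
    rw [Subsingleton.elim x ⟨0, trivial⟩]
    exact (mul_one _).symm
  obtain rfl : m = 0 := Subsingleton.elim _ _
  have sum_deg : (l.map fun i : (euclideanChart r).OddIdx => (euclideanChart r).deg i).sum =
      l.length := by
    refine (congrArg List.sum (List.map_const' (l := l) (b := 1))).trans ?_
    rw [List.sum_replicate, smul_eq_mul, mul_one]
  rw [sum_deg, map_zero, Nat.cast_zero, zero_add] at hl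
  obtain ⟨i, j, rfl⟩ := List.length_eq_two.1 (Nat.cast_inj.1 hl)
  have monom_eq : (euclideanChart r).monom f (MvPolynomial.monomial 0 1)
      ((euclideanChart r).oddProd [i, j]) = f.1 ⟨0, trivial⟩ • (ξ i.1 * ξ j.1) := by
    change _ = f.1 ⟨0, trivial⟩ •
      ((euclideanChart r).oddCoord i * (euclideanChart r).oddCoord j)
    conv_lhs => rw [const_f, ← DarbouxChart.monomₗ_apply, map_smul, LinearMap.smul_apply,
      LinearMap.smul_apply, DarbouxChart.monomₗ_apply]
    rw [DarbouxChart.oddCoord, DarbouxChart.oddCoord, DarbouxChart.monom_mul_monom, mul_one,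
      mul_one]
    simp [DarbouxChart.oddProd]
  exact monom_eq ▸ S.smul_mem _ (hS i.1 j.1)

/-! ### Cubic Hamiltonian functions -/

/-- The cubic functions `s ξ₀ξ₁ξ₂ + t ξ₃ξ₄ξ₅`, a two-parameter family of Hamiltonian functions. -/
def cubic (s t : ℝ) : (euclideanChart 6).Fun := s • (ξ 0 * ξ 1 * ξ 2) + t • (ξ 3 * ξ 4 * ξ 5)

/-- The coefficient of the monomial `∂ a (cubic s t)`, see `pd_cubic`. -/
def cubicCoeff (s t : ℝ) : Fin 6 → ℝ := ![s, -s, s, t, -t, t]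

/-- The index of the first factor of the monomial `∂ a (cubic s t)`, see `pd_cubic`. -/
def cubicFst : Fin 6 → Fin 6 := ![1, 0, 0, 4, 3, 3]

/-- The index of the second factor of the monomial `∂ a (cubic s t)`, see `pd_cubic`. -/
def cubicSnd : Fin 6 → Fin 6 := ![2, 2, 1, 5, 5, 4]

theorem smul_cubic (c s t : ℝ) : c • cubic s t = cubic (c * s) (c * t) := by
  rw [cubic, smul_add, smul_smul, smul_smul, cubic]

theorem cubic_add_cubic (s t s' t' : ℝ) : cubic s t + cubic s' t' = cubic (s + s') (t + t') := by
  simp only [cubic]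
  module

theorem pd_cubic (s t : ℝ) (a : Fin 6) :
    ∂ a (cubic s t) = cubicCoeff s t a • (ξ (cubicFst a) * ξ (cubicSnd a)) := by
  fin_cases a <;>
  simp [cubic, cubicCoeff, cubicFst, cubicSnd, pd_mul, parity_mul, parity_coord, pd_coord]

theorem cubicFst_ne_cubicSnd (a : Fin 6) : cubicFst a ≠ cubicSnd a := by
  revert a
  decide

theorem parity_cubic (s t : ℝ) : ε (cubic s t) = -cubic s t := by
  simp [cubic, parity_mul, parity_coord, add_comm]

theorem cubic_mem_homogeneous (s t : ℝ) : cubic s t ∈ (euclideanChart 6).homogeneous 3 := by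
  have monomial_mem (a b c : Fin 6) : ξ a * ξ b * ξ c ∈ (euclideanChart 6).homogeneous 3 :=
    (by norm_num : (1 + 1 + 1 : ℤ) = 3) ▸ SetLike.mul_mem_graded (SetLike.mul_mem_graded
      (coord_mem_homogeneous a) (coord_mem_homogeneous b)) (coord_mem_homogeneous c)
  exact add_mem (Submodule.smul_mem _ _ (monomial_mem _ _ _))
    (Submodule.smul_mem _ _ (monomial_mem _ _ _))

theorem bracket_cubic (s t : ℝ) : (euclideanChart 6).bracket (cubic s t) (cubic s t) = 0 := by
  have mul_self_eq_zero (i j : Fin 6) : ξ i * ξ j * (ξ i * ξ j) = 0 := by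
    rw [mul_assoc, ← mul_assoc (ξ j), coord_mul_coord j i, neg_mul, mul_assoc, coord_mul_self j,
      mul_zero, neg_zero, mul_zero]
  rw [bracket_eq_sum]
  refine Finset.sum_eq_zero fun a _ => ?_
  rw [parity_cubic, map_neg, pd_cubic, neg_mul, smul_mul_smul_comm, mul_self_eq_zero, smul_zero,
    neg_zero]

/-- The cubic functions as Hamiltonian functions. -/
def cubicHam (s t : ℝ) : (euclideanChart 6).Ham :=
  ⟨cubic s t, cubic_mem_homogeneous s t, bracket_cubic s t⟩

theorem rep_theta_cubic (s t : ℝ) :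
    (euclideanChart 6).rep (Gra.theta 3) (fun _ => cubic s t) = (6 * (s ^ 2 + t ^ 2)) • 1 := by
  have summand_eq (a : Fin 6) : contraction 2 (∂ a (ε (cubic s t))) (∂ a (cubic s t)) =
      (2 * cubicCoeff s t a ^ 2) • 1 := by
    rw [parity_cubic, map_neg, pd_cubic, ← neg_smul, contraction_smul_smul,
      contraction_two_coord_mul_coord (cubicFst_ne_cubicSnd a), smul_smul]
    congr 1
    ring
  rw [rep_theta, contraction, Finset.sum_congr rfl fun a _ => summand_eq a, ← Finset.sum_smul]
  congr 1
  simp [Fin.sum_univ_six, cubicCoeff]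
  ring

/-- The operator `∂₂∂₁∂₀`, which reads off the coefficient of `ξ₀ξ₁ξ₂`. -/
def tripleDeriv : Module.End ℝ (euclideanChart 6).Fun :=
  (euclideanChart 6).pd (2 : Fin 6) * (euclideanChart 6).pd (1 : Fin 6) *
    (euclideanChart 6).pd (0 : Fin 6)

theorem tripleDeriv_apply (x : (euclideanChart 6).Fun) :
    tripleDeriv x = ∂ (2 : Fin 6) (∂ (1 : Fin 6) (∂ (0 : Fin 6) x)) := rfl

theorem tripleDeriv_cubic (s t : ℝ) : tripleDeriv (cubic s t) = s • 1 := by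
  rw [tripleDeriv_apply, pd_cubic]
  simp [cubicCoeff, cubicFst, cubicSnd, pd_mul, parity_coord, pd_coord]

theorem tripleDeriv_pd_cubic_mul_coord (s t : ℝ) {i j : Fin 6} (hij : i ≠ j) :
    tripleDeriv (∂ i (cubic s t) * ξ j) = 0 := by
  rw [tripleDeriv_apply, pd_cubic, smul_mul_assoc, map_smul, map_smul, map_smul]
  refine (congrArg (_ • ·) ?_).trans (smul_zero _)
  fin_cases i <;> fin_cases j <;> first
  | exact absurd rfl hij
  | simp [cubicFst, cubicSnd, pd_mul, parity_mul, parity_coord, pd_coord]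

theorem bracket_cubic_coord_mul_coord (s t : ℝ) (i j : Fin 6) :
    (euclideanChart 6).bracket (cubic s t) (ξ i * ξ j) =
      ∂ j (cubic s t) * ξ i - ∂ i (cubic s t) * ξ j := by
  rw [bracket_eq_sum, parity_cubic]
  simp only [pd_coord_mul_coord, map_neg, mul_sub, mul_ite, mul_zero, Finset.sum_sub_distrib,
    Finset.sum_ite_eq', Finset.mem_univ, if_true]
  rw [neg_mul, neg_mul]
  abel

theorem tripleDeriv_bracket_cubic (s t : ℝ) {x : (euclideanChart 6).Fun}
    (hx : x ∈ (euclideanChart 6).homogeneous 2) :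
    tripleDeriv ((euclideanChart 6).bracket (cubic s t) x) = 0 := by
  refine homogeneous_two_le (S := LinearMap.ker
    (tripleDeriv ∘ₗ (euclideanChart 6).bracket (cubic s t))) (fun i j => ?_) hx
  rw [LinearMap.mem_ker, LinearMap.comp_apply]
  by_cases hij : i = j
  · rw [hij, coord_mul_self, map_zero, map_zero]
  · rw [bracket_cubic_coord_mul_coord, map_sub, tripleDeriv_pd_cubic_mul_coord s t hij,
      tripleDeriv_pd_cubic_mul_coord s t (Ne.symm hij), sub_zero]

theorem pd_cubic_eq_zero_or (a : Fin 6) : ∂ a (cubic 1 0) = 0 ∨ ∂ a (cubic 0 1) = 0 := by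
  rw [pd_cubic, pd_cubic]
  fin_cases a <;> simp [cubicCoeff]

theorem edgeOp_tprod_piecewise_cubic {N : ℕ} {S : Finset (Fin N)} {i j : Fin N}
    (hij : i ∈ S ↔ j ∉ S) :
    (euclideanChart 6).edgeOp i j
      (tprod ℝ (S.piecewise (fun _ => cubic 1 0) fun _ => cubic 0 1)) = 0 := by
  refine (euclideanChart 6).edgeOp_tprod_eq_zero fun a b hab => ?_
  obtain rfl : a = b := by_contra fun hne => hab (if_neg hne)
  by_cases hi : i ∈ S
  · have hj := hij.1 hi
    simpa only [Finset.piecewise_eq_of_mem _ _ _ hi, Finset.piecewise_eq_of_notMem _ _ _ hj] using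
      pd_cubic_eq_zero_or a
  · have hj : j ∈ S := by_contra fun hj => hi (hij.2 hj)
    simpa only [Finset.piecewise_eq_of_mem _ _ _ hj, Finset.piecewise_eq_of_notMem _ _ _ hi] using
      (pd_cubic_eq_zero_or a).symm

theorem exists_pair_forall_mem_iff_notMem : ∀ S : Finset (Fin 3), S ≠ Finset.univ → S ≠ ∅ →
    ∃ p q : Fin 3, p ≠ q ∧ ∀ i j : Fin 3, i ≠ j → ¬(i = p ∧ j = q) → ¬(i = q ∧ j = p) →
      (i ∈ S ↔ j ∉ S) := by
  decide

/-- A graph has a nonzero mixed term only if its edges join the two vertices carrying the same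
monomial, and such graphs are detected by the weights `edgeWeight p q`. -/
theorem rep_cubic_add (hd : Odd (2 + 1)) {k : ℕ} {x : Gra (2 + 1) 3 k}
    (hx : ∀ p q, p ≠ q → Gra.weight hd (Gra.edgeWeight p q) x = 0) :
    ((euclideanChart 6).rep x fun _ => cubic 1 1) =
      ((euclideanChart 6).rep x fun _ => cubic 1 0) +
        (euclideanChart 6).rep x fun _ => cubic 0 1 := by
  have mixed_eq_zero (S : Finset (Fin 3)) (hS : S ≠ Finset.univ) (hS' : S ≠ ∅) :
      (euclideanChart 6).rep x (S.piecewise (fun _ => cubic 1 0) fun _ => cubic 0 1) = 0 := by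
    obtain ⟨p, q, hpq, hS⟩ := exists_pair_forall_mem_iff_notMem S hS hS'
    rw [(euclideanChart 6).rep_eq_weight_smul hd hpq
      (fun i j hij hij₁ hij₂ => edgeOp_tprod_piecewise_cubic (hS i j hij hij₁ hij₂)) x,
      hx p q hpq, zero_smul]
  have const_eq : (fun _ : Fin 3 => cubic 1 1) = (fun _ => cubic 1 0) + fun _ => cubic 0 1 := by
    funext _
    rw [Pi.add_apply, cubic_add_cubic, add_zero, zero_add]
  rw [const_eq, MultilinearMap.map_add_univ, Fintype.sum_eq_add Finset.univ ∅ (by decide)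
    fun S hS => mixed_eq_zero S hS.1 hS.2, Finset.piecewise_univ, Finset.piecewise_empty]

end euclideanChart

/-! ### The conformal flow of the theta graph -/

open Polynomial in
theorem sum_filter_eq_of_forall_sum_mul_pow_eq {R ι : Type*} [CommRing R] [IsDomain R] [Infinite R]
    {S : Finset ι} {a : ι → R} {m : ι → ℕ} {c : R} {M : ℕ}
    (h : ∀ r : R, ∑ i ∈ S, a i * r ^ m i = c * r ^ M) : ∑ i ∈ S with m i = M, a i = c := by
  have poly_eq : ∑ i ∈ S, C (a i) * X ^ m i = C c * X ^ M := by
    refine Polynomial.funext fun r => ?_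
    simpa only [eval_finsetSum, eval_mul, eval_C, eval_pow, eval_X] using h r
  have coeff_eq := congrArg (coeff · M) poly_eq
  simp only [finsetSum_coeff, coeff_C_mul_X_pow, if_true] at coeff_eq
  rw [← coeff_eq, Finset.sum_filter]
  exact Finset.sum_congr rfl fun i _ => if_congr eq_comm rfl rfl

namespace DarbouxChart

variable {n : ℕ} (V : DarbouxChart n)

theorem IsClassOf.sub_mem_qCoboundaries {H : V.Ham} {k : ℤ} {f g : V.Fun} {c : V.QCohomology H k}
    (hf : V.IsClassOf f c) (hg : V.IsClassOf g c) : f - g ∈ V.qCoboundaries H k := by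
  obtain ⟨hf, rfl⟩ := hf
  obtain ⟨hg, h⟩ := hg
  exact (Submodule.Quotient.eq ((V.qCoboundaries H k).comap (V.qCocycles H k).subtype)).1 h

theorem rep_zero_apply {N k : ℕ} (f : Fin N → V.Fun) : V.rep (0 : Gra (n + 1) N k) f = 0 := by
  rw [map_zero, zero_apply]

theorem evalAt_eq_rep {γ : GraFamily (n + 1)} {N k : ℕ}
    (h : ∀ N' k', ¬(N' = N ∧ k' = k) → γ N' k' = 0) (f : V.Fun) :
    V.evalAt γ f = V.rep (γ N k) fun _ => f := by
  refine finsum_eq_single _ ((N, k) : ℕ × ℕ) fun p hp => ?_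
  rw [h _ _ fun h => hp (Prod.ext h.1 h.2), rep_zero_apply]

theorem evalAt_smul_right {γ : GraFamily (n + 1)} (hfin : γ ∈ finiteFamilies (n + 1)) (r : ℝ)
    (f : V.Fun) : V.evalAt γ (r • f) =
      ∑ p ∈ Set.Finite.toFinset hfin, r ^ (p.1 + 1) • V.rep (γ p.1 p.2) fun _ => f := by
  rw [evalAt, finsum_eq_sum_of_support_subset (s := Set.Finite.toFinset hfin)]
  · refine Finset.sum_congr rfl fun p _ => ?_
    rw [(V.rep (γ p.1 p.2)).map_smul_univ (fun _ => r) fun _ => f, Finset.prod_const,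
      Finset.card_univ, Fintype.card_fin]
  · refine fun p hp => (Set.Finite.mem_toFinset hfin).2 fun h => Function.mem_support.1 hp ?_
    rw [h, rep_zero_apply]

/-- The graphs with `N + 1` vertices contribute the terms of degree `N + 1` in `f`. -/
theorem map_rep_eq_of_forall_map_evalAt_smul_eq {γ : GraFamily (n + 1)}
    (hfin : γ ∈ finiteFamilies (n + 1)) {ℓ : V.Fun →ₗ[ℝ] ℝ} {f : V.Fun} {c : ℝ} {N k : ℕ}
    (hk : ∀ k', k' ≠ k → γ N k' = 0) (h : ∀ r : ℝ, ℓ (V.evalAt γ (r • f)) = c * r ^ (N + 1)) :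
    ℓ (V.rep (γ N k) fun _ => f) = c := by
  have sum_eq (r : ℝ) : ∑ p ∈ Set.Finite.toFinset hfin,
      ℓ (V.rep (γ p.1 p.2) fun _ => f) * r ^ (p.1 + 1) = c * r ^ (N + 1) := by
    rw [← h, evalAt_smul_right _ hfin, map_sum]
    exact Finset.sum_congr rfl fun p _ => by rw [map_smul, smul_eq_mul, mul_comm]
  rw [← sum_filter_eq_of_forall_sum_mul_pow_eq sum_eq, Finset.sum_eq_single (N, k)]
  · rintro ⟨N', k'⟩ hp hne
    obtain rfl : N' = N := Nat.succ_injective (Finset.mem_filter.1 hp).2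
    rw [hk k' fun hk' => hne (hk' ▸ rfl), rep_zero_apply, map_zero]
  · intro hp
    have eq_zero : γ N k = 0 := by_contra fun hne =>
      hp (Finset.mem_filter.2 ⟨(Set.Finite.mem_toFinset hfin).2 hne, rfl⟩)
    rw [eq_zero, rep_zero_apply, map_zero]

end DarbouxChart

namespace euclideanChart

theorem evalAt_thetaFamily {r : ℕ} (f : (euclideanChart r).Fun) :
    (euclideanChart r).evalAt (Gra.thetaFamily 3) f =
      (euclideanChart r).rep (Gra.theta 3) fun _ => f :=
  (euclideanChart r).evalAt_eq_rep (γ := Gra.thetaFamily 3) (N := 1) (k := 3)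
    (fun _ _ h => Gra.thetaFamily_eq_zero h) f

/-- The coefficient of `ξ₀ξ₁ξ₂` in a function, evaluated at the base point. -/
def tripleCoeff : (euclideanChart 6).Fun →ₗ[ℝ] ℝ :=
  ((euclideanChart 6).eval ⟨0, trivial⟩).toLinearMap ∘ₗ tripleDeriv

theorem tripleCoeff_apply (f : (euclideanChart 6).Fun) :
    tripleCoeff f = (euclideanChart 6).eval ⟨0, trivial⟩ (tripleDeriv f) := rfl

theorem tripleCoeff_cubic (s t : ℝ) : tripleCoeff (cubic s t) = s := by
  rw [tripleCoeff_apply, tripleDeriv_cubic, map_smul, map_one, smul_eq_mul, mul_one]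

theorem tripleCoeff_eq_zero_of_mem_qCoboundaries {s t : ℝ} {f : (euclideanChart 6).Fun}
    (hf : f ∈ (euclideanChart 6).qCoboundaries (cubicHam s t) 3) : tripleCoeff f = 0 := by
  obtain ⟨x, hx, rfl⟩ := hf
  rw [tripleCoeff_apply]
  exact (congrArg _ (tripleDeriv_bracket_cubic s t hx)).trans (map_zero _)

theorem tripleCoeff_evalAt_thetaFamily_mul_cubic (s t : ℝ) :
    tripleCoeff ((euclideanChart 6).evalAt (Gra.thetaFamily 3) (cubic s t) * cubic s t) =
      6 * (s ^ 2 + t ^ 2) * s := by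
  rw [evalAt_thetaFamily, rep_theta_cubic, smul_one_mul, map_smul, tripleCoeff_cubic, smul_eq_mul]

/-- On the cubic functions the flow of the theta graph is a nonadditive cubic expression, whereas
the part of a flow of degree zero that is cubic in `H` is additive on them. -/
theorem not_forall_sub_mem_qCoboundaries {γ : GraFamily 3} (hγ : γ ∈ fgcCocycles 3 0)
    (hfin : γ ∈ finiteFamilies 3) : ¬ ∀ s t : ℝ,
      (euclideanChart 6).evalAt γ (cubic s t) -
          (euclideanChart 6).evalAt (Gra.thetaFamily 3) (cubic s t) * cubic s t ∈
        (euclideanChart 6).qCoboundaries (cubicHam s t) 3 := by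
  intro h
  have hd : Odd (2 + 1) := ⟨1, rfl⟩
  have tripleCoeff_evalAt (s t : ℝ) :
      tripleCoeff ((euclideanChart 6).evalAt γ (cubic s t)) = 6 * (s ^ 2 + t ^ 2) * s := by
    rw [← tripleCoeff_evalAt_thetaFamily_mul_cubic, ← sub_eq_zero, ← map_sub]
    exact tripleCoeff_eq_zero_of_mem_qCoboundaries (h s t)
  have eq_zero_of_ne (k : ℕ) (hk : k ≠ 3) : γ 2 k = 0 := hγ.1.2 2 k <| by
    simp only [fgcDegree]
    push_cast
    lia
  have tripleCoeff_rep (s t : ℝ) : tripleCoeff ((euclideanChart 6).rep (γ 2 3)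
      fun _ => cubic s t) = 6 * (s ^ 2 + t ^ 2) * s :=
    (euclideanChart 6).map_rep_eq_of_forall_map_evalAt_smul_eq hfin eq_zero_of_ne fun r => by
      rw [smul_cubic, tripleCoeff_evalAt]
      ring
  have additive := congrArg tripleCoeff <| rep_cubic_add hd (x := γ 2 3) fun p q hpq =>
    Gra.weight_edgeWeight_eq_zero_of_mem_fgcCocycles hd hγ 3 hpq
  simp only [map_add, tripleCoeff_rep] at additive
  norm_num at additive

theorem exists_conformalFlow_notMem_range
    {Φ : finiteCohomology (2 + 1) (-((2 : ℕ) + 1 : ℤ)) →ₗ[ℝ] (euclideanChart 6).cHFlow}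
    {Φ₀ : finiteCohomology (2 + 1) 0 →ₗ[ℝ] (euclideanChart 6).HFlow}
    (hΦ : (euclideanChart 6).IsConformalFlowMap Φ)
    (hΦ₀ : (euclideanChart 6).IsHamiltonianFlowMap Φ₀) :
    ∃ c, (Φ c : (euclideanChart 6).HFlow) ∉ LinearMap.range Φ₀ := by
  have theta_mem : Gra.thetaFamily 3 ∈ fgcCocycles 3 (-((2 : ℕ) + 1 : ℤ)) :=
    Gra.thetaFamily_mem_fgcCocycles ⟨1, rfl⟩
  refine ⟨cocycleClass ⟨_, theta_mem⟩ (Gra.thetaFamily_mem_finiteFamilies 3), ?_⟩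
  rintro ⟨c, hc⟩
  obtain ⟨⟨γ, hγ⟩, rfl⟩ := finiteCocycleClass_surjective _ _ c
  refine not_forall_sub_mem_qCoboundaries γ.2 hγ fun s t => ?_
  have theta_flow := hΦ ⟨_, theta_mem⟩ (Gra.thetaFamily_mem_finiteFamilies 3) (cubicHam s t)
  rw [← hc] at theta_flow
  exact DarbouxChart.IsClassOf.sub_mem_qCoboundaries _ (hΦ₀ γ hγ (cubicHam s t)) theta_flow

end euclideanChart

end GraphFlow

end

theorem mainTheorem10 :
    (∀ (n : ℕ) (V : GraphFlow.DarbouxChart n),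
      (∀ γ ∈ GraphFlow.fgcCocycles (n + 1) (-((n : ℤ) + 1)), ∀ (N k : ℕ) (H : V.Ham),
        V.rep (γ N k) (fun _ => H.1) ∈ V.homogeneous 0 ∧
          V.bracket H.1 (V.rep (γ N k) (fun _ => H.1)) = 0) ∧
      (∀ γ ∈ GraphFlow.fgcCocycles (n + 1) (-((n : ℤ) + 1)),
        γ ∈ GraphFlow.finiteFamilies (n + 1) → ∀ H : V.Ham,
          V.evalAt γ H.1 ∈ V.homogeneous 0 ∧ V.bracket H.1 (V.evalAt γ H.1) = 0) ∧
      (∃! Φ : GraphFlow.finiteCohomology (n + 1) (-((n : ℤ) + 1)) →ₗ[ℝ] V.cHFlow,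
        V.IsConformalFlowMap Φ) ∧
      (∃! Φ₀ : GraphFlow.finiteCohomology (n + 1) 0 →ₗ[ℝ] V.HFlow,
        V.IsHamiltonianFlowMap Φ₀)) ∧
    (∃ (n : ℕ) (V : GraphFlow.DarbouxChart n)
      (Φ : GraphFlow.finiteCohomology (n + 1) (-((n : ℤ) + 1)) →ₗ[ℝ] V.cHFlow)
      (Φ₀ : GraphFlow.finiteCohomology (n + 1) 0 →ₗ[ℝ] V.HFlow),
      V.IsConformalFlowMap Φ ∧ V.IsHamiltonianFlowMap Φ₀ ∧
        ¬ Function.Surjective Φ₀ ∧ ∃ c, (Φ c : V.HFlow) ∉ LinearMap.range Φ₀) := by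
  refine ⟨fun n V => ⟨fun γ hγ N k H => ?_, fun γ hγ hfin H => ?_,
    V.existsUnique_isConformalFlowMap, V.existsUnique_isHamiltonianFlowMap⟩, ?_⟩
  · exact V.rep_mem_qCocycles (neg_add_cancel _) hγ N k H
  · exact V.evalAt_mem_qCocycles (neg_add_cancel _) hγ hfin H
  · obtain ⟨Φ, hΦ, -⟩ := (GraphFlow.euclideanChart 6).existsUnique_isConformalFlowMap
    obtain ⟨Φ₀, hΦ₀, -⟩ := (GraphFlow.euclideanChart 6).existsUnique_isHamiltonianFlowMap
    obtain ⟨c, hc⟩ := GraphFlow.euclideanChart.exists_conformalFlow_notMem_range hΦ hΦ₀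
    exact ⟨2, GraphFlow.euclideanChart 6, Φ, Φ₀, hΦ, hΦ₀, fun hsurj => hc (hsurj _), c, hc⟩
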